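/- **Creased papers.** A *developable orthodiagonal creased paper* with $n\ge 1$ inner rows and $m\ge 1$ inner columns is a planar quadrilateral crease pattern with vertices $V_{ij}$ ($0\le i\le n+1$, $0\le j\le m+1$; the inner vertices are those with $1\le i\le n$, $1\le j\le m$). Its columns are parallel straight lines, its creases meet only at vertices, and the sector angles at the inner vertex $V_{ij}$ are, in cyclic order, $\alpha_{i,j-1},\ \alpha_{ij},\ \pi-\alpha_{ij},\ \pi-\alpha_{i,j-1}$ (the first two lie on one side, to the left and to the right of the column: the upper side for odd $j$, the lower side for even $j$), where $\alpha_{ij}\neq\pi/2$ and $\tan\alpha_{ij}/\tan\alpha_{i,j+1}=\tan\alpha_{i+1,j}/\tan\alpha_{i+1,j+1}$. Assume moreover that $(\alpha_{1j}-\frac\pi2)(\alpha_{10}-\frac\pi2)>0$ and $|\alpha_{1j}-\frac\pi2|<|\alpha_{10}-\frac\pi2|$ for $1\le j\le m$. A *folded state* is a map of the vertices to $\mathbb R^3$ that moves each panel rigidly; two adjacent panels *clash* if they lie in one half-plane bounded by their common crease. (Intersections of non-adjacent panels are not excluded.) A *final state* is a folded state in which, for every $i\in[1,n]$, the two panels left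 of the first inner column that meet at row $i$ clash, while no other adjacent panels clash. For $\beta\in(0,\pi)$ let $\cos\xi(\alpha,\beta)=\frac{4\cos^2\alpha}{1-\cos\beta}-1$, $\xi\in[0,\pi]$, and let $$A(\xi,\theta)=\begin{pmatrix}1&-1/\tan\xi\\0&1/\sin\xi\end{pmatrix}\begin{pmatrix}\cos\theta&\sin\theta\\-\sin\theta&\cos\theta\end{pmatrix}.$$ **(1) Rows.** Consider a final state of such a paper, let $\beta_i$ be the angle of the folded first inner column at its vertex in row $i$, and let $1\le l<r\le m+1$ be such that $\alpha_{1,j+1}=\alpha_{1j}$ for $l\le j<r-1$. Then $\alpha_{ij}=\alpha_{il}$ for all $i\in[1,n]$ and $l\le j<r$. With $\xi_i=\xi(\alpha_{il},\beta_i)$, the angle between consecutive creases of row $i$ at the vertices in columns $l<j<r$ is $\xi_i$. The first inner column lies in a plane $E$, and for every $\theta$ there are Cartesian coordinates in planes perpendicular to $E$ in which the part of row $i$ in columns $l,\dots,r$, with origin at its vertex in column $l$, has its vertices at points $g_i(j)$ with $$g_i(j)=\frac{\sin\alpha_{1l}}{\sin\alpha_{il}}\,A(\xi_i,\theta)^{-1}A(\xi_1,\theta)\,g_1(j),$$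 where $A(\xi_i,\theta)g_i(j)$ has nondecreasing first and nonincreasing second coordinate in $j$. **(2) Approximation.** Let $\Gamma:[a,b]\to\mathbb R^2$ ($a<b$) be a $C^2$ curve with nonvanishing derivative (the datum curve), regarded as a curve in the plane $\mathbb R^2\times 0$ of $\mathbb R^3$ with unit tangent $T(u)$, and put $N=(0,0,1)$. Let $\beta:[a,b]\to(0,\pi)$ be $C^1$ and let $\alpha_0=(\pi+\beta)/2$ on $[a,b]$ or $\alpha_0=(\pi-\beta)/2$ on $[a,b]$. Let $k$ range over a nonempty, finite or infinite, initial segment of $\mathbb N$. For each $k$ let $\theta_k\in\mathbb R$; let $\alpha_k:[a,b]\to(0,\pi)$ be such that $\tan\alpha_0/\tan\alpha_k$ is constant, $(\alpha_k(a)-\frac\pi2)(\alpha_0(a)-\frac\pi2)>0$ and $|\alpha_k(a)-\frac\pi2|<|\alpha_0(a)-\frac\pi2|$; put $\xi_k(u)=\xi(\alpha_k(u),\beta(u))$; and let $f_k:[a_k,b_k]\to\mathbb R^2$ ($a_k\le b_k$) be continuous such that $A(\xi_k(a),\theta_k)f_k$ has nondecreasing first and nonincreasing second coordinate. Let $$\widetilde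 f_{k,u}(t)=\frac{\sin\alpha_k(a)}{\sin\alpha_k(u)}\,A(\xi_k(u),\theta_k)^{-1}A(\xi_k(a),\theta_k)\,f_k(t),$$ placed in the plane spanned by $T(u)$ and $N$ (it contains the tangent of $\Gamma$ and is perpendicular to the plane of $\Gamma$) by means of the Cartesian coordinates in which, with $\omega=\theta_k+\xi_k(u)/2$, the vector $(\cos\omega,\sin\omega)$ is $T(u)$ and $(\sin\omega,-\cos\omega)$ is $N$. Let $r_k(u,t)=\Gamma(u)+\widetilde f_{k,u}(t)$ be the $k$-th piece. Assume that $f_0(a_0)=0$, that the pieces are stitched in the transverse direction, i.e. $r_{k+1}(u,a_{k+1})=r_k(u,b_k)$ for all $u$, that the union $S$ of the pieces is bounded, and that the creases of different rows do not cross, in the sense that the angle between $\partial_u r_k(u,t)$ and $T(u)$ is less than $(\pi-\beta(u))/2$ for all $k,u,t$. Then for every $\varepsilon>0$ there is a developable orthodiagonal creased paper as above (with finitely many creases) with a continuous rigid folding motion from its planar state (time $0$) to a final state (time $1$) such that no adjacent panels clash before time $1$, states at different times are not congruent, and the motion has one degree of freedom (at every time in $(0,1)$, all sufficiently near folded states are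 congruent to states of the motion), and such that: * the panel columns $1,\dots,m$ (panel column $j$ lies between columns $j$ and $j+1$) are assigned in order to pieces, $j\mapsto k(j)$ nondecreasing, with $\alpha_{1,j+1}=\alpha_{1j}$ within each piece; * there are $u_1\le\dots\le u_n$ in $[a,b]$ with $|\beta_i-\beta(u_i)|\le\varepsilon$, $|\alpha_{i0}-\alpha_0(u_i)|\le\varepsilon$ and $|\alpha_{ij}-\alpha_{k(j)}(u_i)|\le\varepsilon$ for $1\le i\le n$, $1\le j\le m$; * in the final state, the set of vertices of the first inner column has Hausdorff distance at most $\varepsilon$ from $\Gamma([a,b])$, the set of vertices of row $i$ in columns $1,\dots,m+1$ has Hausdorff distance at most $\varepsilon$ from $\bigcup_k r_k(\{u_i\}\times[a_k,b_k])$ for each $i\in[1,n]$, and the folded paper has Hausdorff distance at most $\varepsilon$ from $S$. -/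

import Mathlib

open scoped Matrix EuclideanGeometry

noncomputable section

/-! ### Developable orthodiagonal creased papers -/

/-- The point of the plane in column `v.2` and row `v.1`, for columns at the abscissas `X j` and
vertices at the heights `Y i j`. -/
def gridPoint (X : ℕ → ℝ) (Y : ℕ → ℕ → ℝ) (v : ℕ × ℕ) : EuclideanSpace ℝ (Fin 2) :=
  !₂[X v.2, Y v.1 v.2]

/-- The row of the neighbour, on the same column, from which the labelled sector angles at the
vertex `(i, j)` are measured: the upper neighbour on odd columns, the lower one on even columns. -/
def labelRow (i j : ℕ) : ℕ := if Odd j then i - 1 else i + 1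

/-- A creased paper of the developable orthodiagonal type, in its planar state.
The vertices `(i, j)` have `i ≤ rows + 1` and `j ≤ cols + 1`; the inner vertices are those with
`1 ≤ i ≤ rows` and `1 ≤ j ≤ cols`, the other ones lie on the boundary. The columns are parallel
(vertical) straight lines, numbered from the left; rows are numbered from the top. The inequalities
`X_lt` and `Y_lt` say that the crease pattern is embedded: creases meet only at vertices.
At an inner vertex `(i, j)` the column is a straight line, and the sector angles on one side
(above on odd columns, below on even ones) are `α i (j - 1)` to the left and `α i j` to the right;
hence those on the other side are their supplements. -/
structure OrthodiagonalPaper where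
  rows : ℕ
  cols : ℕ
  X : ℕ → ℝ
  Y : ℕ → ℕ → ℝ
  α : ℕ → ℕ → ℝ
  one_le_rows : 1 ≤ rows
  one_le_cols : 1 ≤ cols
  X_lt : ∀ j ≤ cols, X j < X (j + 1)
  Y_lt : ∀ i ≤ rows, ∀ j ≤ cols + 1, Y (i + 1) j < Y i j
  sector_left : ∀ i ∈ Set.Icc 1 rows, ∀ j ∈ Set.Icc 1 cols,
    ∠ (gridPoint X Y (labelRow i j, j)) (gridPoint X Y (i, j)) (gridPoint X Y (i, j - 1))
      = α i (j - 1)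
  sector_right : ∀ i ∈ Set.Icc 1 rows, ∀ j ∈ Set.Icc 1 cols,
    ∠ (gridPoint X Y (labelRow i j, j)) (gridPoint X Y (i, j)) (gridPoint X Y (i, j + 1))
      = α i j
  α_ne : ∀ i ∈ Set.Icc 1 rows, ∀ j ≤ cols, α i j ≠ Real.pi / 2
  tan_ratio : ∀ i j, 1 ≤ i → i + 1 ≤ rows → j + 1 ≤ cols →
    Real.tan (α i j) / Real.tan (α i (j + 1))
      = Real.tan (α (i + 1) j) / Real.tan (α (i + 1) (j + 1))

namespace OrthodiagonalPaper

variable (P : OrthodiagonalPaper)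

/-- The position of a vertex in the planar state. -/
def vertex (v : ℕ × ℕ) : EuclideanSpace ℝ (Fin 2) := gridPoint P.X P.Y v

/-- The index set of the vertices. -/
def grid : Set (ℕ × ℕ) := {v | v.1 ≤ P.rows + 1 ∧ v.2 ≤ P.cols + 1}

/-- The corners of the panel between rows `i`, `i + 1` and columns `j`, `j + 1`. -/
def corners (i j : ℕ) : Set (ℕ × ℕ) := {(i, j), (i + 1, j), (i, j + 1), (i + 1, j + 1)}

/-- `F` gives the vertices of a rigidly folded state: every panel is moved rigidly. -/
def IsFolded (F : ℕ × ℕ → EuclideanSpace ℝ (Fin 3)) : Prop :=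
  ∀ i ≤ P.rows, ∀ j ≤ P.cols, ∀ v ∈ corners i j, ∀ w ∈ corners i j,
    dist (F v) (F w) = dist (P.vertex v) (P.vertex w)

/-- The folded paper: the union of the folded panels. -/
def foldedSet (F : ℕ × ℕ → EuclideanSpace ℝ (Fin 3)) : Set (EuclideanSpace ℝ (Fin 3)) :=
  ⋃ i ∈ Set.Iic P.rows, ⋃ j ∈ Set.Iic P.cols, convexHull ℝ (F '' corners i j)

/-- Two folded states differ by a rigid motion or a reflection of space. -/
def SameShape (F G : ℕ × ℕ → EuclideanSpace ℝ (Fin 3)) : Prop :=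
  ∀ v ∈ P.grid, ∀ w ∈ P.grid, dist (F v) (F w) = dist (G v) (G w)

/-- The two panels at the crease from `(i, j)` to `(i, j + 1)` clash: the fold is complete, the
panels lie in one half-plane bounded by the crease. -/
def RowClash (F : ℕ × ℕ → EuclideanSpace ℝ (Fin 3)) (i j : ℕ) : Prop :=
  (line[ℝ, F (i, j), F (i, j + 1)]).SSameSide (F (i - 1, j)) (F (i + 1, j))

/-- The two panels at the crease from `(i, j)` to `(i + 1, j)` clash. -/
def ColClash (F : ℕ × ℕ → EuclideanSpace ℝ (Fin 3)) (i j : ℕ) : Prop :=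
  (line[ℝ, F (i, j), F (i + 1, j)]).SSameSide (F (i, j - 1)) (F (i, j + 1))

/-- No two adjacent panels clash. -/
def IsUnclashed (F : ℕ × ℕ → EuclideanSpace ℝ (Fin 3)) : Prop :=
  (∀ i ∈ Set.Icc 1 P.rows, ∀ j ≤ P.cols, ¬ RowClash F i j) ∧
  (∀ i ≤ P.rows, ∀ j ∈ Set.Icc 1 P.cols, ¬ ColClash F i j)

/-- A folded state in which the panels to the left of the first inner column clash along all
inner row creases there, and no other adjacent panels clash. -/
def IsFinal (F : ℕ × ℕ → EuclideanSpace ℝ (Fin 3)) : Prop :=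
  P.IsFolded F ∧
  (∀ i ∈ Set.Icc 1 P.rows, RowClash F i 0) ∧
  (∀ i ∈ Set.Icc 1 P.rows, ∀ j ∈ Set.Icc 1 P.cols, ¬ RowClash F i j) ∧
  (∀ i ≤ P.rows, ∀ j ∈ Set.Icc 1 P.cols, ¬ ColClash F i j)

/-- The choice of the sector angles of the first row for which the motion halts at the left. -/
def HaltingAngles : Prop :=
  ∀ j ∈ Set.Icc 1 P.cols,
    0 < (P.α 1 j - Real.pi / 2) * (P.α 1 0 - Real.pi / 2) ∧
    |P.α 1 j - Real.pi / 2| < |P.α 1 0 - Real.pi / 2|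

/-- `φ` is a rigid folding motion with one degree of freedom from the planar state (time `0`) to
a final state (time `1`) at which it halts because panels clash. -/
structure IsHaltingMotion (φ : ℝ → ℕ × ℕ → EuclideanSpace ℝ (Fin 3)) : Prop where
  continuous : ∀ v ∈ P.grid, ContinuousOn (fun s => φ s v) (Set.Icc 0 1)
  folded : ∀ s ∈ Set.Icc (0 : ℝ) 1, P.IsFolded (φ s)
  planar : ∀ v ∈ P.grid, ∀ w ∈ P.grid, dist (φ 0 v) (φ 0 w) = dist (P.vertex v) (P.vertex w)
  injective : ∀ s ∈ Set.Icc (0 : ℝ) 1, ∀ s' ∈ Set.Icc (0 : ℝ) 1,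
    P.SameShape (φ s) (φ s') → s = s'
  one_dof : ∀ s ∈ Set.Ioo (0 : ℝ) 1, ∃ η > 0, ∀ G : ℕ × ℕ → EuclideanSpace ℝ (Fin 3),
    P.IsFolded G → (∀ v ∈ P.grid, dist (G v) (φ s v) < η) →
      ∃ s' ∈ Set.Icc (0 : ℝ) 1, P.SameShape G (φ s')
  unclashed : ∀ s ∈ Set.Ico (0 : ℝ) 1, P.IsUnclashed (φ s)
  final : P.IsFinal (φ 1)

end OrthodiagonalPaper

/-- The angle, at row `i`, of the first inner column of a folded state. -/
def columnAngle (F : ℕ × ℕ → EuclideanSpace ℝ (Fin 3)) (i : ℕ) : ℝ :=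
  ∠ (F (i - 1, 1)) (F (i, 1)) (F (i + 1, 1))

/-! ### The affine relation between the target curves -/

/-- The angle `ξ ∈ [0, π]` with `cos ξ = 4 cos² α / (1 - cos β) - 1`. -/
def creaseAngle (α β : ℝ) : ℝ :=
  Real.arccos (4 * Real.cos α ^ 2 / (1 - Real.cos β) - 1)

/-- The matrix `A(ξ, θ)`: rotation, then shear; it maps the directions of polar angles `θ` and
`θ + ξ` to the two coordinate axes. -/
def shearRotation (ξ θ : ℝ) : Matrix (Fin 2) (Fin 2) ℝ :=
  !![1, -1 / Real.tan ξ; 0, 1 / Real.sin ξ] *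
    !![Real.cos θ, Real.sin θ; -Real.sin θ, Real.cos θ]

/-- The matrix `(sin α₁ / sin α) A(ξ, θ)⁻¹ A(ξ₁, θ)`, where `ξ₁`, `ξ` belong to `α₁, β₁` and
to `α, β`. -/
def rowMatrix (α₁ β₁ α β θ : ℝ) : Matrix (Fin 2) (Fin 2) ℝ :=
  (Real.sin α₁ / Real.sin α) •
    ((shearRotation (creaseAngle α β) θ)⁻¹ * shearRotation (creaseAngle α₁ β₁) θ)

/-! ### The target surfaces -/

/-- The plane of the datum curve inside space. -/
def liftPlane (v : EuclideanSpace ℝ (Fin 2)) : EuclideanSpace ℝ (Fin 3) := !₂[v 0, v 1, 0]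

/-- The unit normal of the plane of the datum curve. -/
def planeNormal : EuclideanSpace ℝ (Fin 3) := !₂[0, 0, 1]

/-- The unit tangent vector of a plane curve on `[a, b]`, in space. -/
def unitTangent (Γ : ℝ → EuclideanSpace ℝ (Fin 2)) (a b u : ℝ) : EuclideanSpace ℝ (Fin 3) :=
  liftPlane (‖derivWithin Γ (Set.Icc a b) u‖⁻¹ • derivWithin Γ (Set.Icc a b) u)

/-- The data of one piece besides those of the datum curve: the sector angle `α u` along the datum
curve, the rotation angle `θ`, and the first target curve `f` on the interval `[lo, hi]`. -/
structure SurfacePiece where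
  lo : ℝ
  hi : ℝ
  θ : ℝ
  α : ℝ → ℝ
  f : ℝ → Fin 2 → ℝ

namespace SurfacePiece

variable (p : SurfacePiece)

/-- The plane coordinates of the target curve at `u`; `a` is the parameter of the first row. -/
def targetCurve (a : ℝ) (β : ℝ → ℝ) (u t : ℝ) : Fin 2 → ℝ :=
  rowMatrix (p.α a) (β a) (p.α u) (β u) p.θ *ᵥ p.f t

/-- The target curve at `u` in space, in the plane that contains the tangent of the datum curve at
`u` and is perpendicular to the plane of the datum curve. The Cartesian frame of that plane is the
one in which the crease directions, of polar angles `θ` and `θ + ξ + π`, are mirror images of each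
other in the normal of the plane of the datum curve. -/
def spaceCurve (Γ : ℝ → EuclideanSpace ℝ (Fin 2)) (a b : ℝ) (β : ℝ → ℝ) (u t : ℝ) :
    EuclideanSpace ℝ (Fin 3) :=
  let ω := p.θ + creaseAngle (p.α u) (β u) / 2
  let g := p.targetCurve a β u t
  (g 0 * Real.cos ω + g 1 * Real.sin ω) • unitTangent Γ a b u +
    (g 0 * Real.sin ω - g 1 * Real.cos ω) • planeNormal

/-- The parametrization `r(u, t) = Γ(u) + f̃_u(t)` of the piece. -/
def param (Γ : ℝ → EuclideanSpace ℝ (Fin 2)) (a b : ℝ) (β : ℝ → ℝ) (u t : ℝ) :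
    EuclideanSpace ℝ (Fin 3) :=
  liftPlane (Γ u) + p.spaceCurve Γ a b β u t

/-- The conditions on one piece: `α₀` and `β` are the sector angle to the left of the datum curve
and the angle between adjacent creases along it. -/
structure Admissible (Γ : ℝ → EuclideanSpace ℝ (Fin 2)) (a b : ℝ) (α₀ β : ℝ → ℝ) : Prop where
  le : p.lo ≤ p.hi
  /-- The sector angles satisfy the compatibility condition of the orthodiagonal type. -/
  α_mem : ∀ u ∈ Set.Icc a b, p.α u ∈ Set.Ioo 0 Real.pi
  tan_ratio : ∀ u ∈ Set.Icc a b, ∀ v ∈ Set.Icc a b,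
    Real.tan (α₀ u) / Real.tan (p.α u) = Real.tan (α₀ v) / Real.tan (p.α v)
  /-- The choice of the sector angle in the first row. -/
  same_side : 0 < (p.α a - Real.pi / 2) * (α₀ a - Real.pi / 2)
  closer : |p.α a - Real.pi / 2| < |α₀ a - Real.pi / 2|
  /-- The first target curve is continuous, and monotone decreasing after the affine map. -/
  continuousOn : ContinuousOn p.f (Set.Icc p.lo p.hi)
  monotoneOn : MonotoneOn
    (fun t => (shearRotation (creaseAngle (p.α a) (β a)) p.θ *ᵥ p.f t) 0) (Set.Icc p.lo p.hi)
  antitoneOn : AntitoneOn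
    (fun t => (shearRotation (creaseAngle (p.α a) (β a)) p.θ *ᵥ p.f t) 1) (Set.Icc p.lo p.hi)
  /-- The condition that keeps the creases of different rows from crossing: the column curves
  `r(·, t)` run, at each `u`, strictly between the two crease directions of the datum column. -/
  noncrossing : ∀ u ∈ Set.Icc a b, ∀ t ∈ Set.Icc p.lo p.hi,
    InnerProductGeometry.angle
      (derivWithin (fun v => p.param Γ a b β v t) (Set.Icc a b) u) (unitTangent Γ a b u)
        < (Real.pi - β u) / 2

end SurfacePiece

/-- The curve at `u` of the stitched surface: the union of those of the pieces with index below
`K ≤ ∞`. -/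
def stitchedCurve (K : ℕ∞) (p : ℕ → SurfacePiece) (Γ : ℝ → EuclideanSpace ℝ (Fin 2)) (a b : ℝ)
    (β : ℝ → ℝ) (u : ℝ) : Set (EuclideanSpace ℝ (Fin 3)) :=
  {x | ∃ k : ℕ, (k : ℕ∞) < K ∧ ∃ t ∈ Set.Icc (p k).lo (p k).hi, x = (p k).param Γ a b β u t}

/-- The surface stitched from the pieces with index below `K ≤ ∞`. -/
def stitchedSurface (K : ℕ∞) (p : ℕ → SurfacePiece) (Γ : ℝ → EuclideanSpace ℝ (Fin 2)) (a b : ℝ)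
    (β : ℝ → ℝ) : Set (EuclideanSpace ℝ (Fin 3)) :=
  ⋃ u ∈ Set.Icc a b, stitchedCurve K p Γ a b β u

end

/-!
Both halves of the theorem rest on one feature of these papers: all panels are trapezoids whose
parallel sides are column creases. In a folded state the column creases between two neighbouring
rows are therefore parallel (`IsFolded.exists_isDirection`), and a folded state is encoded by one
unit vector `D i` for each `i`, the creases of a row having prescribed scalar products with the two
directions above and below it (`isFolded_of_directions`). In terms of cotangents the sector angles
are products, `cot α_ij = cot α_i0 * ratio j` with `ratio j` independent of the row (`cot_eq`).

*Rows.* Where the two leftmost panels at row `i` clash, the row crease between them bisects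
`D (i - 1)` and `D i` (`IsFolded.direction_add_of_rowClash`). As it is shared by these panels, all
the `D i` lie in one plane, and every row `i` runs in the plane spanned by the bisector of
`D (i - 1)`, `D i` and the normal of that plane (`IsFinal.exists_frame`). Where the sector angles do
not change along a row, its creases alternate between two directions that are mirror images of each
other in the line of the normal, since otherwise two panels on the two sides of a column would clash
(`normal_component_eq`). The matrix `A(ξ, θ)` takes these two directions to the coordinate axes, so
that the row becomes a staircase, whose steps are the panel widths of one parity; the scale
`1 / sin α` is all that depends on the row (`OrthodiagonalPaper.rows_of_final_state`).

*Folding motions.* For cotangents `σ * z i * d j` with `d 0 = 1` and `d j < 1` for `j ≥ 1`, there is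
an explicit motion in the product of the complex plane and a line (`PaperData.motion`): at time `κ`
the first column turns at row `i` by the angle whose half has the tangent `± κ / z i`, and a row
crease in panel column `j` of width `w j` rises by `w j * √(1 - d j ^ 2 * κ ^ 2)`. It is planar at
`κ = 0`; at `κ = 1` exactly the leftmost panels have stopped rising, which means that they clash.
Up to congruence, a nearby folded state is determined by the angle of the first two column
directions, because each further direction is a mirror image of the previous one in the plane of two
row creases (`PaperData.eventually_sameShape`, `PaperData.isHaltingMotion`).

*Approximation.* Written in the same coordinates, the piece `k` of the surface is
`Γ u + x_k(t) g u` at the height `y_k(t)`, where `g u` is the tangent of `Γ` divided by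
`cos (β u / 2)`, and where the profile curve `(x_k, y_k)` does not depend on `u`
(`SurfacePiece.Admissible.param_eq`). Hence the two directions can be discretized separately.

In the transverse direction, finitely many pieces suffice up to `ε`, because the profile is bounded
(`exists_finite_pieces`). In oblique coordinates along the two crease directions of its piece the
profile is monotone, so that it can be replaced by a zigzag with small steps in these directions
(`ProfileData.exists_zigzag`); steps of width zero are avoided by making all of them a little
longer.

In the direction of the datum curve, the first column has a vertex at each node of a subdivision of
`[a, b]`, and from one node to the next one it runs in two creases, the first of which has the
direction belonging to `β` at the former node and the second that at the latter
(`SpineData.exists_rows`). All columns have to be embedded: the length of a crease of column `j` is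
an affine function of the shift of this column, so it suffices to consider the two extreme shifts.
There the length is positive if the chord between the two nodes lies between the two crease
directions, and for a fine subdivision this follows from the same property of the tangent of the
shifted curve, which is the hypothesis that creases of different rows do not cross
(`SurfacePiece.Admissible.inCone`, `SpineData.exists_chord_pos`). The hypothesis is an open
condition, which leaves room for the deviation of the zigzag from the profile
(`InCone.exists_margin`).

The paper with these rows and columns (`Mesh.paperData`) has the motion above, and in its final
state the vertices lie close to the corresponding points of the surface
(`Mesh.dist_final_target`); since the panels are small, so does the rest of the folded paper
(`exists_paper_of_stitchedSurface`).
-/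

open scoped Matrix EuclideanGeometry

noncomputable section

local notation "E3" => EuclideanSpace ℝ (Fin 3)

/-! ### Rigid trapezoids and the directions of the folded columns -/

/-- The scalar products of difference vectors are determined by the mutual distances. -/
lemma inner_sub_sub_eq_of_dist_eq {E E' : Type*} [NormedAddCommGroup E] [InnerProductSpace ℝ E]
    [NormedAddCommGroup E'] [InnerProductSpace ℝ E'] {a b c : E} {a' b' c' : E'}
    (hb : dist a b = dist a' b') (hc : dist a c = dist a' c') (hbc : dist b c = dist b' c') :
    inner ℝ (b - a) (c - a) = inner ℝ (b' - a') (c' - a') := by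
  rw [real_inner_eq_norm_mul_self_add_norm_mul_self_sub_norm_sub_mul_self_div_two,
    real_inner_eq_norm_mul_self_add_norm_mul_self_sub_norm_sub_mul_self_div_two,
    sub_sub_sub_cancel_right, sub_sub_sub_cancel_right, ← dist_eq_norm, ← dist_eq_norm,
    ← dist_eq_norm, ← dist_eq_norm, ← dist_eq_norm, ← dist_eq_norm, dist_comm b, dist_comm c,
    dist_comm b', dist_comm c', hb, hc, hbc]

lemma norm_sq_comb_sub {E : Type*} [NormedAddCommGroup E] [InnerProductSpace ℝ E]
    (x y z : E) (k : ℝ) :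
    ‖z - y - k • x‖ ^ 2 = inner ℝ z z + inner ℝ y y + k ^ 2 * inner ℝ x x - 2 * inner ℝ y z
      - 2 * k * inner ℝ x z + 2 * k * inner ℝ x y := by
  rw [← real_inner_self_eq_norm_sq]
  simp only [inner_sub_left, inner_sub_right, inner_smul_left, inner_smul_right,
    RCLike.conj_to_real]
  rw [real_inner_comm z y, real_inner_comm z x, real_inner_comm y x]
  ring

/-- Linear relations of the form `d - c = k (b - a)` are preserved by isometries of four points. -/
lemma sub_eq_smul_sub_of_dist_eq {E E' : Type*} [NormedAddCommGroup E] [InnerProductSpace ℝ E]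
    [NormedAddCommGroup E'] [InnerProductSpace ℝ E'] {a b c d : E} {a' b' c' d' : E'} {k : ℝ}
    (hab : dist a b = dist a' b') (hac : dist a c = dist a' c') (had : dist a d = dist a' d')
    (hbc : dist b c = dist b' c') (hbd : dist b d = dist b' d') (hcd : dist c d = dist c' d')
    (h : d' - c' = k • (b' - a')) : d - c = k • (b - a) := by
  have h0 : ‖(d' - a') - (c' - a') - k • (b' - a')‖ ^ 2 = 0 := by
    rw [sub_sub_sub_cancel_right, h, sub_self, norm_zero]; norm_num
  have h1 : ‖(d - a) - (c - a) - k • (b - a)‖ ^ 2 = 0 := by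
    rw [norm_sq_comb_sub] at h0 ⊢
    rw [← inner_sub_sub_eq_of_dist_eq had had (by simp),
      ← inner_sub_sub_eq_of_dist_eq hac hac (by simp),
      ← inner_sub_sub_eq_of_dist_eq hab hab (by simp), ← inner_sub_sub_eq_of_dist_eq hac had hcd,
      ← inner_sub_sub_eq_of_dist_eq hab had hbd,
      ← inner_sub_sub_eq_of_dist_eq hab hac hbc] at h0
    exact h0
  have h2 : (d - a) - (c - a) - k • (b - a) = 0 := by simpa using h1
  rw [sub_sub_sub_cancel_right] at h2
  exact sub_eq_zero.1 h2

namespace OrthodiagonalPaper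

variable (P : OrthodiagonalPaper)

/-- `D i` is the direction, from top to bottom, of all column creases between the rows `i` and
`i + 1` of the folded state `F`. -/
structure IsDirection (F : ℕ × ℕ → E3) (D : ℕ → E3) : Prop where
  norm_eq : ∀ i ≤ P.rows, ‖D i‖ = 1
  sub_eq : ∀ i ≤ P.rows, ∀ j ≤ P.cols + 1,
    F (i + 1, j) - F (i, j) = (P.Y i j - P.Y (i + 1) j) • D i

variable {P} {F : ℕ × ℕ → E3} {D : ℕ → E3}

/-- The column creases between two rows are parallel in every folded state, since the panels are
trapezoids. -/
theorem IsFolded.exists_isDirection (hF : P.IsFolded F) : ∃ D, P.IsDirection F D := by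
  have hpos : ∀ i ≤ P.rows, ∀ j ≤ P.cols + 1, 0 < P.Y i j - P.Y (i + 1) j :=
    fun i hi j hj => sub_pos.2 (P.Y_lt i hi j hj)
  refine ⟨fun i => (P.Y i 0 - P.Y (i + 1) 0)⁻¹ • (F (i + 1, 0) - F (i, 0)), ?_, ?_⟩
  · intro i hi
    have h := hF i hi 0 (Nat.zero_le _) (i, 0) (by simp [corners]) (i + 1, 0) (by simp [corners])
    rw [norm_smul, ← dist_eq_norm, dist_comm, h]
    have : dist (P.vertex (i, 0)) (P.vertex (i + 1, 0)) = P.Y i 0 - P.Y (i + 1) 0 := by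
      rw [EuclideanSpace.dist_eq]
      simp only [vertex, gridPoint, Fin.sum_univ_two, Real.dist_eq, sq_abs]
      simp [abs_of_pos (hpos i hi 0 (by omega)), Real.sqrt_sq_eq_abs]
    rw [this, Real.norm_eq_abs, abs_inv, abs_of_pos (hpos i hi 0 (by omega))]
    exact inv_mul_cancel₀ (hpos i hi 0 (by omega)).ne'
  · intro i hi j
    induction j with
    | zero =>
      intro hj
      simp only [smul_smul]
      rw [mul_inv_cancel₀ (hpos i hi 0 hj).ne', one_smul]
    | succ j ih =>
      intro hj
      have ih' := ih (by omega)
      have H := hF i hi j (by omega)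
      have key : F (i + 1, j + 1) - F (i, j + 1) =
          ((P.Y i (j + 1) - P.Y (i + 1) (j + 1)) / (P.Y i j - P.Y (i + 1) j)) •
            (F (i + 1, j) - F (i, j)) := by
        refine sub_eq_smul_sub_of_dist_eq (a' := P.vertex (i, j)) (b' := P.vertex (i + 1, j))
          (c' := P.vertex (i, j + 1)) (d' := P.vertex (i + 1, j + 1)) ?_ ?_ ?_ ?_ ?_ ?_ ?_
        any_goals exact H _ (by simp [corners]) _ (by simp [corners])
        ext k
        fin_cases k
        · simp [vertex, gridPoint]
        · have := (hpos i hi j (by omega)).ne'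
          simp only [vertex, gridPoint, PiLp.sub_apply, PiLp.smul_apply, smul_eq_mul]
          simp only [Fin.mk_one, Matrix.cons_val_one, Matrix.cons_val_fin_one]
          rw [← neg_sub (P.Y i j), mul_neg, div_mul_cancel₀ _ this, neg_sub]
      rw [key, ih', smul_smul, div_mul_cancel₀ _ (hpos i hi j (by omega)).ne']

lemma inner_vertex_sub (v w x : ℕ × ℕ) :
    inner ℝ (P.vertex v - P.vertex x) (P.vertex w - P.vertex x) =
      (P.X v.2 - P.X x.2) * (P.X w.2 - P.X x.2)
        + (P.Y v.1 v.2 - P.Y x.1 x.2) * (P.Y w.1 w.2 - P.Y x.1 x.2) := by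
  simp [vertex, gridPoint, PiLp.inner_apply, Fin.sum_univ_two, mul_comm]

lemma IsFolded.inner_eq (hF : P.IsFolded F) {i j : ℕ} (hi : i ≤ P.rows) (hj : j ≤ P.cols)
    {v w x : ℕ × ℕ} (hv : v ∈ corners i j) (hw : w ∈ corners i j) (hx : x ∈ corners i j) :
    inner ℝ (F v - F x) (F w - F x) =
      (P.X v.2 - P.X x.2) * (P.X w.2 - P.X x.2)
        + (P.Y v.1 v.2 - P.Y x.1 x.2) * (P.Y w.1 w.2 - P.Y x.1 x.2) := by
  rw [← inner_vertex_sub]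
  exact inner_sub_sub_eq_of_dist_eq (hF i hi j hj _ hx _ hv) (hF i hi j hj _ hx _ hw)
    (hF i hi j hj _ hv _ hw)

lemma IsFolded.inner_row_lower (hF : P.IsFolded F) (hD : P.IsDirection F D) {i j : ℕ}
    (hi : i ≤ P.rows) (hj : j ≤ P.cols) :
    inner ℝ (F (i, j + 1) - F (i, j)) (D i) = -(P.Y i (j + 1) - P.Y i j) := by
  have h := hF.inner_eq hi hj (v := (i, j + 1)) (w := (i + 1, j)) (x := (i, j))
    (by simp [corners]) (by simp [corners]) (by simp [corners])
  have hp := P.Y_lt i hi j (by omega)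
  rw [hD.sub_eq i hi j (by omega), inner_smul_right] at h
  have : P.Y i j - P.Y (i + 1) j ≠ 0 := by linarith
  apply mul_left_cancel₀ this
  rw [h]; simp; ring

lemma IsFolded.inner_row_upper (hF : P.IsFolded F) (hD : P.IsDirection F D) {i j : ℕ}
    (hi : i ≤ P.rows) (hj : j ≤ P.cols) :
    inner ℝ (F (i + 1, j + 1) - F (i + 1, j)) (D i) = -(P.Y (i + 1) (j + 1) - P.Y (i + 1) j) := by
  have h := hF.inner_eq hi hj (v := (i + 1, j + 1)) (w := (i, j)) (x := (i + 1, j))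
    (by simp [corners]) (by simp [corners]) (by simp [corners])
  have hp := P.Y_lt i hi j (by omega)
  rw [← neg_sub (F (i + 1, j)) (F (i, j)), hD.sub_eq i hi j (by omega), inner_neg_right,
    inner_smul_right] at h
  have : P.Y i j - P.Y (i + 1) j ≠ 0 := by linarith
  apply mul_left_cancel₀ this
  linear_combination -h

lemma IsFolded.norm_row_sq (hF : P.IsFolded F) {i j : ℕ} (hi : i ≤ P.rows) (hj : j ≤ P.cols) :
    ‖F (i, j + 1) - F (i, j)‖ ^ 2 = (P.X (j + 1) - P.X j) ^ 2 + (P.Y i (j + 1) - P.Y i j) ^ 2 := by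
  have h := hF.inner_eq hi hj (v := (i, j + 1)) (w := (i, j + 1)) (x := (i, j))
    (by simp [corners]) (by simp [corners]) (by simp [corners])
  rw [real_inner_self_eq_norm_sq] at h
  rw [h]; ring

lemma IsDirection.row_succ (hD : P.IsDirection F D) {i j : ℕ} (hi : i ≤ P.rows)
    (hj : j ≤ P.cols) :
    F (i + 1, j + 1) - F (i + 1, j) = F (i, j + 1) - F (i, j) +
      ((P.Y i (j + 1) - P.Y (i + 1) (j + 1)) - (P.Y i j - P.Y (i + 1) j)) • D i := by
  have h1 := hD.sub_eq i hi (j + 1) (by omega)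
  have h2 := hD.sub_eq i hi j (by omega)
  rw [sub_smul, ← h1, ← h2]; abel

/-- A map of the vertices is a folded state if the column creases between two rows are parallel
and if the row creases have the scalar products with their directions and the lengths that they
have in the plane. -/
theorem isFolded_of_directions (hn : ∀ i ≤ P.rows, ‖D i‖ = 1)
    (hD : ∀ i ≤ P.rows, ∀ j ≤ P.cols + 1,
      F (i + 1, j) - F (i, j) = (P.Y i j - P.Y (i + 1) j) • D i)
    (hR : ∀ i ≤ P.rows, ∀ j ≤ P.cols,
      inner ℝ (F (i, j + 1) - F (i, j)) (D i) = -(P.Y i (j + 1) - P.Y i j))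
    (hN : ∀ i ≤ P.rows, ∀ j ≤ P.cols, ‖F (i, j + 1) - F (i, j)‖ ^ 2 =
      (P.X (j + 1) - P.X j) ^ 2 + (P.Y i (j + 1) - P.Y i j) ^ 2) : P.IsFolded F := by
  intro i hi j hj
  have coord : ∀ v ∈ corners i j, ∃ x y : ℝ,
      F v = F (i, j) + x • (F (i, j + 1) - F (i, j)) + y • D i ∧
      P.X v.2 = P.X j + x * (P.X (j + 1) - P.X j) ∧
      P.Y v.1 v.2 = P.Y i j + x * (P.Y i (j + 1) - P.Y i j) - y := by
    intro v hv
    simp only [corners, Set.mem_insert_iff, Set.mem_singleton_iff] at hv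
    have h1 := hD i hi j (by omega)
    have h2 := hD i hi (j + 1) (by omega)
    rcases hv with rfl | rfl | rfl | rfl
    · exact ⟨0, 0, by simp, by simp, by simp⟩
    · refine ⟨0, P.Y i j - P.Y (i + 1) j, ?_, by simp, by simp⟩
      rw [← h1]; simp
    · exact ⟨1, 0, by simp, by simp, by simp⟩
    · refine ⟨1, P.Y i (j + 1) - P.Y (i + 1) (j + 1), ?_, by simp, by simp⟩
      rw [← h2]; simp
  have hsq : ∀ v ∈ corners i j, ∀ w ∈ corners i j,
      dist (F v) (F w) ^ 2 = dist (P.vertex v) (P.vertex w) ^ 2 := by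
    intro v hv w hw
    obtain ⟨x, y, hF1, hX1, hY1⟩ := coord v hv
    obtain ⟨x', y', hF2, hX2, hY2⟩ := coord w hw
    have e1 : F v - F w = (x - x') • (F (i, j + 1) - F (i, j)) + (y - y') • D i := by
      rw [hF1, hF2, sub_smul x, sub_smul y]; abel
    rw [dist_eq_norm, e1, ← real_inner_self_eq_norm_sq]
    simp only [inner_add_left, inner_add_right, inner_smul_left, inner_smul_right,
      RCLike.conj_to_real]
    rw [real_inner_comm (F (i, j + 1) - F (i, j)) (D i), hR i hi j hj, real_inner_self_eq_norm_sq,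
      real_inner_self_eq_norm_sq, hN i hi j hj, hn i hi, dist_eq_norm,
      ← real_inner_self_eq_norm_sq, inner_vertex_sub, hX1, hY1, hX2, hY2]
    ring
  intro v hv w hw
  exact (pow_left_inj₀ dist_nonneg dist_nonneg two_ne_zero).1 (hsq v hv w hw)

end OrthodiagonalPaper

/-! ### Sector angles and slopes -/

/-- The sign of the vertical direction from which the sector angles at column `j` are measured. -/
def colSign (j : ℕ) : ℝ := if Odd j then 1 else -1

lemma colSign_mul_self (j : ℕ) : colSign j * colSign j = 1 := by
  unfold colSign; split_ifs <;> norm_num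

lemma colSign_sq (j : ℕ) : colSign j ^ 2 = 1 := by rw [sq, colSign_mul_self]

lemma colSign_succ (j : ℕ) : colSign (j + 1) = -colSign j := by
  unfold colSign
  rcases Nat.even_or_odd j with h | h
  · rw [if_pos h.add_one, if_neg (Nat.not_odd_iff_even.2 h)]; norm_num
  · rw [if_neg (Nat.not_odd_iff_even.2 h.add_one), if_pos h]

lemma colSign_zero : colSign 0 = -1 := by simp [colSign]

/-- The angle between a vertical vector and the vector `(x, y)`. -/
lemma angle_vertical {p x y : ℝ} (hp : p ≠ 0) (hx : x ≠ 0) :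
    InnerProductGeometry.angle (!₂[0, p] : EuclideanSpace ℝ (Fin 2)) !₂[x, y] =
      Real.pi / 2 - Real.arctan (SignType.sign p * y / |x|) := by
  have h1 : ‖(!₂[0, p] : EuclideanSpace ℝ (Fin 2))‖ = |p| := by
    simp [EuclideanSpace.norm_eq, Fin.sum_univ_two, Real.sqrt_sq_eq_abs]
  have h2 : ‖(!₂[x, y] : EuclideanSpace ℝ (Fin 2))‖ = √(x ^ 2 + y ^ 2) := by
    simp [EuclideanSpace.norm_eq, Fin.sum_univ_two]
  have h3 : inner ℝ (!₂[0, p] : EuclideanSpace ℝ (Fin 2)) !₂[x, y] = p * y := by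
    simp [PiLp.inner_apply, Fin.sum_univ_two, mul_comm]
  have hs : (SignType.sign p : ℝ) ^ 2 = 1 := by
    rcases lt_or_gt_of_ne hp with h | h <;> simp [h]
  have hps : p = SignType.sign p * |p| := (sign_mul_abs p).symm
  rw [InnerProductGeometry.angle, h1, h2, h3, Real.arctan_eq_arcsin,
    Real.arccos_eq_pi_div_two_sub_arcsin]
  congr 2
  have h4 : √(1 + (SignType.sign p * y / |x|) ^ 2) = √(x ^ 2 + y ^ 2) / |x| := by
    rw [div_pow, mul_pow, hs, sq_abs, one_mul, ← Real.sqrt_sq_eq_abs x,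
        ← Real.sqrt_div' _ (sq_nonneg _)]
    congr 1
    field_simp
  have hpos : 0 < √(x ^ 2 + y ^ 2) := Real.sqrt_pos.2 (by positivity)
  have hxa : |x| ≠ 0 := abs_ne_zero.2 hx
  have hpa : |p| ≠ 0 := abs_ne_zero.2 hp
  rw [h4]
  nth_rewrite 1 [hps]
  field_simp

namespace OrthodiagonalPaper

variable (P : OrthodiagonalPaper)

/-- The cotangent of the sector angle `α i j`, read off from the slope of the row crease. -/
def cot (i j : ℕ) : ℝ := colSign j * (P.Y i (j + 1) - P.Y i j) / (P.X (j + 1) - P.X j)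

/-- The width of the panels between the columns `j` and `j + 1`. -/
def width (j : ℕ) : ℝ := P.X (j + 1) - P.X j

variable {P}

lemma width_pos {j : ℕ} (hj : j ≤ P.cols) : 0 < P.width j := sub_pos.2 (P.X_lt j hj)

lemma sub_Y_eq {i j : ℕ} (hj : j ≤ P.cols) :
    P.Y i (j + 1) - P.Y i j = colSign j * P.width j * P.cot i j := by
  have := (width_pos hj).ne'
  unfold cot
  rw [← width]
  field_simp
  rw [colSign_sq, mul_one]

lemma gridPoint_sub (X : ℕ → ℝ) (Y : ℕ → ℕ → ℝ) (v w : ℕ × ℕ) :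
    gridPoint X Y v -ᵥ gridPoint X Y w = !₂[X v.2 - X w.2, Y v.1 v.2 - Y w.1 w.2] := by
  ext k; fin_cases k <;> simp [gridPoint]

lemma sign_labelRow {Y : ℕ → ℕ → ℝ} {rows i j : ℕ} (hi : i ∈ Set.Icc 1 rows)
    (hY : ∀ i ≤ rows, Y (i + 1) j < Y i j) :
    Y (labelRow i j) j - Y i j ≠ 0 ∧ (SignType.sign (Y (labelRow i j) j - Y i j) : ℝ)
        = colSign j := by
  unfold labelRow colSign
  split_ifs with h
  · have := hY (i - 1) (by have := hi.2; omega)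
    rw [Nat.sub_add_cancel hi.1] at this
    have h2 : 0 < Y (i - 1) j - Y i j := by linarith
    exact ⟨h2.ne', by simp [h2]⟩
  · have := hY i hi.2
    have h2 : Y (i + 1) j - Y i j < 0 := by linarith
    exact ⟨h2.ne, by simp [h2]⟩

/-- The sector angles at the left and the right of a vertex of a grid with vertical columns. -/
lemma gridPoint_angle {X : ℕ → ℝ} {Y : ℕ → ℕ → ℝ} {rows i j j' : ℕ} (hi : i ∈ Set.Icc 1 rows)
    (hY : ∀ i ≤ rows, Y (i + 1) j < Y i j) (hX : X j' - X j ≠ 0) :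
    ∠ (gridPoint X Y (labelRow i j, j)) (gridPoint X Y (i, j)) (gridPoint X Y (i, j')) =
      Real.pi / 2 - Real.arctan (colSign j * (Y i j' - Y i j) / |X j' - X j|) := by
  obtain ⟨h1, h2⟩ := sign_labelRow hi hY
  rw [EuclideanGeometry.angle, gridPoint_sub, gridPoint_sub]
  simp only [sub_self]
  rw [angle_vertical h1 hX, h2]

lemma α_eq {i j : ℕ} (hi : i ∈ Set.Icc 1 P.rows) (hj : j ≤ P.cols) :
    P.α i j = Real.pi / 2 - Real.arctan (P.cot i j) := by
  rcases Nat.eq_zero_or_pos j with rfl | hj0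
  · have hX := P.X_lt 0 hj
    rw [← P.sector_left i hi 1 ⟨le_rfl, P.one_le_cols⟩,
      gridPoint_angle hi (fun i hi => P.Y_lt i hi 1 (by have := P.one_le_cols; omega))
          (by simp; linarith)]
    simp only [cot, colSign_succ 0, zero_add, Nat.sub_self]
    rw [abs_of_neg (by linarith)]
    congr 3 <;> ring
  · have hX := P.X_lt j hj
    rw [← P.sector_right i hi j ⟨hj0, hj⟩,
      gridPoint_angle hi (fun i hi => P.Y_lt i hi j (by omega)) (by linarith)]
    rw [abs_of_pos (by linarith), cot]

lemma cot_ne_zero {i j : ℕ} (hi : i ∈ Set.Icc 1 P.rows) (hj : j ≤ P.cols) : P.cot i j ≠ 0 := by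
  intro h
  apply P.α_ne i hi j hj
  rw [α_eq hi hj, h, Real.arctan_zero, sub_zero]

lemma tan_α {i j : ℕ} (hi : i ∈ Set.Icc 1 P.rows) (hj : j ≤ P.cols) :
    Real.tan (P.α i j) = (P.cot i j)⁻¹ := by
  rw [α_eq hi hj, Real.tan_pi_div_two_sub, Real.tan_arctan]

/-- The ratios of the cotangents along a row do not depend on the row. -/
lemma cot_eq {i j : ℕ} (hi : i ∈ Set.Icc 1 P.rows) (hj : j ≤ P.cols) :
    P.cot i j = P.cot i 0 * (P.cot 1 j / P.cot 1 0) := by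
  have h1 : (1 : ℕ) ∈ Set.Icc 1 P.rows := ⟨le_rfl, P.one_le_rows⟩
  have step : ∀ i, 1 ≤ i → i ≤ P.rows → ∀ j, j + 1 ≤ P.cols →
      P.cot i (j + 1) * P.cot 1 j = P.cot i j * P.cot 1 (j + 1) := by
    intro i hi1
    induction i, hi1 using Nat.le_induction with
    | base => intro _ j _; ring
    | succ i hi1 ih =>
      intro hi2 j hj
      have h := P.tan_ratio i j hi1 hi2 hj
      have m1 : i ∈ Set.Icc 1 P.rows := ⟨hi1, by omega⟩
      have m2 : i + 1 ∈ Set.Icc 1 P.rows := ⟨by omega, hi2⟩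
      rw [tan_α m1 (by omega), tan_α m1 hj, tan_α m2 (by omega), tan_α m2 hj] at h
      have a1 := cot_ne_zero m1 (j := j) (by omega)
      have a2 := cot_ne_zero m1 hj
      have a3 := cot_ne_zero m2 (j := j) (by omega)
      have a4 := cot_ne_zero m2 hj
      have ih' := ih (by omega) j hj
      field_simp at h
      apply mul_left_cancel₀ a1
      linear_combination P.cot (i + 1) j * ih' - P.cot 1 j * h
  have h10 := cot_ne_zero h1 (Nat.zero_le P.cols)
  rw [mul_div_assoc', eq_div_iff h10]
  induction j with
  | zero => rfl
  | succ j ih =>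
    have a := cot_ne_zero h1 (j := j) (by omega)
    have ih' := ih (by omega)
    have s := step i hi.1 hi.2 j hj
    apply mul_left_cancel₀ a
    linear_combination P.cot 1 0 * s + P.cot 1 (j + 1) * ih'

lemma HaltingAngles.ratio_mem (h : P.HaltingAngles) {j : ℕ} (hj : j ∈ Set.Icc 1 P.cols) :
    P.cot 1 j / P.cot 1 0 ∈ Set.Ioo (0 : ℝ) 1 := by
  have h1 : (1 : ℕ) ∈ Set.Icc 1 P.rows := ⟨le_rfl, P.one_le_rows⟩
  obtain ⟨hs, hc⟩ := h j hj
  rw [α_eq h1 hj.2, α_eq h1 (Nat.zero_le _)] at hs hc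
  simp only [sub_sub_cancel_left, abs_neg, neg_mul_neg] at hs hc
  have mono := Real.arctan_strictMono
  rcases lt_or_gt_of_ne (cot_ne_zero h1 (Nat.zero_le P.cols)) with h0 | h0
  · have a0 : Real.arctan (P.cot 1 0) < 0 := by simpa using mono h0
    have aj : Real.arctan (P.cot 1 j) < 0 := by by_contra! hh; nlinarith
    rw [abs_of_neg a0, abs_of_neg aj, neg_lt_neg_iff, mono.lt_iff_lt] at hc
    have : P.cot 1 j < 0 := by simpa using aj
    exact ⟨div_pos_of_neg_of_neg this h0, (div_lt_one_of_neg h0).2 hc⟩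
  · have a0 : 0 < Real.arctan (P.cot 1 0) := by simpa using mono h0
    have aj : 0 < Real.arctan (P.cot 1 j) := by by_contra! hh; nlinarith
    rw [abs_of_pos a0, abs_of_pos aj, mono.lt_iff_lt] at hc
    have : 0 < P.cot 1 j := by simpa using aj
    exact ⟨div_pos this h0, (div_lt_one h0).2 hc⟩

end OrthodiagonalPaper

/-! ### Half-planes and orthonormal frames of space -/

/-- The points `x` and `y` lie in the same open half-plane bounded by the line `o b` if and only if
`x - o` is a positive multiple of `y - o` modulo the direction of the line. This is the form in
which clashes are used. -/
lemma sSameSide_line_iff {V : Type*} [NormedAddCommGroup V] [InnerProductSpace ℝ V]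
    {o b x y : V} : (line[ℝ, o, b]).SSameSide x y ↔
      (∃ k > (0 : ℝ), ∃ s : ℝ, x - o = k • (y - o) + s • (b - o)) ∧
        ∀ s : ℝ, y - o ≠ s • (b - o) := by
  have mem : ∀ p, p ∈ line[ℝ, o, b] ↔ ∃ s : ℝ, p - o = s • (b - o) := by
    intro p
    rw [mem_affineSpan_pair_iff_exists_lineMap_eq]
    refine exists_congr fun s => ?_
    rw [AffineMap.lineMap_apply, vsub_eq_sub, vadd_eq_add, eq_comm, sub_eq_iff_eq_add]
  constructor
  · rintro ⟨⟨p₁, h₁, p₂, h₂, hr⟩, hx, hy⟩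
    obtain ⟨s₁, hs₁⟩ := (mem _).1 h₁
    obtain ⟨s₂, hs₂⟩ := (mem _).1 h₂
    refine ⟨?_, fun s hs => hy ((mem _).2 ⟨s, hs⟩)⟩
    rcases hr with h | h | ⟨a, c, ha, hc, h⟩
    · exact absurd (by rwa [vsub_eq_zero_iff_eq.1 h]) hx
    · exact absurd (by rwa [vsub_eq_zero_iff_eq.1 h]) hy
    · refine ⟨a⁻¹ * c, by positivity, s₁ - a⁻¹ * c * s₂, ?_⟩
      have e : x - p₁ = (a⁻¹ * c) • (y - p₂) := by
        rw [mul_smul, ← vsub_eq_sub y, ← h, smul_smul, inv_mul_cancel₀ ha.ne', one_smul,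
          vsub_eq_sub]
      have e1 : x - o = (x - p₁) + (p₁ - o) := by abel
      have e2 : y - p₂ = (y - o) - (p₂ - o) := by abel
      rw [e1, e, hs₁, e2, hs₂]
      module
  · rintro ⟨⟨k, hk, s, h⟩, hy⟩
    refine ⟨⟨o + s • (b - o), (mem _).2 ⟨s, by simp⟩, o, (mem _).2 ⟨0, by simp⟩, ?_⟩, ?_, ?_⟩
    · have : x -ᵥ (o + s • (b - o)) = k • (y -ᵥ o) := by
        rw [vsub_eq_sub, vsub_eq_sub, ← sub_sub, h, add_sub_cancel_right]
      rw [this]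
      exact SameRay.sameRay_nonneg_smul_left _ hk.le
    · intro hx
      obtain ⟨s', hs'⟩ := (mem _).1 hx
      apply hy (k⁻¹ * (s' - s))
      rw [hs'] at h
      have : (s' - s) • (b - o) = k • (y - o) := by rw [sub_smul, h]; abel
      rw [mul_smul, this, smul_smul, inv_mul_cancel₀ hk.ne', one_smul]
    · intro hy'
      obtain ⟨s', hs'⟩ := (mem _).1 hy'
      exact hy s' hs'

lemma eq_sum_of_orthonormal {e f n : E3} (he : ‖e‖ = 1) (hf : ‖f‖ = 1) (hn : ‖n‖ = 1)
    (hef : inner ℝ e f = 0) (hen : inner ℝ e n = 0) (hfn : inner ℝ f n = 0) (x : E3) :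
    x = inner ℝ e x • e + inner ℝ f x • f + inner ℝ n x • n := by
  have ho : Orthonormal ℝ ![e, f, n] := by
    constructor
    · intro i; fin_cases i <;> simpa
    · intro i j hij
      fin_cases i <;> fin_cases j <;> simp_all [real_inner_comm]
  have h := (OrthonormalBasis.mk ho (by
    rw [ho.linearIndependent.span_eq_top_of_card_eq_finrank (by simp)])).sum_repr' x
  simpa [Fin.sum_univ_three, eq_comm] using h

/-- Any two vectors of space have a common unit normal. -/
lemma exists_unit_normal (a b : E3) : ∃ n : E3, ‖n‖ = 1 ∧ inner ℝ n a = 0 ∧ inner ℝ n b = 0 := by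
  classical
  have hlt : Submodule.span ℝ {a, b} ≠ ⊤ := by
    intro h
    have h1 := finrank_span_finset_le_card (R := ℝ) ({a, b} : Finset E3)
    rw [Set.finrank, Finset.coe_pair, h, finrank_top, finrank_euclideanSpace_fin] at h1
    exact absurd (h1.trans Finset.card_le_two) (by norm_num)
  obtain ⟨v, hv, hv0⟩ := Submodule.exists_mem_ne_zero_of_ne_bot
    (mt Submodule.orthogonal_eq_bot_iff.1 hlt)
  rw [Submodule.mem_orthogonal'] at hv
  refine ⟨‖v‖⁻¹ • v, ?_, ?_, ?_⟩
  · rw [norm_smul, norm_inv, norm_norm, inv_mul_cancel₀ (norm_ne_zero_iff.2 hv0)]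
  · rw [inner_smul_left, hv a (Submodule.subset_span (by simp)), mul_zero]
  · rw [inner_smul_left, hv b (Submodule.subset_span (by simp)), mul_zero]

/-! ### The affine maps between the rows -/

/-- The unit vector of polar angle `θ`. -/
def polarDir (θ : ℝ) : Fin 2 → ℝ := ![Real.cos θ, Real.sin θ]

/-- The matrix `A(ξ, θ)` gives the coordinates along the directions of polar angles `θ` and
`θ + ξ`. -/
lemma shearRotation_mulVec {ξ : ℝ} (hξ : Real.sin ξ ≠ 0) (θ p q : ℝ) :
    shearRotation ξ θ *ᵥ (p • polarDir θ + q • polarDir (θ + ξ)) = ![p, q] := by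
  have h1 : -1 / Real.tan ξ = -Real.cos ξ / Real.sin ξ := by
    rw [Real.tan_eq_sin_div_cos, div_div_eq_mul_div, neg_one_mul]
  have hc := Real.sin_sq_add_cos_sq θ
  rw [shearRotation, h1]
  ext k
  fin_cases k
  · simp [polarDir, Matrix.mulVec, dotProduct, Fin.sum_univ_two, Matrix.mul_apply, Real.sin_add,
      Real.cos_add]
    field_simp
    linear_combination (p * Real.sin ξ) * hc
  · simp [polarDir, Matrix.mulVec, dotProduct, Fin.sum_univ_two, Matrix.mul_apply, Real.sin_add,
      Real.cos_add]
    field_simp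
    linear_combination (q * Real.sin ξ) * hc

lemma isUnit_det_shearRotation {ξ : ℝ} (hξ : Real.sin ξ ≠ 0) (θ : ℝ) :
    IsUnit (shearRotation ξ θ).det := by
  rw [isUnit_iff_ne_zero, shearRotation, Matrix.det_mul, Matrix.det_fin_two_of,
      Matrix.det_fin_two_of]
  have : Real.cos θ * Real.cos θ - Real.sin θ * -Real.sin θ = 1 := by
    linear_combination Real.sin_sq_add_cos_sq θ
  rw [this]
  simpa using hξ

lemma shearRotation_inv_mulVec {ξ : ℝ} (hξ : Real.sin ξ ≠ 0) (θ p q : ℝ) :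
    (shearRotation ξ θ)⁻¹ *ᵥ ![p, q] = p • polarDir θ + q • polarDir (θ + ξ) := by
  rw [← shearRotation_mulVec hξ θ p q, Matrix.mulVec_mulVec,
    Matrix.nonsing_inv_mul _ (isUnit_det_shearRotation hξ θ), Matrix.one_mulVec]

lemma rowMatrix_mulVec (α₁ β₁ α β θ : ℝ) (v : Fin 2 → ℝ) :
    rowMatrix α₁ β₁ α β θ *ᵥ v = (Real.sin α₁ / Real.sin α) •
      ((shearRotation (creaseAngle α β) θ)⁻¹ *ᵥ (shearRotation (creaseAngle α₁ β₁) θ *ᵥ v)) := by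
  rw [rowMatrix, Matrix.smul_mulVec, Matrix.mulVec_mulVec]

/-- If `4 cos² α / (1 - cos β) - 1 = 2 a² - 1`, then `a` is the cosine of half the crease angle. -/
lemma creaseAngle_half {α β a : ℝ} (ha : a ∈ Set.Ioo (0 : ℝ) 1)
    (h : 4 * Real.cos α ^ 2 / (1 - Real.cos β) = 2 * a ^ 2) :
    Real.cos (creaseAngle α β) = 2 * a ^ 2 - 1 ∧ Real.cos (creaseAngle α β / 2) = a ∧
      Real.sin (creaseAngle α β / 2) = √(1 - a ^ 2) ∧ 0 < Real.sin (creaseAngle α β) := by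
  have h1 : a ^ 2 < 1 := by nlinarith [ha.1, ha.2]
  have h2 : 0 < a ^ 2 := by nlinarith [ha.1, ha.2]
  have hc : Real.cos (creaseAngle α β) = 2 * a ^ 2 - 1 := by
    rw [creaseAngle, h, Real.cos_arccos (by linarith) (by linarith)]
  have hr : 0 ≤ creaseAngle α β ∧ creaseAngle α β ≤ Real.pi :=
    ⟨Real.arccos_nonneg _, Real.arccos_le_pi _⟩
  have hh : Real.cos (creaseAngle α β / 2) = a := by
    have hp : 0 ≤ Real.cos (creaseAngle α β / 2) :=
      Real.cos_nonneg_of_neg_pi_div_two_le_of_le (by linarith [Real.pi_pos]) (by linarith)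
    have := Real.cos_sq (creaseAngle α β / 2)
    rw [mul_div_cancel₀ _ two_ne_zero, hc] at this
    exact (pow_left_inj₀ hp ha.1.le two_ne_zero).1 (by linarith)
  have hs : Real.sin (creaseAngle α β / 2) = √(1 - a ^ 2) := by
    rw [← hh, ← Real.abs_sin_eq_sqrt_one_sub_cos_sq, abs_of_nonneg]
    exact Real.sin_nonneg_of_nonneg_of_le_pi (by linarith) (by linarith [Real.pi_pos])
  refine ⟨hc, hh, hs, ?_⟩
  have : creaseAngle α β = 2 * (creaseAngle α β / 2) := by ring
  rw [this, Real.sin_two_mul, hh, hs]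
  have : 0 < √(1 - a ^ 2) := Real.sqrt_pos.2 (by linarith)
  have := ha.1
  positivity

/-- In the frame turned by `θ + ξ / 2`, the coordinate vectors of polar angles `θ` and `θ + ξ` are
mirror images of each other in the line of `e`. -/
lemma polarDir_frame {V : Type*} [AddCommGroup V] [Module ℝ V] (e n : V) (θ ξ : ℝ) :
    let ω := θ + ξ / 2
    (polarDir θ 0 • (Real.cos ω • e + Real.sin ω • n)
      + polarDir θ 1 • (Real.sin ω • e - Real.cos ω • n)
        = Real.cos (ξ / 2) • e + Real.sin (ξ / 2) • n) ∧
    (polarDir (θ + ξ) 0 • (Real.cos ω • e + Real.sin ω • n)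
      + polarDir (θ + ξ) 1 • (Real.sin ω • e - Real.cos ω • n)
        = Real.cos (ξ / 2) • e - Real.sin (ξ / 2) • n) := by
  intro ω
  have a1 : Real.cos (ξ / 2) = Real.cos θ * Real.cos ω + Real.sin θ * Real.sin ω := by
    rw [← Real.cos_sub, ← Real.cos_neg]; congr 1; simp only [ω]; ring
  have a2 : Real.sin (ξ / 2) = Real.sin ω * Real.cos θ - Real.cos ω * Real.sin θ := by
    rw [← Real.sin_sub]; congr 1; simp only [ω]; ring
  have a3 : Real.cos (ξ / 2) = Real.cos (θ + ξ) * Real.cos ω + Real.sin (θ + ξ) * Real.sin ω := by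
    rw [← Real.cos_sub]; congr 1; simp only [ω]; ring
  have a4 : Real.sin (ξ / 2) = Real.sin (θ + ξ) * Real.cos ω - Real.cos (θ + ξ) * Real.sin ω := by
    rw [← Real.sin_sub]; congr 1; simp only [ω]; ring
  constructor
  · rw [a1, a2]; simp only [polarDir, Matrix.cons_val_zero, Matrix.cons_val_one]; module
  · rw [a3, a4]; simp only [polarDir, Matrix.cons_val_zero, Matrix.cons_val_one]; module

/-! ### The rows of a final state -/

namespace OrthodiagonalPaper

variable {P : OrthodiagonalPaper} {F : ℕ × ℕ → E3} {D : ℕ → E3}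

/-- The cotangents in the panel column `j` are those in the leftmost one times this ratio. -/
def ratio (P : OrthodiagonalPaper) (j : ℕ) : ℝ := P.cot 1 j / P.cot 1 0

/-- Where the two panels to the left of the first inner column clash, the row crease between them
bisects the angle of the column. -/
lemma IsFolded.direction_add_of_rowClash (hF : P.IsFolded F) (hD : P.IsDirection F D) {i : ℕ}
    (hi : i + 1 ≤ P.rows) (hc : RowClash F (i + 1) 0) :
    D i + D (i + 1) = (2 * P.cot (i + 1) 0 / (P.width 0 * (1 + P.cot (i + 1) 0 ^ 2))) •
      (F (i + 1, 1) - F (i + 1, 0)) := by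
  set t := P.cot (i + 1) 0
  set w := P.width 0 with hw
  have hwp : 0 < w := width_pos (Nat.zero_le _)
  have hdY : P.Y (i + 1) (0 + 1) - P.Y (i + 1) 0 = -(w * t) := by
    rw [sub_Y_eq (Nat.zero_le _), colSign_zero]; ring
  have hlow := hF.inner_row_lower hD hi (Nat.zero_le P.cols)
  have hup := hF.inner_row_upper hD (i := i) (by omega) (Nat.zero_le P.cols)
  have hn := hF.norm_row_sq hi (Nat.zero_le P.cols)
  have hn0 := hD.norm_eq i (by omega)
  have hn1 := hD.norm_eq (i + 1) hi
  rw [hdY] at hlow hup hn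
  rw [← width, ← hw] at hn
  simp only [zero_add, neg_neg] at hlow hup hn
  have hp := P.Y_lt i (by omega) 0 (by omega)
  have hq := P.Y_lt (i + 1) hi 0 (by omega)
  have e0 := hD.sub_eq i (by omega) 0 (by omega)
  have e1 := hD.sub_eq (i + 1) hi 0 (by omega)
  obtain ⟨⟨k, hk, s, h⟩, -⟩ := sSameSide_line_iff.1 hc
  simp only [Nat.add_sub_cancel, zero_add] at h
  rw [← neg_sub (F (i + 1, 0)) (F (i, 0)), e0, e1] at h
  set R := F (i + 1, 1) - F (i + 1, 0)
  set p := P.Y i 0 - P.Y (i + 1) 0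
  set q := P.Y (i + 1) 0 - P.Y (i + 1 + 1) 0
  have hp0 : 0 < p := sub_pos.2 hp
  have hq0 : 0 < q := sub_pos.2 hq
  obtain ⟨μ, hμ, σ, hDi⟩ : ∃ μ > (0 : ℝ), ∃ σ : ℝ, D i = -μ • D (i + 1) + σ • R := by
    refine ⟨k * q / p, by positivity, -s / p, ?_⟩
    have : D i = (-p⁻¹) • (-(p • D i)) := by
      rw [smul_neg, neg_smul, neg_neg, smul_smul, inv_mul_cancel₀ hp0.ne', one_smul]
    rw [this, h]
    match_scalars <;> field_simp
  have i1 : inner ℝ R (D i) = -μ * (w * t) + σ * (w ^ 2 * (1 + t ^ 2)) := by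
    rw [hDi, inner_add_right, inner_smul_right, inner_smul_right, hlow, real_inner_self_eq_norm_sq,
      hn]; ring
  have i2 : (1 : ℝ) = μ ^ 2 + σ ^ 2 * (w ^ 2 * (1 + t ^ 2)) - 2 * μ * σ * (w * t) := by
    have : inner ℝ (D i) (D i) = (1 : ℝ) := by rw [real_inner_self_eq_norm_sq, hn0]; norm_num
    rw [hDi] at this
    simp only [inner_add_left, inner_add_right, inner_smul_left, inner_smul_right,
      RCLike.conj_to_real] at this
    rw [real_inner_comm R (D (i + 1)), hlow, real_inner_self_eq_norm_sq,
      real_inner_self_eq_norm_sq, hn, hn1] at this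
    linear_combination -this
  rw [hup] at i1
  have hσ : σ * (w * (1 + t ^ 2)) = (1 + μ) * t := by
    apply mul_left_cancel₀ hwp.ne'
    linear_combination -i1
  have ht : 0 < 1 + t ^ 2 := by positivity
  have hμ1 : μ = 1 := by
    have : (1 - μ ^ 2) * 1 = 0 := by
      linear_combination (1 + t ^ 2) * i2 + (σ * w * (1 + t ^ 2) + (1 + μ) * t - 2 * μ * t) * hσ
    nlinarith
  rw [hμ1] at hσ hDi
  have : σ = 2 * t / (w * (1 + t ^ 2)) := by
    rw [eq_div_iff (by positivity)]; linarith
  rw [hDi, ← this]; module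

/-- In a final state the first column lies in a plane, with unit normal `ν`, and row `i` runs in
the plane spanned by `ν` and the bisector `e i` of the column; the components of its creases in the
direction `ν` do not depend on `i`. -/
theorem IsFinal.exists_frame (hF : P.IsFinal F) (hD : P.IsDirection F D) :
    ∃ (ν : E3) (e : ℕ → E3) (b : ℕ → ℝ), ‖ν‖ = 1 ∧ (∀ i ≤ P.rows, inner ℝ ν (D i) = 0) ∧
      (∀ j ≤ P.cols, b j ^ 2 = P.width j ^ 2 * (1 - P.ratio j ^ 2)) ∧
      ∀ i ∈ Set.Icc 1 P.rows, ‖e i‖ = 1 ∧ inner ℝ (e i) ν = 0 ∧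
        1 + inner ℝ (D (i - 1)) (D i) = 2 * P.cot i 0 ^ 2 / (1 + P.cot i 0 ^ 2) ∧
        ∀ j ≤ P.cols, F (i, j + 1) - F (i, j) =
          (colSign j * P.width j * P.ratio j * √(1 + P.cot i 0 ^ 2)) • e i + b j • ν := by
  obtain ⟨hfold, hclash, -, -⟩ := hF
  obtain ⟨ν, hν, hν0, hν1⟩ := exists_unit_normal (D 0) (D 1)
  have hw0 : 0 < P.width 0 := width_pos (Nat.zero_le _)
  have hadd := fun i (hi : i + 1 ≤ P.rows) => hfold.direction_add_of_rowClash hD hi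
    (hclash (i + 1) ⟨by omega, hi⟩)
  have ht0 : ∀ i, i + 1 ≤ P.rows → P.cot (i + 1) 0 ≠ 0 := fun i hi =>
    cot_ne_zero ⟨by omega, hi⟩ (Nat.zero_le _)
  have hR0 : ∀ i, i + 1 ≤ P.rows → inner ℝ ν (D i) = 0 → inner ℝ ν (D (i + 1)) = 0 →
      inner ℝ ν (F (i + 1, 1) - F (i + 1, 0)) = 0 := by
    intro i hi h0 h1
    have h := congrArg (inner ℝ ν) (hadd i hi)
    rw [inner_add_right, h0, h1, inner_smul_right, add_zero, eq_comm, mul_eq_zero] at h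
    refine h.resolve_left (div_ne_zero (mul_ne_zero two_ne_zero (ht0 i hi)) ?_)
    positivity
  have hνD : ∀ i, i + 1 ≤ P.rows → inner ℝ ν (D i) = 0 ∧ inner ℝ ν (D (i + 1)) = 0 := by
    intro i
    induction i with
    | zero => exact fun _ => ⟨hν0, hν1⟩
    | succ i ih =>
      intro hi
      obtain ⟨h0, h1⟩ := ih (by omega)
      refine ⟨h1, ?_⟩
      have h := congrArg (inner ℝ ν) (hadd (i + 1) hi)
      have hs := hD.row_succ (i := i + 1) (j := 0) (by omega) (Nat.zero_le _)
      rw [zero_add] at hs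
      rw [hs, inner_add_right, h1, inner_smul_right, inner_add_right, inner_smul_right, h1,
        hR0 i (by omega) h0 h1] at h
      simpa using h
  have hνD' : ∀ i ≤ P.rows, inner ℝ ν (D i) = 0 := by
    intro i hi
    rcases Nat.eq_zero_or_pos i with rfl | h
    · exact hν0
    · obtain ⟨k, rfl⟩ := Nat.exists_eq_add_of_lt h
      rw [zero_add] at hi ⊢
      exact (hνD k hi).2
  refine ⟨ν, fun i => -(P.width 0 * √(1 + P.cot i 0 ^ 2))⁻¹ • (F (i, 1) - F (i, 0)),
    fun j => inner ℝ ν (F (1, j + 1) - F (1, j)), hν, hνD', ?_⟩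
  have key : ∀ i ∈ Set.Icc 1 P.rows,
      ‖-(P.width 0 * √(1 + P.cot i 0 ^ 2))⁻¹ • (F (i, 1) - F (i, 0))‖ = 1 ∧
      inner ℝ (-(P.width 0 * √(1 + P.cot i 0 ^ 2))⁻¹ • (F (i, 1) - F (i, 0))) ν = 0 ∧
      1 + inner ℝ (D (i - 1)) (D i) = 2 * P.cot i 0 ^ 2 / (1 + P.cot i 0 ^ 2) ∧
      ∀ j ≤ P.cols, F (i, j + 1) - F (i, j) =
          (colSign j * P.width j * P.ratio j * √(1 + P.cot i 0 ^ 2)) •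
            (-(P.width 0 * √(1 + P.cot i 0 ^ 2))⁻¹ • (F (i, 1) - F (i, 0)))
          + inner ℝ ν (F (i, j + 1) - F (i, j)) • ν := by
    rintro i' ⟨h1, hi'⟩
    obtain ⟨i, rfl⟩ := Nat.exists_eq_add_of_le' h1
    have hadd' := hadd i hi'
    have ht := ht0 i hi'
    have hn := hfold.norm_row_sq (j := 0) hi' (Nat.zero_le _)
    rw [sub_Y_eq (Nat.zero_le _), colSign_zero, ← width, zero_add] at hn
    have h0 := hR0 i hi' (hνD i hi').1 (hνD i hi').2
    set t := P.cot (i + 1) 0 with ht_def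
    set w := P.width 0
    set R := F (i + 1, 1) - F (i + 1, 0)
    set r := √(1 + t ^ 2) with hr
    have hrp : 0 < r := Real.sqrt_pos.2 (by positivity)
    have hr2 : r ^ 2 = 1 + t ^ 2 := Real.sq_sqrt (by positivity)
    set e := -(w * r)⁻¹ • R with he
    have he1 : ‖e‖ = 1 := by
      have : ‖R‖ = w * r := by
        rw [← pow_left_inj₀ (norm_nonneg _) (by positivity) two_ne_zero, hn]
        linear_combination (-w ^ 2) * hr2
      rw [he, norm_smul, this, norm_neg, norm_inv, Real.norm_of_nonneg (by positivity)]
      exact inv_mul_cancel₀ (by positivity)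
    have heν : inner ℝ e ν = 0 := by
      rw [he, inner_smul_left, real_inner_comm, h0, mul_zero]
    have hsum : D i + D (i + 1) = (-(2 * t / r)) • e := by
      rw [hadd', he, smul_smul, ← hr2]
      congr 1
      field_simp
    have n0 := hD.norm_eq i (by omega)
    have n1 := hD.norm_eq (i + 1) hi'
    have hin : 1 + inner ℝ (D i) (D (i + 1)) = 2 * t ^ 2 / (1 + t ^ 2) := by
      have h := norm_add_sq_real (D i) (D (i + 1))
      rw [hsum, norm_smul, he1, n0, n1, Real.norm_eq_abs, mul_one, sq_abs, neg_sq, div_pow,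
          hr2] at h
      linear_combination -h / 2
    refine ⟨he1, heν, hin, ?_⟩
    set f := (r / 2) • (D (i + 1) - D i) with hf
    have hf1 : ‖f‖ = 1 := by
      have h := norm_sub_sq_real (D (i + 1)) (D i)
      rw [real_inner_comm, n0, n1] at h
      rw [← pow_left_inj₀ (norm_nonneg _) zero_le_one two_ne_zero, hf, norm_smul, mul_pow, h,
        Real.norm_eq_abs, sq_abs, div_pow, hr2]
      have h' : inner ℝ (D i) (D (i + 1)) = 2 * t ^ 2 / (1 + t ^ 2) - 1 := by linarith
      rw [h']
      have : 1 + t ^ 2 ≠ 0 := by positivity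
      field_simp
      ring
    have hef : inner ℝ e f = 0 := by
      have h : inner ℝ (D i + D (i + 1)) (D (i + 1) - D i) = 0 := by
        simp only [inner_add_left, inner_sub_right]
        rw [real_inner_self_eq_norm_sq, real_inner_self_eq_norm_sq, n0, n1,
          real_inner_comm (D i) (D (i + 1))]
        ring
      rw [hsum, inner_smul_left, mul_eq_zero] at h
      rw [hf, inner_smul_right, h.resolve_left, mul_zero]
      simp only [RCLike.conj_to_real]
      exact neg_ne_zero.2 (div_ne_zero (mul_ne_zero two_ne_zero ht) hrp.ne')
    have hfν : inner ℝ f ν = 0 := by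
      rw [hf, inner_smul_left, inner_sub_left, real_inner_comm, (hνD i hi').2, real_inner_comm,
        (hνD i hi').1]; simp
    intro j hj
    have low := hfold.inner_row_lower hD hi' hj
    have up := hfold.inner_row_upper hD (i := i) (by omega) hj
    rw [sub_Y_eq hj, cot_eq ⟨h1, hi'⟩ hj, ← ratio, ← ht_def] at low up
    set x := F (i + 1, j + 1) - F (i + 1, j)
    have hx := eq_sum_of_orthonormal he1 hf1 hν hef heν hfν x
    have c1 : inner ℝ e x = colSign j * P.width j * P.ratio j * r := by
      have h : inner ℝ (D i + D (i + 1)) x = 2 * -(colSign j * P.width j * (t * P.ratio j)) := by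
        rw [inner_add_left, real_inner_comm, up, real_inner_comm, low]; ring
      rw [hsum, inner_smul_left, RCLike.conj_to_real] at h
      field_simp at h
      linear_combination -h
    have c2 : inner ℝ f x = 0 := by
      rw [hf, inner_smul_left, inner_sub_left, real_inner_comm, low, real_inner_comm, up, sub_self,
        mul_zero]
    rw [c1, c2, zero_smul, add_zero] at hx
    exact hx
  have hb : ∀ j ≤ P.cols, ∀ i, i + 1 ≤ P.rows → inner ℝ ν (F (i + 1, j + 1) - F (i + 1, j))
      = inner ℝ ν (F (1, j + 1) - F (1, j)) := by
    intro j hj i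
    induction i with
    | zero => exact fun _ => rfl
    | succ i ih =>
      intro hi
      rw [hD.row_succ (by omega) hj, inner_add_right, inner_smul_right, hνD' (i + 1) (by omega),
        mul_zero, add_zero, ih (by omega)]
  constructor
  · intro j hj
    have m1 : (1 : ℕ) ∈ Set.Icc 1 P.rows := ⟨le_rfl, P.one_le_rows⟩
    obtain ⟨k1, k2, -, k3⟩ := key 1 m1
    have hn := hfold.norm_row_sq (i := 1) P.one_le_rows hj
    rw [k3 j hj] at hn
    generalize -(P.width 0 * √(1 + P.cot 1 0 ^ 2))⁻¹ • (F (1, 1) - F (1, 0)) = e at k1 k2 hn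
    rw [sub_Y_eq hj, cot_eq m1 hj, ← ratio, ← width, norm_add_sq_real, inner_smul_left,
      inner_smul_right, k2, norm_smul, norm_smul, k1, hν, Real.norm_eq_abs, Real.norm_eq_abs,
      mul_one, mul_one, sq_abs, sq_abs, mul_pow _ √_, Real.sq_sqrt (by positivity),
          mul_pow _ (P.ratio j),
      mul_pow, colSign_sq, mul_pow, mul_pow (colSign j), colSign_sq] at hn
    linear_combination hn
  · intro i hi
    obtain ⟨k1, k2, k4, k3⟩ := key i hi
    refine ⟨k1, k2, k4, fun j hj => ?_⟩
    obtain ⟨k, rfl⟩ := Nat.exists_eq_add_of_le' hi.1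
    beta_reduce
    rw [← hb j hj k hi.2]
    exact k3 j hj

end OrthodiagonalPaper

namespace OrthodiagonalPaper

variable {P : OrthodiagonalPaper} {F : ℕ × ℕ → E3} {D : ℕ → E3}

lemma IsDirection.columnAngle_eq (hD : P.IsDirection F D) {i : ℕ} (hi : i ∈ Set.Icc 1 P.rows) :
    columnAngle F i = Real.arccos (-inner ℝ (D (i - 1)) (D i)) := by
  obtain ⟨k, rfl⟩ := Nat.exists_eq_add_of_le' hi.1
  have hk := hi.2
  have h1 := P.one_le_cols
  have e0 := hD.sub_eq k (by omega) 1 (by omega)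
  have e1 := hD.sub_eq (k + 1) hk 1 (by omega)
  have p0 := sub_pos.2 (P.Y_lt k (by omega) 1 (by omega))
  have p1 := sub_pos.2 (P.Y_lt (k + 1) hk 1 (by omega))
  rw [columnAngle, EuclideanGeometry.angle, vsub_eq_sub, vsub_eq_sub, Nat.add_sub_cancel,
    ← neg_sub (F (k + 1, 1)), e0, e1, ← smul_neg,
    InnerProductGeometry.angle_smul_left_of_pos _ _ p0,
    InnerProductGeometry.angle_smul_right_of_pos _ _ p1, InnerProductGeometry.angle, norm_neg,
    hD.norm_eq k (by omega), hD.norm_eq (k + 1) hk, inner_neg_left, mul_one, div_one]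

lemma IsDirection.cos_columnAngle (hD : P.IsDirection F D) {i : ℕ} (hi : i ∈ Set.Icc 1 P.rows) :
    Real.cos (columnAngle F i) = -inner ℝ (D (i - 1)) (D i) := by
  have h := abs_le.1 (abs_real_inner_le_norm (D (i - 1)) (D i))
  rw [hD.norm_eq i hi.2, hD.norm_eq (i - 1) (by have := hi.2; omega), mul_one] at h
  rw [hD.columnAngle_eq hi, Real.cos_arccos] <;> linarith [h.1, h.2]

lemma sin_α_eq {i j : ℕ} (hi : i ∈ Set.Icc 1 P.rows) (hj : j ≤ P.cols) :
    Real.sin (P.α i j) = (√(1 + P.cot i j ^ 2))⁻¹ := by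
  rw [α_eq hi hj, Real.sin_pi_div_two_sub, Real.cos_arctan, one_div]

lemma cos_α_eq {i j : ℕ} (hi : i ∈ Set.Icc 1 P.rows) (hj : j ≤ P.cols) :
    Real.cos (P.α i j) = P.cot i j / √(1 + P.cot i j ^ 2) := by
  rw [α_eq hi hj, Real.cos_pi_div_two_sub, Real.sin_arctan]

/-- Along equal sector angles the normal component of the row creases keeps its sign, because
otherwise the panels on the two sides of a column would clash. -/
lemma normal_component_eq {ν e : E3} {b : ℕ → ℝ} {l r : ℕ} (hl : l < r) (hr : r ≤ P.cols + 1)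
    (hν : ‖ν‖ = 1) (hνD : inner ℝ ν (D 1) = 0) (hD : P.IsDirection F D)
    (heν : inner ℝ e ν = 0)
    (hd : P.ratio l ∈ Set.Ioo (0 : ℝ) 1) (hrun : ∀ j, l ≤ j → j < r → P.ratio j = P.ratio l)
    (hb : ∀ j ≤ P.cols, b j ^ 2 = P.width j ^ 2 * (1 - P.ratio j ^ 2)) {c : ℝ}
    (hR : ∀ j ≤ P.cols, F (1, j + 1) - F (1, j) =
      (colSign j * P.width j * P.ratio j * c) • e + b j • ν)
    (hcol : ∀ j, l < j → j < r → ¬ ColClash F 1 j) :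
    ∃ ε : ℝ, ε ^ 2 = 1 ∧ ∀ j, l ≤ j → j < r → b j = ε * P.width j * √(1 - P.ratio l ^ 2) := by
  set d := P.ratio l with hd_def
  have hd2 : 0 < 1 - d ^ 2 := by nlinarith [hd.1, hd.2]
  set k := √(1 - d ^ 2) with hk
  have hkp : 0 < k := Real.sqrt_pos.2 hd2
  have hk2 : k ^ 2 = 1 - d ^ 2 := Real.sq_sqrt hd2.le
  have hb' : ∀ j, l ≤ j → j < r → b j = P.width j * k ∨ b j = -(P.width j * k) := by
    intro j h1 h2
    have h := hb j (by omega)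
    rw [hrun j h1 h2, ← hk2, ← mul_pow] at h
    exact sq_eq_sq_iff_eq_or_eq_neg.1 h
  obtain ⟨ε, hε, hεl⟩ : ∃ ε : ℝ, ε ^ 2 = 1 ∧ b l = ε * P.width l * k := by
    rcases hb' l le_rfl hl with h | h
    · exact ⟨1, by norm_num, by rw [h, one_mul]⟩
    · exact ⟨-1, by norm_num, by rw [h]; ring⟩
  refine ⟨ε, hε, fun j hj => ?_⟩
  induction j, hj using Nat.le_induction with
  | base => exact fun _ => hεl
  | succ j hj ih =>
    intro hjr
    have ihj := ih (by omega)
    by_contra hne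
    have hneg : b (j + 1) = -(ε * P.width (j + 1) * k) := by
      have hε' : ε = 1 ∨ ε = -1 := by simpa using hε
      rcases hb' (j + 1) (by omega) hjr with h | h <;> rcases hε' with rfl | rfl
      · exact absurd (by rw [h, one_mul]) hne
      · rw [h]; ring
      · rw [h, one_mul]
      · exact absurd (by rw [h]; ring) hne
    have hw0 : 0 < P.width j := width_pos (by omega)
    have hw1 : 0 < P.width (j + 1) := width_pos (by omega)
    apply hcol (j + 1) (by omega) hjr
    have hR0 := hR j (by omega)
    have hR1 := hR (j + 1) (by omega)
    rw [hrun j hj (by omega), ihj] at hR0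
    rw [hrun (j + 1) (by omega) hjr, hneg, colSign_succ] at hR1
    refine sSameSide_line_iff.2 ⟨⟨P.width j / P.width (j + 1), by positivity, 0, ?_⟩,
        fun s hs => ?_⟩
    · rw [Nat.add_sub_cancel, ← neg_sub, hR0, hR1, zero_smul, add_zero]
      match_scalars <;> field_simp
    · rw [hD.sub_eq 1 P.one_le_rows (j + 1) (by omega), hR1] at hs
      have h := congrArg (inner ℝ ν) hs
      simp only [inner_add_right, inner_smul_right, hνD, real_inner_self_eq_norm_sq, hν] at h
      rw [real_inner_comm, heν] at h
      have hz : ε * P.width (j + 1) * k = 0 := by linear_combination -h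
      have : ε ≠ 0 := by rintro rfl; norm_num at hε
      exact mul_ne_zero (mul_ne_zero this hw1.ne') hkp.ne' hz


/-- The total width of the panel columns of one parity between the columns `l` and `j`. -/
def parityWidth (P : OrthodiagonalPaper) (odd : Prop) [Decidable odd] (l j : ℕ) : ℝ :=
  ∑ k ∈ Finset.Ico l j, if (Odd k ↔ odd) then P.width k else 0

lemma parityWidth_mono {odd : Prop} [Decidable odd] {l j j' : ℕ} (h : j ≤ j')
    (hj : j' ≤ P.cols + 1) : P.parityWidth odd l j ≤ P.parityWidth odd l j' := by
  refine Finset.sum_le_sum_of_subset_of_nonneg (Finset.Ico_subset_Ico_right h) fun k hk _ => ?_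
  have := (Finset.mem_Ico.1 hk).2
  split_ifs
  · exact (width_pos (by omega)).le
  · exact le_rfl

lemma cot_eq_of_run {l r : ℕ} (hr : r ≤ P.cols + 1)
    (hrun : ∀ j, l ≤ j → j + 1 < r → P.α 1 (j + 1) = P.α 1 j) :
    ∀ j, l ≤ j → j < r → P.cot 1 j = P.cot 1 l := by
  have m1 : (1 : ℕ) ∈ Set.Icc 1 P.rows := ⟨le_rfl, P.one_le_rows⟩
  intro j hj
  induction j, hj using Nat.le_induction with
  | base => exact fun _ => rfl
  | succ j hj ih =>
    intro hjr
    have h := hrun j hj hjr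
    rw [α_eq m1 (by omega), α_eq m1 (by omega), sub_right_inj, Real.arctan_inj] at h
    rw [h, ih (by omega)]

/-- The half of the angle `ξ` of a row: by these formulas, the components of a crease of the row
along the bisector of the first column and along its normal are in the ratio of `cos (ξ / 2)` to
`sin (ξ / 2)`. -/
lemma creaseAngle_half_row {i l : ℕ} (hi : i ∈ Set.Icc 1 P.rows) (hl : l ≤ P.cols)
    (hd : P.ratio l ∈ Set.Ioo (0 : ℝ) 1)
    (hβ : 1 - Real.cos (columnAngle F i) = 2 * P.cot i 0 ^ 2 / (1 + P.cot i 0 ^ 2)) :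
    let ξ := creaseAngle (P.α i l) (columnAngle F i)
    Real.cos ξ = 4 * Real.cos (P.α i l) ^ 2 / (1 - Real.cos (columnAngle F i)) - 1 ∧
    0 < Real.sin ξ ∧
    Real.cos (ξ / 2) = P.ratio l * √(1 + P.cot i 0 ^ 2) * Real.sin (P.α i l) ∧
    Real.sin (ξ / 2) = √(1 - P.ratio l ^ 2) * Real.sin (P.α i l) := by
  intro ξ
  have ht := cot_ne_zero hi (Nat.zero_le P.cols)
  have hs := sin_α_eq hi hl
  have hc := cos_α_eq hi hl
  rw [cot_eq hi hl, ← ratio] at hs hc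
  rw [hs]
  set t := P.cot i 0
  set d := P.ratio l
  set s := √(1 + (t * d) ^ 2) with hs_def
  have hs2 : s ^ 2 = 1 + (t * d) ^ 2 := Real.sq_sqrt (by positivity)
  have hs0 : 0 < s := Real.sqrt_pos.2 (by positivity)
  set ρ := √(1 + t ^ 2) with hρ_def
  have hρ2 : ρ ^ 2 = 1 + t ^ 2 := Real.sq_sqrt (by positivity)
  have hρ0 : 0 < ρ := Real.sqrt_pos.2 (by positivity)
  have hd2 : 0 < 1 - d ^ 2 := by nlinarith [hd.1, hd.2]
  have hsq : 1 - (d * ρ * s⁻¹) ^ 2 = (1 - d ^ 2) * s⁻¹ ^ 2 := by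
    rw [mul_pow, mul_pow, inv_pow, hρ2, hs2]; field_simp; ring
  have ha : d * ρ * s⁻¹ ∈ Set.Ioo (0 : ℝ) 1 := by
    have h0 : 0 < d * ρ * s⁻¹ := by have := hd.1; positivity
    have h1 : 0 < (1 - d ^ 2) * s⁻¹ ^ 2 := by positivity
    exact ⟨h0, by nlinarith⟩
  have h4 : 4 * Real.cos (P.α i l) ^ 2 / (1 - Real.cos (columnAngle F i))
      = 2 * (d * ρ * s⁻¹) ^ 2 := by
    rw [hβ, hc, ← hρ2]
    field_simp
    ring
  obtain ⟨k1, k2, k3, k4⟩ := creaseAngle_half ha h4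
  refine ⟨?_, k4, k2, ?_⟩
  · rw [h4]; exact k1
  · rw [k3, hsq, Real.sqrt_mul hd2.le, Real.sqrt_sq (by positivity)]

/-- The rows of a final state. In the frame formed by the bisector of the first column and the
normal of its plane, the creases of a row alternate between the directions
`±cos (ξ / 2), sin (ξ / 2)`; hence in the coordinates of `A(ξ, θ)` the row is a staircase, whose
steps are the widths of the panels up to the factor `1 / sin α`. -/
theorem rows_of_final_state (P : OrthodiagonalPaper) (F : ℕ × ℕ → E3) (l r : ℕ) (θ : ℝ)
    (hP : P.HaltingAngles) (hF : P.IsFinal F) (hl : 1 ≤ l) (hlr : l < r) (hr : r ≤ P.cols + 1)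
    (hrun : ∀ j, l ≤ j → j + 1 < r → P.α 1 (j + 1) = P.α 1 j) :
    (∀ i ∈ Set.Icc 1 P.rows, ∀ j, l ≤ j → j < r → P.α i j = P.α i l) ∧
    (∀ i ∈ Set.Icc 1 P.rows, ∀ j, l < j → j < r →
      ∠ (F (i, j - 1)) (F (i, j)) (F (i, j + 1)) = creaseAngle (P.α i l) (columnAngle F i) ∧
      Real.cos (∠ (F (i, j - 1)) (F (i, j)) (F (i, j + 1)))
        = 4 * Real.cos (P.α i l) ^ 2 / (1 - Real.cos (columnAngle F i)) - 1) ∧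
    ∃ (ν : E3) (x y : ℕ → E3) (g : ℕ → ℕ → Fin 2 → ℝ),
      ‖ν‖ = 1 ∧
      (∀ i ≤ P.rows + 1, inner ℝ ν (F (i, 1) - F (0, 1)) = 0) ∧
      ∀ i ∈ Set.Icc 1 P.rows,
        ‖x i‖ = 1 ∧ ‖y i‖ = 1 ∧ inner ℝ (x i) (y i) = 0 ∧
        ν ∈ Submodule.span ℝ {x i, y i} ∧
        (∀ j ∈ Set.Icc l r, F (i, j) = F (i, l) + (g i j 0 • x i + g i j 1 • y i)) ∧
        MonotoneOn (fun j => (shearRotation (creaseAngle (P.α i l) (columnAngle F i)) θ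
          *ᵥ g i j) 0) (Set.Icc l r) ∧
        AntitoneOn (fun j => (shearRotation (creaseAngle (P.α i l) (columnAngle F i)) θ
          *ᵥ g i j) 1) (Set.Icc l r) ∧
        ∀ j ∈ Set.Icc l r, g i j =
          rowMatrix (P.α 1 l) (columnAngle F 1) (P.α i l) (columnAngle F i) θ *ᵥ g 1 j := by
  have m1 : (1 : ℕ) ∈ Set.Icc 1 P.rows := ⟨le_rfl, P.one_le_rows⟩
  have hcot := cot_eq_of_run hr hrun
  have hratio : ∀ j, l ≤ j → j < r → P.ratio j = P.ratio l := fun j h1 h2 => by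
    rw [ratio, ratio, hcot j h1 h2]
  have hd : P.ratio l ∈ Set.Ioo (0 : ℝ) 1 := hP.ratio_mem ⟨hl, by omega⟩
  obtain ⟨D, hD⟩ := hF.1.exists_isDirection
  obtain ⟨ν, e, b, hν, hνD, hb, hframe⟩ := hF.exists_frame hD
  obtain ⟨he1, heν1, -, hR1⟩ := hframe 1 m1
  obtain ⟨ε, hε, hbε⟩ := normal_component_eq hlr hr hν (hνD 1 P.one_le_rows) hD heν1 hd hratio hb
    (c := √(1 + P.cot 1 0 ^ 2)) hR1
    (fun j h1 h2 => hF.2.2.2 1 P.one_le_rows j ⟨by omega, by omega⟩)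
  set n := ε • ν with hn
  have hn1 : ‖n‖ = 1 := by
    rw [hn, norm_smul, hν, mul_one, Real.norm_eq_abs, ← sq_eq_sq₀ (abs_nonneg _) zero_le_one,
      sq_abs,
      hε, one_pow]
  have hβ : ∀ i ∈ Set.Icc 1 P.rows,
      1 - Real.cos (columnAngle F i) = 2 * P.cot i 0 ^ 2 / (1 + P.cot i 0 ^ 2) := by
    intro i hi
    rw [hD.cos_columnAngle hi, ← (hframe i hi).2.2.1]; ring
  have hsin : ∀ i ∈ Set.Icc 1 P.rows, 0 < Real.sin (P.α i l) := by
    intro i hi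
    rw [sin_α_eq hi (by omega)]
    have : 0 < √(1 + P.cot i l ^ 2) := Real.sqrt_pos.2 (by positivity)
    positivity
  have hrow : ∀ i ∈ Set.Icc 1 P.rows, ∀ j, l ≤ j → j < r → F (i, j + 1) - F (i, j) =
      (P.width j / Real.sin (P.α i l)) •
        ((colSign j * Real.cos (creaseAngle (P.α i l) (columnAngle F i) / 2)) • e i
          + Real.sin (creaseAngle (P.α i l) (columnAngle F i) / 2) • n) := by
    intro i hi j h1 h2
    obtain ⟨-, -, k3, k4⟩ := creaseAngle_half_row hi (by omega) hd (hβ i hi)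
    rw [(hframe i hi).2.2.2 j (by omega), hbε j h1 h2, hratio j h1 h2, k3, k4, hn]
    have := (hsin i hi).ne'
    match_scalars <;> field_simp
  have hen : ∀ i ∈ Set.Icc 1 P.rows, inner ℝ (e i) n = 0 := fun i hi => by
    rw [hn, inner_smul_right, (hframe i hi).2.1, mul_zero]
  refine ⟨?_, ?_, ?_⟩
  · intro i hi j h1 h2
    rw [α_eq hi (by omega), α_eq hi (by omega), cot_eq hi (j := j) (by omega),
      cot_eq hi (j := l) (by omega), hcot j h1 h2]
  · intro i hi j h1 h2
    have hfr := creaseAngle_half_row hi (by omega) hd (hβ i hi)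
    set ξ := creaseAngle (P.α i l) (columnAngle F i) with hξ
    obtain ⟨k1, -⟩ := hfr
    have key : ∠ (F (i, j - 1)) (F (i, j)) (F (i, j + 1)) = ξ := by
      obtain ⟨k, rfl⟩ := Nat.exists_eq_add_of_lt h1
      have e1 := hrow i hi (l + k) (by omega) (by omega)
      have e2 := hrow i hi (l + k + 1) (by omega) (by omega)
      have w1 : 0 < P.width (l + k) := width_pos (by omega)
      have w2 : 0 < P.width (l + k + 1) := width_pos (by omega)
      rw [← hξ] at e1 e2
      have q1 : ∀ c s : ℝ, ‖c • e i + s • n‖ ^ 2 = c ^ 2 + s ^ 2 := by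
        intro c s
        rw [norm_add_sq_real, inner_smul_left, inner_smul_right, hen i hi, norm_smul, norm_smul,
          (hframe i hi).1, hn1, Real.norm_eq_abs, Real.norm_eq_abs]
        simp
      have q2 : ∀ c : ℝ, c ^ 2 = 1 →
          ‖(c * Real.cos (ξ / 2)) • e i + Real.sin (ξ / 2) • n‖ = 1 := by
        intro c hc
        rw [← pow_left_inj₀ (norm_nonneg _) zero_le_one two_ne_zero, q1, mul_pow, hc]
        linear_combination Real.sin_sq_add_cos_sq (ξ / 2)
      rw [EuclideanGeometry.angle, vsub_eq_sub, vsub_eq_sub, Nat.add_sub_cancel,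
        ← neg_sub (F (i, l + k + 1)), e1, e2, ← smul_neg,
        InnerProductGeometry.angle_smul_left_of_pos _ _ (div_pos w1 (hsin i hi)),
        InnerProductGeometry.angle_smul_right_of_pos _ _ (div_pos w2 (hsin i hi)),
        InnerProductGeometry.angle, norm_neg, q2 _ (colSign_sq _), q2 _ (colSign_sq _), mul_one,
        div_one, colSign_succ]
      have q3 : inner ℝ (-((colSign (l + k) * Real.cos (ξ / 2)) • e i + Real.sin (ξ / 2) • n))
          ((-colSign (l + k) * Real.cos (ξ / 2)) • e i + Real.sin (ξ / 2) • n) = Real.cos ξ := by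
        simp only [inner_neg_left, inner_add_left, inner_add_right, inner_smul_left,
          inner_smul_right, RCLike.conj_to_real]
        rw [real_inner_comm (e i) n, hen i hi, real_inner_self_eq_norm_sq,
            real_inner_self_eq_norm_sq, hn1,
          (hframe i hi).1]
        have h := Real.cos_sq (ξ / 2)
        rw [mul_div_cancel₀ _ two_ne_zero] at h
        linear_combination Real.cos (ξ / 2) ^ 2 * colSign_sq (l + k) + 2 * h
          - Real.sin_sq_add_cos_sq (ξ / 2)
      rw [q3]
      exact Real.arccos_cos (Real.arccos_nonneg _) (Real.arccos_le_pi _)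
    exact ⟨key, by rw [key, k1]⟩
  · set ξ : ℕ → ℝ := fun i => creaseAngle (P.α i l) (columnAngle F i) with hξ
    set g : ℕ → ℕ → Fin 2 → ℝ := fun i j => (Real.sin (P.α i l))⁻¹ •
      (P.parityWidth True l j • polarDir θ + (-P.parityWidth False l j) • polarDir (θ + ξ i))
      with hg
    have hA : ∀ i ∈ Set.Icc 1 P.rows, ∀ j, shearRotation (ξ i) θ *ᵥ g i j =
        (Real.sin (P.α i l))⁻¹ • ![P.parityWidth True l j, -P.parityWidth False l j] := by
      intro i hi j
      obtain ⟨-, k2, -⟩ := creaseAngle_half_row hi (by omega) hd (hβ i hi)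
      rw [hg, Matrix.mulVec_smul, shearRotation_mulVec k2.ne']
    refine ⟨n, fun i => Real.cos (θ + ξ i / 2) • e i + Real.sin (θ + ξ i / 2) • n,
      fun i => Real.sin (θ + ξ i / 2) • e i - Real.cos (θ + ξ i / 2) • n, g, hn1, ?_, ?_⟩
    · intro i
      induction i with
      | zero => intro _; simp
      | succ i ih =>
        intro hi
        have h1 := P.one_le_cols
        rw [← sub_add_sub_cancel _ (F (i, 1)), inner_add_right, ih (by omega),
          hD.sub_eq i (by omega) 1 (by omega), inner_smul_right, hn, inner_smul_left,
          hνD i (by omega)]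
        simp
    · intro i hi
      have hpy := Real.sin_sq_add_cos_sq (θ + ξ i / 2)
      have hee : inner ℝ (e i) (e i) = (1 : ℝ) := by
        rw [real_inner_self_eq_norm_sq, (hframe i hi).1, one_pow]
      have hnn : inner ℝ n n = (1 : ℝ) := by rw [real_inner_self_eq_norm_sq, hn1, one_pow]
      have hne : inner ℝ n (e i) = (0 : ℝ) := by rw [real_inner_comm, hen i hi]
      refine ⟨?_, ?_, ?_, ?_, ?_, ?_, ?_, ?_⟩
      · rw [← pow_left_inj₀ (norm_nonneg _) zero_le_one two_ne_zero, ← real_inner_self_eq_norm_sq]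
        simp only [inner_add_left, inner_add_right, inner_smul_left, inner_smul_right,
          RCLike.conj_to_real, hee, hnn, hne, hen i hi]
        linear_combination hpy
      · rw [← pow_left_inj₀ (norm_nonneg _) zero_le_one two_ne_zero, ← real_inner_self_eq_norm_sq]
        simp only [inner_sub_left, inner_sub_right, inner_smul_left, inner_smul_right,
          RCLike.conj_to_real, hee, hnn, hne, hen i hi]
        linear_combination hpy
      · simp only [inner_add_left, inner_sub_right, inner_smul_left, inner_smul_right,
          RCLike.conj_to_real, hee, hnn, hne, hen i hi]
        ring
      · rw [Submodule.mem_span_pair]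
        refine ⟨Real.sin (θ + ξ i / 2), -Real.cos (θ + ξ i / 2), ?_⟩
        have h2 : n = (Real.sin (θ + ξ i / 2) ^ 2 + Real.cos (θ + ξ i / 2) ^ 2) • n := by
          rw [hpy, one_smul]
        conv_rhs => rw [h2]
        module
      · rintro j ⟨hj, hjr⟩
        obtain ⟨f1, f2⟩ := polarDir_frame (e i) n θ (ξ i)
        set x := Real.cos (θ + ξ i / 2) • e i + Real.sin (θ + ξ i / 2) • n
        set y := Real.sin (θ + ξ i / 2) • e i - Real.cos (θ + ξ i / 2) • n
        have hsplit : ∀ j, g i j 0 • x + g i j 1 • y = (Real.sin (P.α i l))⁻¹ •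
            (P.parityWidth True l j • (polarDir θ 0 • x + polarDir θ 1 • y)
              - P.parityWidth False l j • (polarDir (θ + ξ i) 0 • x + polarDir (θ + ξ i) 1 • y)) := by
          intro j
          simp only [hg, Pi.smul_apply, Pi.add_apply, smul_eq_mul]
          module
        rw [hsplit, f1, f2]
        induction j, hj using Nat.le_induction with
        | base => simp [parityWidth]
        | succ j hj ih =>
          have h := hrow i hi j hj (by omega)
          rw [← sub_add_cancel (F (i, j + 1)) (F (i, j)), h, ih (by omega)]
          simp only [parityWidth, Finset.sum_Ico_succ_top hj]
          by_cases ho : Odd j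
          · simp only [colSign, ho, if_true, iff_true, iff_false, not_true, if_false]
            module
          · simp only [colSign, ho, if_true, iff_true, iff_false, if_false]
            module
      · intro j hj j' hj' hjj
        simp only
        rw [hA i hi, hA i hi]
        simp only [Pi.smul_apply, Matrix.cons_val_zero, smul_eq_mul]
        have := hsin i hi
        exact mul_le_mul_of_nonneg_left (parityWidth_mono hjj (hj'.2.trans hr)) (by positivity)
      · intro j hj j' hj' hjj
        simp only
        rw [hA i hi, hA i hi]
        simp only [Pi.smul_apply, Matrix.cons_val_one, Matrix.cons_val_fin_one, smul_eq_mul]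
        have := hsin i hi
        exact mul_le_mul_of_nonneg_left (neg_le_neg (parityWidth_mono hjj (hj'.2.trans hr)))
          (by positivity)
      · intro j _
        obtain ⟨-, k2, -⟩ := creaseAngle_half_row hi (by omega) hd (hβ i hi)
        have h1 := hA 1 m1 j
        simp only [hξ] at h1
        rw [rowMatrix_mulVec, h1, Matrix.mulVec_smul, shearRotation_inv_mulVec k2.ne', smul_smul]
        have := (hsin 1 m1).ne'
        have h2 : Real.sin (P.α 1 l) / Real.sin (P.α i l) * (Real.sin (P.α 1 l))⁻¹
            = (Real.sin (P.α i l))⁻¹ := by field_simp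
        rw [h2]

end OrthodiagonalPaper

/-! ### Space as the product of the complex plane and the line -/

/-- The point of space over the point `z` of the complex plane at the height `h`. -/
def spacePoint (z : ℂ) (h : ℝ) : E3 := !₂[z.re, z.im, h]

lemma spacePoint_add (z z' : ℂ) (h h' : ℝ) :
    spacePoint z h + spacePoint z' h' = spacePoint (z + z') (h + h') := by
  ext k; fin_cases k <;> simp [spacePoint]

lemma spacePoint_sub (z z' : ℂ) (h h' : ℝ) :
    spacePoint z h - spacePoint z' h' = spacePoint (z - z') (h - h') := by
  ext k; fin_cases k <;> simp [spacePoint]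

lemma smul_spacePoint (r : ℝ) (z : ℂ) (h : ℝ) :
    r • spacePoint z h = spacePoint (r * z) (r * h) := by
  ext k; fin_cases k <;> simp [spacePoint]

lemma inner_spacePoint (z z' : ℂ) (h h' : ℝ) :
    inner ℝ (spacePoint z h) (spacePoint z' h') = z.re * z'.re + z.im * z'.im + h * h' := by
  simp [spacePoint, PiLp.inner_apply, Fin.sum_univ_three]; ring

lemma norm_spacePoint_sq (z : ℂ) (h : ℝ) : ‖spacePoint z h‖ ^ 2 = ‖z‖ ^ 2 + h ^ 2 := by
  rw [← real_inner_self_eq_norm_sq, inner_spacePoint, ← Complex.normSq_eq_norm_sq,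
    Complex.normSq_apply]; ring

lemma norm_spacePoint_zero (z : ℂ) : ‖spacePoint z 0‖ = ‖z‖ := by
  rw [← pow_left_inj₀ (norm_nonneg _) (norm_nonneg _) two_ne_zero, norm_spacePoint_sq]; ring

lemma norm_spacePoint_le (z : ℂ) (h : ℝ) : ‖spacePoint z h‖ ≤ ‖z‖ + |h| := by
  apply le_of_sq_le_sq _ (by positivity)
  rw [norm_spacePoint_sq, ← sq_abs h]
  nlinarith [norm_nonneg z, abs_nonneg h]

lemma spacePoint_inj {z z' : ℂ} {h h' : ℝ} :
    spacePoint z h = spacePoint z' h' ↔ z = z' ∧ h = h' := by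
  constructor
  · intro H
    have h0 := congrArg (fun v : E3 => v 0) H
    have h1 := congrArg (fun v : E3 => v 1) H
    have h2 := congrArg (fun v : E3 => v 2) H
    simp [spacePoint] at h0 h1 h2
    exact ⟨Complex.ext h0 h1, h2⟩
  · rintro ⟨rfl, rfl⟩; rfl

lemma continuous_spacePoint : Continuous fun p : ℂ × ℝ => spacePoint p.1 p.2 := by
  unfold spacePoint
  refine (PiLp.continuous_toLp 2 _).comp (continuous_pi fun k => ?_)
  fin_cases k
  · exact Complex.continuous_re.comp continuous_fst
  · exact Complex.continuous_im.comp continuous_fst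
  · exact continuous_snd

/-! ### The rotations of the column creases -/

/-- The rotation by the angle `2 arctan x`, as a complex number. -/
def tanRot (x : ℝ) : ℂ := (1 + x * Complex.I) / (1 - x * Complex.I)

lemma one_sub_mul_I_ne (x : ℝ) : (1 - x * Complex.I : ℂ) ≠ 0 := by
  intro h
  have := congrArg Complex.re h
  simp at this

lemma tanRot_mul (x : ℝ) : tanRot x * (1 - x * Complex.I) = 1 + x * Complex.I :=
  div_mul_cancel₀ _ (one_sub_mul_I_ne x)

lemma one_add_sq_ne (x : ℝ) : 1 + x ^ 2 ≠ 0 := by positivity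

lemma tanRot_eq (x : ℝ) :
    tanRot x = ((1 - x ^ 2) / (1 + x ^ 2) : ℝ) + (2 * x / (1 + x ^ 2) : ℝ) * Complex.I := by
  have h := one_add_sq_ne x
  rw [tanRot, div_eq_iff (one_sub_mul_I_ne x)]
  have h' : (1 + x ^ 2 : ℂ) ≠ 0 := by exact_mod_cast h
  push_cast
  field_simp
  linear_combination (2 * (x : ℂ) ^ 2) * Complex.I_sq

lemma tanRot_re (x : ℝ) : (tanRot x).re = (1 - x ^ 2) / (1 + x ^ 2) := by
  rw [tanRot_eq, Complex.add_re, Complex.re_ofReal_mul, Complex.ofReal_re, Complex.I_re]; ring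

lemma tanRot_im (x : ℝ) : (tanRot x).im = 2 * x / (1 + x ^ 2) := by
  rw [tanRot_eq, Complex.add_im, Complex.im_ofReal_mul, Complex.ofReal_im, Complex.I_im]; ring

lemma norm_tanRot (x : ℝ) : ‖tanRot x‖ = 1 := by
  rw [← pow_left_inj₀ (norm_nonneg _) zero_le_one two_ne_zero, ← Complex.normSq_eq_norm_sq,
    Complex.normSq_apply, tanRot_re, tanRot_im]
  have h := one_add_sq_ne x
  field_simp
  ring

lemma continuous_tanRot : Continuous tanRot := by
  unfold tanRot
  exact Continuous.div (by fun_prop) (by fun_prop) one_sub_mul_I_ne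

/-! ### Papers and folding motions from their widths, heights and cotangents -/

/-- The data of a creased paper with cotangents `σ z_i d_j` of the sector angles: `w` are the
widths of the panel columns, and `ℓ` the heights of the panel rows at the first inner column.
The condition `length_pos` says that the column creases have positive length. -/
structure PaperData where
  rows : ℕ
  cols : ℕ
  σ : ℝ
  z : ℕ → ℝ
  d : ℕ → ℝ
  w : ℕ → ℝ
  ℓ : ℕ → ℝ
  one_le_rows : 1 ≤ rows
  one_le_cols : 1 ≤ cols
  σ_sq : σ ^ 2 = 1
  z_pos : ∀ i, 0 < z i
  d_zero : d 0 = 1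
  d_pos : ∀ j, 0 < d j
  d_lt : ∀ j, 1 ≤ j → d j < 1
  w_pos : ∀ j, 0 < w j
  length_pos : ∀ i ≤ rows, ∀ j ≤ cols + 1,
    0 < ℓ i - σ * (w 0 + ∑ k ∈ Finset.range j, colSign k * w k * d k) * (z (i + 1) - z i)

namespace PaperData

variable (p : PaperData)

/-- The shift of column `j` along the rows, relative to the first inner column. -/
def S (j : ℕ) : ℝ := p.w 0 + ∑ k ∈ Finset.range j, colSign k * p.w k * p.d k

/-- The abscissa of column `j` in the planar state. -/
def X (j : ℕ) : ℝ := ∑ k ∈ Finset.range j, p.w k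

/-- The height of a vertex in the planar state. -/
def Y (i j : ℕ) : ℝ := -∑ k ∈ Finset.range i, p.ℓ k + p.σ * p.z i * p.S j

lemma S_one : p.S 1 = 0 := by simp [S, colSign_zero, p.d_zero]

lemma S_succ (j : ℕ) : p.S (j + 1) = p.S j + colSign j * p.w j * p.d j := by
  rw [S, S, Finset.sum_range_succ, add_assoc]

lemma X_succ (j : ℕ) : p.X (j + 1) = p.X j + p.w j := Finset.sum_range_succ _ _

lemma Y_sub_Y (i j : ℕ) :
    p.Y i j - p.Y (i + 1) j = p.ℓ i - p.σ * p.S j * (p.z (i + 1) - p.z i) := by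
  rw [Y, Y, Finset.sum_range_succ]; ring

lemma Y_sub_pos {i j : ℕ} (hi : i ≤ p.rows) (hj : j ≤ p.cols + 1) :
    0 < p.Y i j - p.Y (i + 1) j := by
  rw [Y_sub_Y]; exact p.length_pos i hi j hj

lemma ℓ_pos {i : ℕ} (hi : i ≤ p.rows) : 0 < p.ℓ i := by
  have h := p.Y_sub_pos hi (j := 1) (by omega)
  rwa [Y_sub_Y, S_one, mul_zero, zero_mul, sub_zero] at h

lemma σ_ne : p.σ ≠ 0 := by
  intro h
  have := p.σ_sq
  rw [h] at this
  norm_num at this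

/-- The sector angles. -/
def angle (i j : ℕ) : ℝ := Real.pi / 2 - Real.arctan (p.σ * p.z i * p.d j)

lemma cot_ne (i j : ℕ) : p.σ * p.z i * p.d j ≠ 0 :=
  mul_ne_zero (mul_ne_zero p.σ_ne (p.z_pos i).ne') (p.d_pos j).ne'

/-- The creased paper with the given data. -/
def paper : OrthodiagonalPaper where
  rows := p.rows
  cols := p.cols
  X := p.X
  Y := p.Y
  α := p.angle
  one_le_rows := p.one_le_rows
  one_le_cols := p.one_le_cols
  X_lt j _ := by rw [X_succ]; linarith [p.w_pos j]
  Y_lt i hi j hj := sub_pos.1 (p.Y_sub_pos hi hj)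
  sector_left i hi j hj := by
    obtain ⟨k, rfl⟩ := Nat.exists_eq_add_of_le' hj.1
    have hw := p.w_pos k
    rw [OrthodiagonalPaper.gridPoint_angle (X := p.X) (Y := p.Y) hi
      (fun i hi => sub_pos.1 (p.Y_sub_pos hi (by have := hj.2; omega)))
      (by rw [Nat.add_sub_cancel, X_succ]; linarith), angle]
    congr 2
    rw [Nat.add_sub_cancel, X_succ, Y, Y, S_succ, colSign_succ]
    have : p.X k - (p.X k + p.w k) = -p.w k := by ring
    rw [this, abs_neg, abs_of_pos hw]
    field_simp
    linear_combination (p.σ * p.z i * p.w k * p.d k) * colSign_sq k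
  sector_right i hi j hj := by
    have hw := p.w_pos j
    rw [OrthodiagonalPaper.gridPoint_angle (X := p.X) (Y := p.Y) hi
      (fun i hi => sub_pos.1 (p.Y_sub_pos hi (by have := hj.2; omega)))
      (by rw [X_succ]; linarith), angle]
    congr 2
    rw [X_succ, Y, Y, S_succ]
    have : p.X j + p.w j - p.X j = p.w j := by ring
    rw [this, abs_of_pos hw]
    field_simp
    linear_combination (p.σ * p.z i * p.w j * p.d j) * colSign_sq j
  α_ne i _ j _ h := by
    rw [angle, sub_eq_self, Real.arctan_eq_zero_iff] at h
    exact p.cot_ne i j h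
  tan_ratio i j _ _ _ := by
    simp only [angle, Real.tan_pi_div_two_sub, Real.tan_arctan]
    have h1 := p.σ_ne
    have h2 := (p.z_pos i).ne'
    have h3 := (p.z_pos (i + 1)).ne'
    have h4 := (p.d_pos j).ne'
    have h5 := (p.d_pos (j + 1)).ne'
    field_simp

lemma paper_X : p.paper.X = p.X := rfl
lemma paper_Y : p.paper.Y = p.Y := rfl
lemma paper_α : p.paper.α = p.angle := rfl

lemma haltingAngles : p.paper.HaltingAngles := by
  intro j hj
  have h1 := p.σ_ne
  have h2 := p.z_pos 1
  have h3 := p.d_pos j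
  have h4 := p.d_lt j hj.1
  rw [paper_α]
  simp only [angle, sub_sub_cancel_left, abs_neg, neg_mul_neg, p.d_zero, mul_one]
  have mono := Real.arctan_strictMono
  rcases lt_or_gt_of_ne h1 with h | h
  · have a : p.σ * p.z 1 < 0 := mul_neg_of_neg_of_pos h h2
    have b : p.σ * p.z 1 * p.d j < 0 := mul_neg_of_neg_of_pos a h3
    have a' : Real.arctan (p.σ * p.z 1) < 0 := by simpa using mono a
    have b' : Real.arctan (p.σ * p.z 1 * p.d j) < 0 := by simpa using mono b
    refine ⟨mul_pos_of_neg_of_neg b' a', ?_⟩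
    rw [abs_of_neg a', abs_of_neg b', neg_lt_neg_iff]
    exact mono (by nlinarith)
  · have a : 0 < p.σ * p.z 1 := mul_pos h h2
    have b : 0 < p.σ * p.z 1 * p.d j := mul_pos a h3
    have a' : 0 < Real.arctan (p.σ * p.z 1) := by simpa using mono a
    have b' : 0 < Real.arctan (p.σ * p.z 1 * p.d j) := by simpa using mono b
    refine ⟨mul_pos b' a', ?_⟩
    rw [abs_of_pos a', abs_of_pos b']
    exact mono (by nlinarith)

end PaperData

/-! ### The folding motion -/

namespace PaperData

variable (p : PaperData) (D₀ V₀ : ℂ)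

/-- The tangent of half the turning angle of the first inner column at row `i`, at time `κ`. -/
def turn (κ : ℝ) (i : ℕ) : ℝ := (-1) ^ i * κ / p.z i

/-- The directions of the column creases at time `κ`. -/
def dir (κ : ℝ) : ℕ → ℂ
  | 0 => D₀
  | i + 1 => dir κ i * tanRot (p.turn κ (i + 1))

/-- The vertices of the first inner column at time `κ`. -/
def spine (κ : ℝ) (i : ℕ) : ℂ := V₀ + ∑ k ∈ Finset.range i, p.ℓ k * p.dir D₀ κ k

/-- The vector along row `i` by which the columns are shifted at time `κ`, up to the factor
`-σ S j`. -/
def shift (κ : ℝ) (i : ℕ) : ℂ := p.dir D₀ κ i * (p.z i - (-1) ^ i * κ * Complex.I)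

/-- The height of a panel over the plane of the first column, at time `κ`. -/
def rise (κ : ℝ) (j : ℕ) : ℝ := p.w j * √(1 - p.d j ^ 2 * κ ^ 2)

/-- The height of column `j` at time `κ`. -/
def height (κ : ℝ) (j : ℕ) : ℝ := ∑ k ∈ Finset.range j, p.rise κ k

/-- The folding motion, in space as the product of the complex plane and a line. The first inner
column runs along `spine` over the complex plane; column `j` is shifted against it by
`-σ S j • shift i` at row `i`, and lies at the height `height j`. -/
def motion (κ : ℝ) (v : ℕ × ℕ) : E3 :=
  spacePoint (p.spine D₀ V₀ κ v.1 - (p.σ * p.S v.2 : ℝ) * p.shift D₀ κ v.1) (p.height κ v.2)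

lemma dir_succ (κ : ℝ) (i : ℕ) :
    p.dir D₀ κ (i + 1) = p.dir D₀ κ i * tanRot (p.turn κ (i + 1)) := rfl

variable {D₀}

lemma norm_dir (hD : ‖D₀‖ = 1) (κ : ℝ) (i : ℕ) : ‖p.dir D₀ κ i‖ = 1 := by
  induction i with
  | zero => exact hD
  | succ i ih => rw [dir_succ, norm_mul, ih, norm_tanRot, one_mul]

lemma dir_ne_zero (hD : ‖D₀‖ = 1) (κ : ℝ) (i : ℕ) : p.dir D₀ κ i ≠ 0 := by
  rw [← norm_ne_zero_iff, norm_dir p hD]; exact one_ne_zero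

lemma spine_succ (κ : ℝ) (i : ℕ) :
    p.spine D₀ V₀ κ (i + 1) = p.spine D₀ V₀ κ i + p.ℓ i * p.dir D₀ κ i := by
  rw [spine, spine, Finset.sum_range_succ, add_assoc]

lemma turn_mul (κ : ℝ) (i : ℕ) : p.turn κ i * p.z i = (-1) ^ i * κ :=
  div_mul_cancel₀ _ (p.z_pos i).ne'

/-- The shift of the next row, in terms of the crease direction common to both rows. -/
lemma shift_succ_eq (κ : ℝ) (i : ℕ) : p.shift D₀ κ (i + 1) =
    p.dir D₀ κ i * p.z (i + 1) * (1 + p.turn κ (i + 1) * Complex.I) := by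
  have h : ((-1) ^ (i + 1) * κ : ℂ) = p.turn κ (i + 1) * p.z (i + 1) := by
    have := congrArg Complex.ofReal (p.turn_mul κ (i + 1))
    push_cast at this
    exact this.symm
  rw [shift, dir_succ, h]
  linear_combination (p.dir D₀ κ i * p.z (i + 1)) * tanRot_mul (p.turn κ (i + 1))

lemma shift_succ (κ : ℝ) (i : ℕ) : p.shift D₀ κ (i + 1) =
    p.shift D₀ κ i + (p.z (i + 1) - p.z i) * p.dir D₀ κ i := by
  have h : ((-1) ^ (i + 1) * κ : ℂ) = p.turn κ (i + 1) * p.z (i + 1) := by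
    have := congrArg Complex.ofReal (p.turn_mul κ (i + 1))
    push_cast at this
    exact this.symm
  rw [shift_succ_eq, shift]
  rw [pow_succ] at h
  linear_combination (-p.dir D₀ κ i * Complex.I) * h

lemma motion_sub_column (κ : ℝ) (i j : ℕ) :
    p.motion D₀ V₀ κ (i + 1, j) - p.motion D₀ V₀ κ (i, j) =
      (p.Y i j - p.Y (i + 1) j) • spacePoint (p.dir D₀ κ i) 0 := by
  rw [motion, motion, spacePoint_sub, smul_spacePoint, spacePoint_inj, Y_sub_Y, spine_succ,
    shift_succ]
  refine ⟨?_, by ring⟩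
  push_cast
  ring

lemma height_succ (κ : ℝ) (j : ℕ) : p.height κ (j + 1) = p.height κ j + p.rise κ j :=
  Finset.sum_range_succ _ _

lemma motion_sub_row (κ : ℝ) (i j : ℕ) :
    p.motion D₀ V₀ κ (i, j + 1) - p.motion D₀ V₀ κ (i, j) =
      spacePoint (-(p.σ * colSign j * p.w j * p.d j : ℝ) * p.shift D₀ κ i) (p.rise κ j) := by
  rw [motion, motion, spacePoint_sub, spacePoint_inj, S_succ, height_succ]
  refine ⟨?_, by ring⟩
  push_cast
  ring

lemma one_sub_nonneg {κ : ℝ} (hκ : κ ∈ Set.Icc (0 : ℝ) 1) (j : ℕ) : 0 ≤ 1 - p.d j ^ 2 * κ ^ 2 := by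
  have h1 : p.d j ≤ 1 := by
    rcases Nat.eq_zero_or_pos j with rfl | h
    · exact p.d_zero.le
    · exact (p.d_lt j h).le
  have := mul_le_one₀ h1 hκ.1 hκ.2
  have h2 := mul_nonneg (p.d_pos j).le hκ.1
  nlinarith

lemma rise_nonneg (κ : ℝ) (j : ℕ) : 0 ≤ p.rise κ j :=
  mul_nonneg (p.w_pos j).le (Real.sqrt_nonneg _)

lemma rise_pos {κ : ℝ} (hκ : κ ∈ Set.Icc (0 : ℝ) 1) {j : ℕ} (h : κ < 1 ∨ 1 ≤ j) :
    0 < p.rise κ j := by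
  refine mul_pos (p.w_pos j) (Real.sqrt_pos.2 ?_)
  have hlt : p.d j * κ < 1 := by
    have hd := p.d_pos j
    rcases Nat.eq_zero_or_pos j with rfl | hj
    · rw [p.d_zero, one_mul]; exact h.resolve_right (by norm_num)
    · nlinarith [p.d_lt j hj, hκ.1, hκ.2]
  have := mul_nonneg (p.d_pos j).le hκ.1
  nlinarith

lemma norm_shift_sq (hD : ‖D₀‖ = 1) (κ : ℝ) (i : ℕ) :
    ‖p.shift D₀ κ i‖ ^ 2 = p.z i ^ 2 + κ ^ 2 := by
  have h : ((-1) ^ i : ℝ) ^ 2 = 1 := by rw [← pow_mul, mul_comm, pow_mul]; norm_num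
  rw [shift, norm_mul, norm_dir p hD, one_mul, ← Complex.normSq_eq_norm_sq, Complex.normSq_apply]
  have e : (p.z i - (-1) ^ i * κ * Complex.I : ℂ) = ⟨p.z i, -((-1) ^ i * κ)⟩ := by
    apply Complex.ext
    · have : (((-1) ^ i : ℝ) * κ * Complex.I : ℂ).re = 0 := by
        rw [← Complex.ofReal_mul, Complex.re_ofReal_mul, Complex.I_re, mul_zero]
      push_cast at this
      simp [this]
    · have : (((-1) ^ i : ℝ) * κ * Complex.I : ℂ).im = (-1) ^ i * κ := by
        rw [← Complex.ofReal_mul, Complex.im_ofReal_mul, Complex.I_im, mul_one]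
      push_cast at this
      simp [this]
  rw [e]
  linear_combination κ ^ 2 * h

lemma inner_shift_dir (hD : ‖D₀‖ = 1) (κ : ℝ) (i : ℕ) :
    (p.shift D₀ κ i).re * (p.dir D₀ κ i).re + (p.shift D₀ κ i).im * (p.dir D₀ κ i).im = p.z i := by
  have h1 := norm_dir p hD κ i
  have h2 : (p.dir D₀ κ i).re * (p.dir D₀ κ i).re + (p.dir D₀ κ i).im * (p.dir D₀ κ i).im = 1 := by
    rw [← Complex.normSq_apply, Complex.normSq_eq_norm_sq, h1, one_pow]
  have e : (p.z i - (-1) ^ i * κ * Complex.I : ℂ)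
      = (p.z i : ℝ) - ((-1) ^ i * κ : ℝ) * Complex.I := by push_cast; ring
  rw [shift, e]
  simp only [Complex.mul_re, Complex.mul_im, Complex.sub_re, Complex.sub_im, Complex.ofReal_re,
    Complex.ofReal_im, Complex.I_re, Complex.I_im]
  linear_combination p.z i * h2

lemma isFolded_motion (hD : ‖D₀‖ = 1) {κ : ℝ} (hκ : κ ∈ Set.Icc (0 : ℝ) 1) :
    p.paper.IsFolded (p.motion D₀ V₀ κ) := by
  refine OrthodiagonalPaper.isFolded_of_directions
    (D := fun i => spacePoint (p.dir D₀ κ i) 0) ?_ ?_ ?_ ?_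
  · intro i _
    rw [norm_spacePoint_zero, norm_dir p hD]
  · intro i _ j _
    exact p.motion_sub_column V₀ κ i j
  · intro i _ j _
    rw [motion_sub_row, inner_spacePoint, paper_Y, Y, Y, S_succ, mul_zero, add_zero,
      ← Complex.ofReal_neg, Complex.re_ofReal_mul, Complex.im_ofReal_mul]
    linear_combination (-(p.σ * colSign j * p.w j * p.d j)) * p.inner_shift_dir hD κ i
  · intro i _ j _
    rw [motion_sub_row, norm_spacePoint_sq, ← Complex.ofReal_neg, norm_mul, mul_pow,
      norm_shift_sq p hD, Complex.norm_real, Real.norm_eq_abs, sq_abs, rise, mul_pow,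
      Real.sq_sqrt (p.one_sub_nonneg hκ j), paper_X, paper_Y, X_succ, Y, Y, S_succ]
    have h1 := colSign_sq j
    have h2 := p.σ_sq
    linear_combination (p.w j ^ 2 * p.d j ^ 2 * κ ^ 2 * p.σ ^ 2) * h1
      + (p.w j ^ 2 * p.d j ^ 2 * κ ^ 2) * h2

lemma isDirection_motion (hD : ‖D₀‖ = 1) (κ : ℝ) :
    p.paper.IsDirection (p.motion D₀ V₀ κ) (fun i => spacePoint (p.dir D₀ κ i) 0) where
  norm_eq i _ := by rw [norm_spacePoint_zero, norm_dir p hD]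
  sub_eq i _ j _ := p.motion_sub_column V₀ κ i j

lemma turn_zero (i : ℕ) : p.turn 0 i = 0 := by simp [turn]

lemma dir_zero (i : ℕ) : p.dir D₀ 0 i = D₀ := by
  induction i with
  | zero => rfl
  | succ i ih => rw [dir_succ, ih, turn_zero]; simp [tanRot]

lemma motion_zero (v : ℕ × ℕ) :
    p.motion D₀ V₀ 0 v = spacePoint (V₀ - (p.Y v.1 v.2 : ℝ) * D₀) (p.X v.2) := by
  rw [motion, spacePoint_inj]
  constructor
  · simp only [spine, shift, dir_zero, Y]
    rw [← Finset.sum_mul]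
    push_cast
    ring
  · simp [height, rise, X]

/-- At time `0` the paper is planar. -/
lemma planar_motion (hD : ‖D₀‖ = 1) (v w : ℕ × ℕ) :
    dist (p.motion D₀ V₀ 0 v) (p.motion D₀ V₀ 0 w) =
      dist (p.paper.vertex v) (p.paper.vertex w) := by
  rw [← pow_left_inj₀ dist_nonneg dist_nonneg two_ne_zero, motion_zero, motion_zero, dist_eq_norm,
    dist_eq_norm, spacePoint_sub, norm_spacePoint_sq,
    ← real_inner_self_eq_norm_sq (p.paper.vertex v - _),
    OrthodiagonalPaper.inner_vertex_sub, paper_X, paper_Y]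
  have : V₀ - (p.Y v.1 v.2 : ℝ) * D₀ - (V₀ - (p.Y w.1 w.2 : ℝ) * D₀)
      = (p.Y w.1 w.2 - p.Y v.1 v.2 : ℝ) * D₀ := by push_cast; ring
  rw [this, norm_mul, hD, mul_one, Complex.norm_real, Real.norm_eq_abs, sq_abs]
  ring

lemma continuous_turn (i : ℕ) : Continuous fun κ => p.turn κ i := by unfold turn; fun_prop

lemma continuous_dir (i : ℕ) : Continuous fun κ => p.dir D₀ κ i := by
  induction i with
  | zero => exact continuous_const
  | succ i ih => exact ih.mul (continuous_tanRot.comp (p.continuous_turn (i + 1)))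

lemma continuous_motion (v : ℕ × ℕ) : Continuous fun κ => p.motion D₀ V₀ κ v := by
  have h := fun i => p.continuous_dir (D₀ := D₀) i
  unfold motion
  refine continuous_spacePoint.comp (f := fun κ => (p.spine D₀ V₀ κ v.1
    - (p.σ * p.S v.2 : ℝ) * p.shift D₀ κ v.1, p.height κ v.2)) (Continuous.prodMk ?_ ?_)
  · unfold spine shift; fun_prop
  · unfold height rise; fun_prop

/-- The turning angle at the first row determines the time. -/
lemma turn_one_inj {κ κ' : ℝ} (h0 : 0 ≤ κ) (h0' : 0 ≤ κ')
    (h : (tanRot (p.turn κ 1)).re = (tanRot (p.turn κ' 1)).re) : κ = κ' := by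
  have hz := p.z_pos 1
  rw [tanRot_re, tanRot_re, div_eq_div_iff (one_add_sq_ne _) (one_add_sq_ne _)] at h
  have h2 : p.turn κ 1 ^ 2 = p.turn κ' 1 ^ 2 := by linarith
  simp only [turn, pow_one, div_pow] at h2
  rw [div_left_inj' (by positivity)] at h2
  have h3 : κ ^ 2 = κ' ^ 2 := by linear_combination h2
  exact (pow_left_inj₀ h0 h0' two_ne_zero).1 h3

lemma mem_grid {i j : ℕ} (hi : i ≤ p.rows + 1) (hj : j ≤ p.cols + 1) : (i, j) ∈ p.paper.grid :=
  ⟨hi, hj⟩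

/-- The distance of the vertices above and below the first inner row, on the first inner column. It
tells the states of the motion apart. -/
lemma dist_motion_sq (hD : ‖D₀‖ = 1) (κ : ℝ) :
    dist (p.motion D₀ V₀ κ (2, 1)) (p.motion D₀ V₀ κ (0, 1)) ^ 2 =
      p.ℓ 0 ^ 2 + p.ℓ 1 ^ 2 + 2 * p.ℓ 0 * p.ℓ 1 * (tanRot (p.turn κ 1)).re := by
  have e : p.motion D₀ V₀ κ (2, 1) - p.motion D₀ V₀ κ (0, 1)
      = spacePoint (D₀ * (p.ℓ 0 + p.ℓ 1 * tanRot (p.turn κ 1))) 0 := by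
    rw [motion, motion, spacePoint_sub, spacePoint_inj, S_one]
    refine ⟨?_, by ring⟩
    simp only [spine, Finset.sum_range_succ, Finset.sum_range_zero, dir]
    push_cast
    ring
  rw [dist_eq_norm, e, norm_spacePoint_zero, norm_mul, hD, one_mul, ← Complex.normSq_eq_norm_sq,
    Complex.normSq_apply]
  have h : (tanRot (p.turn κ 1)).re ^ 2 + (tanRot (p.turn κ 1)).im ^ 2 = 1 := by
    have := norm_tanRot (p.turn κ 1)
    rw [← pow_left_inj₀ (norm_nonneg _) zero_le_one two_ne_zero, ← Complex.normSq_eq_norm_sq,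
      Complex.normSq_apply] at this
    linear_combination this
  simp only [Complex.add_re, Complex.add_im, Complex.ofReal_re, Complex.ofReal_im,
    Complex.re_ofReal_mul, Complex.im_ofReal_mul]
  linear_combination p.ℓ 1 ^ 2 * h

lemma motion_injective (hD : ‖D₀‖ = 1) {κ κ' : ℝ} (h0 : 0 ≤ κ) (h0' : 0 ≤ κ')
    (h : p.paper.SameShape (p.motion D₀ V₀ κ) (p.motion D₀ V₀ κ')) : κ = κ' := by
  have h1 := p.one_le_rows
  have h2 := h (2, 1) (p.mem_grid (by omega) (by omega)) (0, 1) (p.mem_grid (by omega) (by omega))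
  apply p.turn_one_inj h0 h0'
  have h3 := congrArg (· ^ 2) h2
  simp only [dist_motion_sq p V₀ hD] at h3
  have l0 := p.ℓ_pos (i := 0) (by omega)
  have l1 := p.ℓ_pos h1
  have : 2 * p.ℓ 0 * p.ℓ 1 ≠ 0 := by positivity
  apply mul_left_cancel₀ this
  linarith

/-- The column does not fold back on itself: consecutive directions are not opposite. -/
lemma dir_succ_ne_neg_smul (hD : ‖D₀‖ = 1) (κ : ℝ) (i : ℕ) {a b : ℝ} (ha : 0 < a) (hb : 0 < b) :
    -(a : ℂ) * p.dir D₀ κ i ≠ b * p.dir D₀ κ (i + 1) := by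
  intro h
  rw [dir_succ] at h
  have h1 : -(a : ℂ) = b * tanRot (p.turn κ (i + 1)) := by
    apply mul_right_cancel₀ (p.dir_ne_zero hD κ i)
    rw [h]; ring
  have h2 := congrArg (fun x : ℂ => (x * (1 - p.turn κ (i + 1) * Complex.I)).re) h1
  rw [mul_assoc, tanRot_mul, ← Complex.ofReal_neg, Complex.re_ofReal_mul,
      Complex.re_ofReal_mul] at h2
  simp at h2
  linarith

/-- Panels above and below a row do not clash, except in the leftmost panel column at time `1`,
where the row crease does not rise. -/
lemma not_rowClash (hD : ‖D₀‖ = 1) {κ : ℝ} (hκ : κ ∈ Set.Icc (0 : ℝ) 1) {i j : ℕ}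
    (hi : i ∈ Set.Icc 1 p.rows) (hj : j ≤ p.cols) (h : κ < 1 ∨ 1 ≤ j) :
    ¬ OrthodiagonalPaper.RowClash (p.motion D₀ V₀ κ) i j := by
  intro hc
  obtain ⟨k, rfl⟩ := Nat.exists_eq_add_of_le' hi.1
  obtain ⟨⟨c, hc0, s, hs⟩, -⟩ := sSameSide_line_iff.1 hc
  have hr := p.rise_pos hκ h
  rw [Nat.add_sub_cancel, ← neg_sub (p.motion D₀ V₀ κ (k + 1, j)), motion_sub_column,
      motion_sub_column,
    motion_sub_row, ← neg_smul, smul_smul, smul_spacePoint, smul_spacePoint, smul_spacePoint,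
    spacePoint_add, spacePoint_inj] at hs
  obtain ⟨h1, h2⟩ := hs
  have hs0 : s = 0 := by
    rw [mul_zero, mul_zero, zero_add, eq_comm, mul_eq_zero] at h2
    exact h2.resolve_right hr.ne'
  rw [hs0, Complex.ofReal_zero, zero_mul, add_zero, Complex.ofReal_neg] at h1
  exact p.dir_succ_ne_neg_smul hD κ k
    (p.Y_sub_pos (i := k) (j := j) (by have := hi.2; omega) (by omega))
    (mul_pos hc0 (p.Y_sub_pos (i := k + 1) (j := j) hi.2 (by omega))) h1

/-- Panels on the two sides of a column do not clash, because the row creases rise from left to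
right. -/
lemma not_colClash {κ : ℝ} (hκ : κ ∈ Set.Icc (0 : ℝ) 1) {i j : ℕ} (hj : j ∈ Set.Icc 1 p.cols) :
    ¬ OrthodiagonalPaper.ColClash (p.motion D₀ V₀ κ) i j := by
  intro hc
  obtain ⟨k, rfl⟩ := Nat.exists_eq_add_of_le' hj.1
  obtain ⟨⟨c, hc0, s, hs⟩, -⟩ := sSameSide_line_iff.1 hc
  have hr := p.rise_pos hκ (Or.inr hj.1)
  have hr' := p.rise_nonneg κ k
  rw [Nat.add_sub_cancel, ← neg_sub (p.motion D₀ V₀ κ (i, k + 1)), motion_sub_column,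
      motion_sub_row,
    motion_sub_row, smul_smul, ← neg_one_smul ℝ, smul_spacePoint, smul_spacePoint, smul_spacePoint,
    spacePoint_add, spacePoint_inj] at hs
  have h2 := hs.2
  have := mul_pos hc0 hr
  linarith

/-- At time `1` the panels to the left of the first inner column clash. -/
lemma rowClash_motion_one (hD : ‖D₀‖ = 1) {i : ℕ} (hi : i ∈ Set.Icc 1 p.rows) :
    OrthodiagonalPaper.RowClash (p.motion D₀ V₀ 1) i 0 := by
  obtain ⟨k, rfl⟩ := Nat.exists_eq_add_of_le' hi.1
  set a := p.Y k 0 - p.Y (k + 1) 0 with ha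
  set b := p.Y (k + 1) 0 - p.Y (k + 1 + 1) 0 with hb
  have ha0 : 0 < a := p.Y_sub_pos (by have := hi.2; omega) (by omega)
  have hb0 : 0 < b := p.Y_sub_pos hi.2 (by omega)
  have hw := p.w_pos 0
  set x := p.turn 1 (k + 1) with hx
  have hz := p.z_pos (k + 1)
  have hr0 : p.rise 1 0 = 0 := by simp [rise, p.d_zero]
  have hrow : p.motion D₀ V₀ 1 (k + 1, 0 + 1) - p.motion D₀ V₀ 1 (k + 1, 0) =
      spacePoint ((p.σ * p.w 0 : ℝ) * p.shift D₀ 1 (k + 1)) 0 := by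
    rw [motion_sub_row, hr0, colSign_zero, p.d_zero]
    congr 1
    push_cast
    ring
  refine sSameSide_line_iff.2 ⟨⟨a / b, by positivity,
    -(a * (2 / (p.z (k + 1) * (1 + x ^ 2)))) / (p.σ * p.w 0), ?_⟩, fun s hs => ?_⟩
  · rw [Nat.add_sub_cancel, ← neg_sub (p.motion D₀ V₀ 1 (k + 1, 0)), motion_sub_column,
      motion_sub_column, hrow, ← ha, ← hb, ← neg_smul, smul_smul, smul_spacePoint, smul_spacePoint,
      smul_spacePoint, spacePoint_add, spacePoint_inj]
    refine ⟨?_, by ring⟩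
    have hσ := p.σ_ne
    have e1 : a / b * b = a := by field_simp
    have e2 : (-(a * (2 / (p.z (k + 1) * (1 + x ^ 2)))) / (p.σ * p.w 0)) * (p.σ * p.w 0)
        = -(a * (2 / (p.z (k + 1) * (1 + x ^ 2)))) := by field_simp
    rw [e1, ← mul_assoc, ← Complex.ofReal_mul, e2, shift_succ_eq, dir_succ, ← hx, tanRot,
      Complex.ofReal_neg]
    have c1 := one_sub_mul_I_ne x
    have c2 : (p.z (k + 1) : ℂ) ≠ 0 := by exact_mod_cast hz.ne'
    have c3 : (1 + x ^ 2 : ℂ) ≠ 0 := by exact_mod_cast one_add_sq_ne x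
    push_cast
    field_simp
    linear_combination (-2 * a * p.dir D₀ 1 k * (x : ℂ) ^ 2) * Complex.I_sq
  · rw [motion_sub_column, hrow, ← hb, smul_spacePoint, smul_spacePoint, spacePoint_inj] at hs
    have h1 := hs.1
    rw [shift] at h1
    have h2 : (b : ℂ) = (s * (p.σ * p.w 0) : ℝ) *
        ((p.z (k + 1) : ℝ) - ((-1) ^ (k + 1) : ℝ) * Complex.I) := by
      apply mul_right_cancel₀ (p.dir_ne_zero hD 1 (k + 1))
      rw [h1]; push_cast; ring
    have h3 := congrArg Complex.im h2
    have h4 := congrArg Complex.re h2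
    rw [Complex.im_ofReal_mul, Complex.sub_im, Complex.im_ofReal_mul, Complex.ofReal_im,
      Complex.ofReal_im, Complex.I_im, zero_sub, mul_one, eq_comm, mul_eq_zero] at h3
    rw [Complex.re_ofReal_mul, h3.resolve_right, zero_mul, Complex.ofReal_re] at h4
    · exact hb0.ne' h4
    · exact neg_ne_zero.2 (pow_ne_zero _ (by norm_num))

end PaperData

/-! ### One degree of freedom -/

/-- The vector product of space. -/
def cross (a b : E3) : E3 :=
  !₂[a 1 * b 2 - a 2 * b 1, a 2 * b 0 - a 0 * b 2, a 0 * b 1 - a 1 * b 0]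

lemma inner_cross (a b c : E3) : inner ℝ (cross a b) c =
    (a 1 * b 2 - a 2 * b 1) * c 0 + (a 2 * b 0 - a 0 * b 2) * c 1
      + (a 0 * b 1 - a 1 * b 0) * c 2 := by
  simp [cross, PiLp.inner_apply, Fin.sum_univ_three]; ring

lemma inner_cross_left (a b : E3) : inner ℝ (cross a b) a = 0 := by rw [inner_cross]; ring

lemma inner_cross_right (a b : E3) : inner ℝ (cross a b) b = 0 := by rw [inner_cross]; ring

lemma continuous_inner_cross {X : Type*} [TopologicalSpace X] {a b c : X → E3}
    (ha : Continuous a) (hb : Continuous b) (hc : Continuous c) :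
    Continuous fun x => inner ℝ (cross (a x) (b x)) (c x) := by
  have h : ∀ {f : X → E3}, Continuous f → ∀ k, Continuous fun x => f x k := fun hf k =>
    (PiLp.continuous_apply 2 _ k).comp hf
  simp only [inner_cross]
  exact (((((h ha 1).mul (h hb 2)).sub ((h ha 2).mul (h hb 1))).mul (h hc 0)).add
    ((((h ha 2).mul (h hb 0)).sub ((h ha 0).mul (h hb 2))).mul (h hc 1))).add
    ((((h ha 0).mul (h hb 1)).sub ((h ha 1).mul (h hb 0))).mul (h hc 2))

/-- The vectors orthogonal to two independent vectors of space form a line. -/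
lemma eq_smul_of_orthogonal {a b n x : E3} (hab : LinearIndependent ℝ ![a, b]) (hn : n ≠ 0)
    (hna : inner ℝ a n = 0) (hnb : inner ℝ b n = 0) (hxa : inner ℝ a x = 0)
    (hxb : inner ℝ b x = 0) : ∃ c : ℝ, x = c • n := by
  set U := Submodule.span ℝ (Set.range ![a, b])
  have h2 : Module.finrank ℝ U = 2 := by
    rw [finrank_span_eq_card hab, Fintype.card_fin]
  have h3 := U.finrank_add_finrank_orthogonal
  rw [h2, finrank_euclideanSpace_fin] at h3
  have h1 : Module.finrank ℝ Uᗮ = 1 := by omega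
  have mem : ∀ y : E3, inner ℝ a y = 0 → inner ℝ b y = 0 → y ∈ Uᗮ := by
    intro y ha hb
    rw [Submodule.mem_orthogonal]
    intro u hu
    induction hu using Submodule.span_induction with
    | mem u hu =>
      obtain ⟨i, rfl⟩ := hu
      fin_cases i
      · exact ha
      · exact hb
    | zero => simp
    | add u v _ _ hu hv => rw [inner_add_left, hu, hv, add_zero]
    | smul c u _ hu => rw [inner_smul_left, hu, mul_zero]
  have hn' : (⟨n, mem n hna hnb⟩ : Uᗮ) ≠ 0 := by
    intro h; exact hn (congrArg Subtype.val h)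
  obtain ⟨c, hc⟩ := (finrank_eq_one_iff_of_nonzero' _ hn').1 h1 ⟨x, mem x hxa hxb⟩
  exact ⟨c, (congrArg Subtype.val hc).symm⟩

/-- A vector is determined by its norm, its scalar products with two independent vectors, and the
side of their plane on which it lies. -/
lemma eq_of_inner_eq_of_norm_eq {a b n x y : E3} (hab : LinearIndependent ℝ ![a, b])
    (hna : inner ℝ a n = 0) (hnb : inner ℝ b n = 0) (ha : inner ℝ a x = inner ℝ a y)
    (hb : inner ℝ b x = inner ℝ b y) (hnorm : ‖x‖ = ‖y‖) (hx : 0 < inner ℝ n x)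
    (hy : 0 < inner ℝ n y) : x = y := by
  have hn : n ≠ 0 := by rintro rfl; simp at hx
  obtain ⟨c, hc⟩ := eq_smul_of_orthogonal hab hn hna hnb (x := x - y)
    (by rw [inner_sub_right, ha, sub_self]) (by rw [inner_sub_right, hb, sub_self])
  have h : inner ℝ (x - y) (x + y) = 0 := by
    rw [inner_sub_left, inner_add_right, inner_add_right, real_inner_self_eq_norm_sq,
      real_inner_self_eq_norm_sq, hnorm, real_inner_comm]; ring
  rw [hc, inner_smul_left, inner_add_right, mul_eq_zero] at h
  have hc0 : c = 0 := h.resolve_right (by positivity)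
  rw [hc0, zero_smul] at hc
  exact sub_eq_zero.1 hc

/-- At most two unit vectors have given scalar products with two independent vectors. -/
lemma eq_of_inner_eq_of_ne {a b o x y : E3} (hab : LinearIndependent ℝ ![a, b])
    (hxa : inner ℝ a x = inner ℝ a o) (hxb : inner ℝ b x = inner ℝ b o)
    (hya : inner ℝ a y = inner ℝ a o) (hyb : inner ℝ b y = inner ℝ b o)
    (hx : ‖x‖ = ‖o‖) (hy : ‖y‖ = ‖o‖) (hxo : x ≠ o) (hyo : y ≠ o) : x = y := by
  have hn : x - o ≠ 0 := sub_ne_zero.2 hxo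
  obtain ⟨c, hc⟩ := eq_smul_of_orthogonal hab hn (x := y - o)
    (by rw [inner_sub_right, hxa, sub_self]) (by rw [inner_sub_right, hxb, sub_self])
    (by rw [inner_sub_right, hya, sub_self]) (by rw [inner_sub_right, hyb, sub_self])
  have hc0 : c ≠ 0 := by
    rintro rfl
    rw [zero_smul] at hc
    exact hyo (sub_eq_zero.1 hc)
  have e : ∀ v : E3, ‖v‖ = ‖o‖ → 2 * inner ℝ o (v - o) + ‖v - o‖ ^ 2 = 0 := by
    intro v hv
    have := norm_add_sq_real o (v - o)
    rw [add_sub_cancel, hv] at this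
    linarith
  have e1 := e x hx
  have e2 := e y hy
  rw [hc, inner_smul_right, norm_smul, mul_pow, Real.norm_eq_abs, sq_abs] at e2
  have hp : 0 < ‖x - o‖ ^ 2 := by positivity
  have : c * (c - 1) * ‖x - o‖ ^ 2 = 0 := by linear_combination e2 - c * e1
  have hc1 : c = 1 := by
    rcases mul_eq_zero.1 this with h | h
    · rcases mul_eq_zero.1 h with h | h
      · exact absurd h hc0
      · linarith
    · exact absurd h hp.ne'
  rw [hc1, one_smul] at hc
  exact (sub_left_inj.1 hc).symm

namespace OrthodiagonalPaper

variable {P : OrthodiagonalPaper} {F G : ℕ × ℕ → E3} {D C : ℕ → E3}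

/-- A folded state is determined, up to congruence, by the directions of the column creases and the
creases of the first inner row. -/
lemma sameShape_of_eq (hF : P.IsDirection F D) (hG : P.IsDirection G C)
    (hDC : ∀ i ≤ P.rows, C i = D i)
    (hrow : ∀ j ≤ P.cols, G (1, j + 1) - G (1, j) = F (1, j + 1) - F (1, j)) :
    P.SameShape G F := by
  have h1 : ∀ j ≤ P.cols + 1, G (1, j) - F (1, j) = G (1, 0) - F (1, 0) := by
    intro j
    induction j with
    | zero => exact fun _ => rfl
    | succ j ih =>
      intro hj
      rw [← ih (by omega), ← sub_eq_zero]
      have := hrow j (by omega)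
      rw [← sub_eq_zero] at this
      rw [← this]; abel
  have step : ∀ i ≤ P.rows, ∀ j ≤ P.cols + 1,
      G (i + 1, j) - F (i + 1, j) = G (i, j) - F (i, j) := by
    intro i hi j hj
    have e1 := hF.sub_eq i hi j hj
    have e2 := hG.sub_eq i hi j hj
    rw [hDC i hi, ← e1, ← sub_eq_zero] at e2
    rw [← sub_eq_zero, ← e2]; abel
  have h2 : ∀ i ≤ P.rows + 1, ∀ j ≤ P.cols + 1, G (i, j) - F (i, j) = G (1, 0) - F (1, 0) := by
    intro i
    induction i with
    | zero =>
      intro _ j hj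
      rw [← step 0 (Nat.zero_le _) j hj, zero_add, h1 j hj]
    | succ i ih =>
      intro hi j hj
      rw [step i (by omega) j hj, ih (by omega) j hj]
  intro v hv w hw
  have hv' := h2 v.1 hv.1 v.2 hv.2
  have hw' := h2 w.1 hw.1 w.2 hw.2
  rw [Prod.mk.eta] at hv' hw'
  rw [dist_eq_norm, dist_eq_norm]
  congr 1
  rw [← hw', ← sub_eq_zero] at hv'
  rw [← sub_eq_zero, ← hv']; abel

lemma IsFolded.comp (hG : P.IsFolded G) (L : E3 ≃ₗᵢ[ℝ] E3) : P.IsFolded (fun v => L (G v)) := by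
  intro i hi j hj v hv w hw
  rw [L.dist_map]; exact hG i hi j hj v hv w hw

lemma IsDirection.comp (hG : P.IsDirection G C) (L : E3 ≃ₗᵢ[ℝ] E3) :
    P.IsDirection (fun v => L (G v)) (fun i => L (C i)) where
  norm_eq i hi := by rw [L.norm_map, hG.norm_eq i hi]
  sub_eq i hi j hj := by rw [← L.map_sub, hG.sub_eq i hi j hj, L.map_smul]

end OrthodiagonalPaper

namespace PaperData

variable (p : PaperData) {D₀ : ℂ} (V₀ : ℂ)

lemma shift_ne_zero (hD : ‖D₀‖ = 1) (κ : ℝ) (i : ℕ) : p.shift D₀ κ i ≠ 0 := by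
  intro h
  have := p.norm_shift_sq hD κ i
  rw [h, norm_zero] at this
  have := p.z_pos i
  nlinarith [sq_nonneg κ]

/-- The creases of a row in the first two panel columns are independent, except at the time `1`. -/
lemma linearIndependent_row (hD : ‖D₀‖ = 1) {κ : ℝ} (hκ : κ ∈ Set.Ioo (0 : ℝ) 1) (i : ℕ) :
    LinearIndependent ℝ ![p.motion D₀ V₀ κ (i, 0 + 1) - p.motion D₀ V₀ κ (i, 0),
      p.motion D₀ V₀ κ (i, 1 + 1) - p.motion D₀ V₀ κ (i, 1)] := by
  rw [LinearIndependent.pair_iff]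
  intro s t h
  rw [motion_sub_row, motion_sub_row, smul_spacePoint, smul_spacePoint, spacePoint_add] at h
  have h0 : spacePoint 0 0 = 0 := by ext k; fin_cases k <;> simp [spacePoint]
  rw [← h0, spacePoint_inj] at h
  obtain ⟨h1, h2⟩ := h
  have hr0 := p.rise_pos ⟨hκ.1.le, hκ.2.le⟩ (j := 0) (Or.inl hκ.2)
  have hr1 := p.rise_pos ⟨hκ.1.le, hκ.2.le⟩ (j := 1) (Or.inl hκ.2)
  have h3 : ((s * (p.σ * p.w 0 * p.d 0) - t * (p.σ * p.w 1 * p.d 1) : ℝ) : ℂ) = 0 := by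
    apply mul_right_cancel₀ (p.shift_ne_zero hD κ i)
    rw [zero_mul, ← h1, colSign_succ 0, colSign_zero]
    push_cast
    ring
  have h4 : p.σ * (s * (p.w 0 * p.d 0) - t * (p.w 1 * p.d 1)) = 0 := by
    have : s * (p.σ * p.w 0 * p.d 0) - t * (p.σ * p.w 1 * p.d 1) = 0 := by exact_mod_cast h3
    linarith
  have h5 := (mul_eq_zero.1 h4).resolve_left p.σ_ne
  have a0 := mul_pos (p.w_pos 0) (p.d_pos 0)
  have a1 := mul_pos (p.w_pos 1) (p.d_pos 1)
  have h6 : t * (p.w 1 * p.d 1 * p.rise κ 0 + p.w 0 * p.d 0 * p.rise κ 1) = 0 := by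
    linear_combination (p.w 0 * p.d 0) * h2 - p.rise κ 0 * h5
  have ht : t = 0 := (mul_eq_zero.1 h6).resolve_right (by positivity)
  rw [ht, zero_mul, sub_zero] at h5
  exact ⟨(mul_eq_zero.1 h5).resolve_right a0.ne', ht⟩

lemma turn_ne_zero {κ : ℝ} (hκ : 0 < κ) (i : ℕ) : p.turn κ i ≠ 0 :=
  div_ne_zero (mul_ne_zero (pow_ne_zero _ (by norm_num)) hκ.ne') (p.z_pos i).ne'

lemma tanRot_im_ne_zero {x : ℝ} (hx : x ≠ 0) : (tanRot x).im ≠ 0 := by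
  rw [tanRot_im]
  exact div_ne_zero (mul_ne_zero two_ne_zero hx) (one_add_sq_ne x)

lemma dir_succ_ne (hD : ‖D₀‖ = 1) {κ : ℝ} (hκ : 0 < κ) (i : ℕ) :
    p.dir D₀ κ (i + 1) ≠ p.dir D₀ κ i := by
  intro h
  rw [dir_succ] at h
  have h1 : tanRot (p.turn κ (i + 1)) = 1 := by
    apply mul_left_cancel₀ (p.dir_ne_zero hD κ i); rw [h, mul_one]
  exact tanRot_im_ne_zero (p.turn_ne_zero hκ (i + 1)) (by rw [h1, Complex.one_im])

/-- A folded state coincides with a state of the motion if the first two column directions are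
those of the latter, the first row rises over their plane, and the first column is nowhere straight.
The following directions are then determined one after the other: given a direction and the creases
of the row below it, the next direction is the mirror image of the former in the plane of these
creases, the former itself being excluded. -/
lemma sameShape_motion (hD : ‖D₀‖ = 1) {κ : ℝ} (hκ : κ ∈ Set.Ioo (0 : ℝ) 1) {G : ℕ × ℕ → E3}
    {C : ℕ → E3} (hG : p.paper.IsFolded G) (hC : p.paper.IsDirection G C)
    (h0 : C 0 = spacePoint (p.dir D₀ κ 0) 0) (h1 : C 1 = spacePoint (p.dir D₀ κ 1) 0)
    (hrise : ∀ j ≤ p.cols, 0 < inner ℝ (spacePoint 0 1) (G (1, j + 1) - G (1, j)))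
    (hne : ∀ i < p.rows, C (i + 1) ≠ C i) : p.paper.SameShape G (p.motion D₀ V₀ κ) := by
  have hκ' : κ ∈ Set.Icc (0 : ℝ) 1 := ⟨hκ.1.le, hκ.2.le⟩
  set F := p.motion D₀ V₀ κ with hF_def
  have hF := p.isFolded_motion V₀ hD hκ'
  have hFD := p.isDirection_motion V₀ hD κ
  rw [← hF_def] at hF hFD
  have hr := p.one_le_rows
  have hind : LinearIndependent ℝ ![spacePoint (p.dir D₀ κ 0) 0, spacePoint (p.dir D₀ κ 1) 0] := by
    rw [LinearIndependent.pair_iff]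
    intro s t h
    have hz : spacePoint 0 0 = 0 := by ext k; fin_cases k <;> simp [spacePoint]
    rw [smul_spacePoint, smul_spacePoint, spacePoint_add, ← hz, spacePoint_inj] at h
    have h2 : (s : ℂ) + t * tanRot (p.turn κ 1) = 0 := by
      apply mul_left_cancel₀ (p.dir_ne_zero hD κ 0)
      rw [mul_zero, ← h.1, dir_succ]; ring
    have h3 := congrArg Complex.im h2
    have h4 := congrArg Complex.re h2
    rw [Complex.add_im, Complex.ofReal_im, Complex.im_ofReal_mul, zero_add, Complex.zero_im,
      mul_eq_zero] at h3
    have ht := h3.resolve_right (tanRot_im_ne_zero (p.turn_ne_zero hκ.1 1))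
    rw [ht] at h4
    simp at h4
    exact ⟨h4, ht⟩
  have hrow1 : ∀ j ≤ p.cols, G (1, j + 1) - G (1, j) = F (1, j + 1) - F (1, j) := by
    intro j hj
    refine eq_of_inner_eq_of_norm_eq (n := spacePoint 0 1) hind (by simp [inner_spacePoint])
      (by simp [inner_spacePoint]) ?_ ?_ ?_ (hrise j hj) ?_
    · have e1 := hG.inner_row_upper hC (i := 0) (Nat.zero_le _) hj
      have e2 := hF.inner_row_upper hFD (i := 0) (Nat.zero_le _) hj
      rw [h0, real_inner_comm] at e1
      rw [real_inner_comm] at e2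
      exact e1.trans e2.symm
    · have e1 := hG.inner_row_lower hC (i := 1) hr hj
      have e2 := hF.inner_row_lower hFD (i := 1) hr hj
      rw [h1, real_inner_comm] at e1
      rw [real_inner_comm] at e2
      exact e1.trans e2.symm
    · rw [← pow_left_inj₀ (norm_nonneg _) (norm_nonneg _) two_ne_zero, hG.norm_row_sq hr hj,
        hF.norm_row_sq hr hj]
    · rw [hF_def, motion_sub_row, inner_spacePoint]
      simpa using p.rise_pos hκ' (Or.inl hκ.2)
  have main : ∀ i, i + 1 ≤ p.rows → C i = spacePoint (p.dir D₀ κ i) 0 ∧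
      C (i + 1) = spacePoint (p.dir D₀ κ (i + 1)) 0 ∧
      ∀ j ≤ p.cols, G (i + 1, j + 1) - G (i + 1, j) = F (i + 1, j + 1) - F (i + 1, j) := by
    intro i
    induction i with
    | zero => exact fun _ => ⟨h0, h1, hrow1⟩
    | succ i ih =>
      intro hi
      obtain ⟨-, ih1, ih2⟩ := ih (by omega)
      have hrow : ∀ j ≤ p.cols,
          G (i + 1 + 1, j + 1) - G (i + 1 + 1, j) = F (i + 1 + 1, j + 1) - F (i + 1 + 1, j) := by
        intro j hj
        rw [hC.row_succ (i := i + 1) (show i + 1 ≤ p.rows by omega) hj,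
          hFD.row_succ (i := i + 1) (show i + 1 ≤ p.rows by omega) hj, ih1, ih2 j hj]
      refine ⟨ih1, ?_, hrow⟩
      have hlow : ∀ j ≤ p.cols,
          inner ℝ (F (i + 1 + 1, j + 1) - F (i + 1 + 1, j)) (C (i + 1 + 1)) =
          inner ℝ (F (i + 1 + 1, j + 1) - F (i + 1 + 1, j))
            (spacePoint (p.dir D₀ κ (i + 1)) 0) := by
        intro j hj
        rw [hF.inner_row_upper hFD (i := i + 1) (show i + 1 ≤ p.rows by omega) hj, ← hrow j hj,
          hG.inner_row_lower hC (i := i + 1 + 1) hi hj]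
      have hlow' : ∀ j ≤ p.cols,
          inner ℝ (F (i + 1 + 1, j + 1) - F (i + 1 + 1, j))
            (spacePoint (p.dir D₀ κ (i + 1 + 1)) 0) =
          inner ℝ (F (i + 1 + 1, j + 1) - F (i + 1 + 1, j))
            (spacePoint (p.dir D₀ κ (i + 1)) 0) := by
        intro j hj
        rw [hF.inner_row_upper hFD (i := i + 1) (show i + 1 ≤ p.rows by omega) hj,
          hF.inner_row_lower hFD (i := i + 1 + 1) hi hj]
      have hu : ∀ k, ‖spacePoint (p.dir D₀ κ k) 0‖ = 1 := fun k => by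
        rw [norm_spacePoint_zero, norm_dir p hD]
      refine eq_of_inner_eq_of_ne (o := spacePoint (p.dir D₀ κ (i + 1)) 0)
        (p.linearIndependent_row V₀ hD hκ (i + 1 + 1)) (hlow 0 (Nat.zero_le _))
        (hlow 1 p.one_le_cols) (hlow' 0 (Nat.zero_le _)) (hlow' 1 p.one_le_cols) ?_ ?_ ?_ ?_
      · rw [hu, hC.norm_eq _ hi]
      · rw [hu, hu]
      · rw [← ih1]; exact hne (i + 1) hi
      · intro h; exact p.dir_succ_ne hD hκ.1 (i + 1) (spacePoint_inj.1 h).1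
  refine OrthodiagonalPaper.sameShape_of_eq hFD hC ?_ hrow1
  intro i hi
  rcases Nat.eq_zero_or_pos i with rfl | hpos
  · exact h0
  · obtain ⟨k, rfl⟩ := Nat.exists_eq_add_of_le' hpos
    exact (main k hi).2.1

end PaperData

/-- Orthonormal frames of space are carried into each other by linear isometries. -/
lemma exists_isometry_of_orthonormal {e f n e' f' n' : E3}
    (he : ‖e‖ = 1) (hf : ‖f‖ = 1) (hn : ‖n‖ = 1)
    (hef : inner ℝ e f = 0) (hen : inner ℝ e n = 0) (hfn : inner ℝ f n = 0)
    (he' : ‖e'‖ = 1) (hf' : ‖f'‖ = 1) (hn' : ‖n'‖ = 1)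
    (hef' : inner ℝ e' f' = 0) (hen' : inner ℝ e' n' = 0) (hfn' : inner ℝ f' n' = 0) :
    ∃ L : E3 ≃ₗᵢ[ℝ] E3, L e = e' ∧ L f = f' ∧ L n = n' := by
  have key : ∀ {e f n : E3}, ‖e‖ = 1 → ‖f‖ = 1 → ‖n‖ = 1 → inner ℝ e f = 0 → inner ℝ e n = 0 →
      inner ℝ f n = 0 → ∃ b : OrthonormalBasis (Fin 3) ℝ E3, b 0 = e ∧ b 1 = f ∧ b 2 = n := by
    intro e f n he hf hn hef hen hfn
    have ho : Orthonormal ℝ ![e, f, n] := by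
      constructor
      · intro i; fin_cases i <;> simpa
      · intro i j hij
        fin_cases i <;> fin_cases j <;> simp_all [real_inner_comm]
    refine ⟨OrthonormalBasis.mk ho (by
      rw [ho.linearIndependent.span_eq_top_of_card_eq_finrank (by simp)]), ?_, ?_, ?_⟩ <;> simp
  obtain ⟨b, rfl, rfl, rfl⟩ := key he hf hn hef hen hfn
  obtain ⟨b', rfl, rfl, rfl⟩ := key he' hf' hn' hef' hen' hfn'
  exact ⟨b.equiv b' (Equiv.refl _), by simp, by simp, by simp⟩

/-- Closeness in the product topology is, for properties that depend on finitely many points only,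
uniform closeness there. -/
lemma exists_pos_of_eventually {ι X : Type*} [MetricSpace X] {F : ι → X} {s : Set ι}
    {Q : (ι → X) → Prop} (h : ∀ᶠ G in nhds F, Q G)
    (hQ : ∀ G G', (∀ v ∈ s, G v = G' v) → Q G → Q G') :
    ∃ η > 0, ∀ G, (∀ v ∈ s, dist (G v) (F v) < η) → Q G := by
  classical
  rw [Filter.Eventually, nhds_pi, Filter.mem_pi] at h
  obtain ⟨I, hI, t, ht, hsub⟩ := h
  choose r hr hrt using fun i => Metric.mem_nhds_iff.1 (ht i)
  obtain ⟨η, hη, hηr⟩ : ∃ η > 0, ∀ i ∈ I, η ≤ r i := by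
    rcases I.eq_empty_or_nonempty with rfl | hne
    · exact ⟨1, one_pos, by simp⟩
    · obtain ⟨i, hi, hmin⟩ := hI.exists_minimalFor r I hne
      refine ⟨r i, hr i, fun j hj => ?_⟩
      rcases le_total (r i) (r j) with h | h
      · exact h
      · exact hmin hj h
  refine ⟨η, hη, fun G hG => ?_⟩
  refine hQ (fun v => if v ∈ s then G v else F v) G (fun v hv => if_pos hv) ?_
  refine hsub fun i hi => hrt i (Metric.mem_ball.2 ?_)
  by_cases his : i ∈ s
  · simp only [his, if_true]; exact (hG i his).trans_le (hηr i hi)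
  · simp only [his, if_false, dist_self]; exact hr i

namespace PaperData

variable (p : PaperData) {D₀ : ℂ} (V₀ : ℂ)

/-- The direction of the column creases below row `i`, read off from the first inner column. -/
def columnDir (G : ℕ × ℕ → E3) (i : ℕ) : E3 := (p.ℓ i)⁻¹ • (G (i + 1, 1) - G (i, 1))

lemma columnDir_eq {G : ℕ × ℕ → E3} {C : ℕ → E3} (hC : p.paper.IsDirection G C) {i : ℕ}
    (hi : i ≤ p.rows) : C i = p.columnDir G i := by
  have h := hC.sub_eq i hi 1 (show 1 ≤ p.cols + 1 by omega)
  rw [paper_Y, Y_sub_Y, S_one, mul_zero, zero_mul, sub_zero] at h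
  rw [columnDir, h, smul_smul, inv_mul_cancel₀ (p.ℓ_pos hi).ne', one_smul]

lemma continuous_columnDir (i : ℕ) : Continuous fun G : ℕ × ℕ → E3 => p.columnDir G i := by
  unfold columnDir; fun_prop

lemma inner_dir_one (hD : ‖D₀‖ = 1) (κ : ℝ) :
    inner ℝ (spacePoint (p.dir D₀ κ 0) 0) (spacePoint (p.dir D₀ κ 1) 0)
      = (tanRot (p.turn κ 1)).re := by
  have h : D₀.re * D₀.re + D₀.im * D₀.im = 1 := by
    rw [← Complex.normSq_apply, Complex.normSq_eq_norm_sq, hD, one_pow]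
  rw [inner_spacePoint, dir_succ, zero_add]
  change D₀.re * (D₀ * _).re + D₀.im * (D₀ * _).im + _ = _
  rw [Complex.mul_re, Complex.mul_im]
  linear_combination (tanRot (p.turn κ 1)).re * h

/-- The scalar product of the first two column directions runs, at the times in `(0, 1)`, through
all values between the final one and `1`. -/
lemma exists_time {q : ℝ} (h1 : (1 - (1 / p.z 1) ^ 2) / (1 + (1 / p.z 1) ^ 2) < q) (h2 : q < 1) :
    ∃ κ ∈ Set.Ioo (0 : ℝ) 1, (tanRot (p.turn κ 1)).re = q := by
  have hz := p.z_pos 1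
  have hz' : 1 / p.z 1 ≠ 0 := by positivity
  rw [div_lt_iff₀ (by positivity)] at h1
  have hq : 0 < 1 + q := by
    by_contra! hq
    have : (0 : ℝ) < (1 / p.z 1) ^ 2 := by positivity
    nlinarith
  have h3 : 0 < (1 - q) / (1 + q) := div_pos (by linarith) hq
  refine ⟨p.z 1 * √((1 - q) / (1 + q)), ⟨by positivity, ?_⟩, ?_⟩
  · have h4 : √((1 - q) / (1 + q)) < 1 / p.z 1 := by
      rw [Real.sqrt_lt' (by positivity), div_lt_iff₀ hq]
      linarith
    calc p.z 1 * √((1 - q) / (1 + q)) < p.z 1 * (1 / p.z 1) := by gcongr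
      _ = 1 := by field_simp
  · have h5 : p.turn (p.z 1 * √((1 - q) / (1 + q))) 1 ^ 2 = (1 - q) / (1 + q) := by
      have : p.turn (p.z 1 * √((1 - q) / (1 + q))) 1 = -√((1 - q) / (1 + q)) := by
        rw [turn]; field_simp
      rw [this, neg_sq, Real.sq_sqrt h3.le]
    rw [tanRot_re, h5]
    field_simp
    ring

lemma inner_dir_one_mem {κ : ℝ} (hκ : κ ∈ Set.Ioo (0 : ℝ) 1) :
    (tanRot (p.turn κ 1)).re ∈ Set.Ioo ((1 - (1 / p.z 1) ^ 2) / (1 + (1 / p.z 1) ^ 2)) 1 := by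
  have hz := p.z_pos 1
  have h : p.turn κ 1 ^ 2 = κ ^ 2 * (1 / p.z 1) ^ 2 := by
    rw [turn]; field_simp
  have hp : 0 < (1 / p.z 1) ^ 2 := by positivity
  have hκ2 : 0 < κ ^ 2 := by have := hκ.1; positivity
  have hκ3 : κ ^ 2 < 1 := by nlinarith [hκ.1, hκ.2]
  rw [tanRot_re, h]
  constructor
  · rw [div_lt_div_iff₀ (by positivity) (by positivity)]
    nlinarith
  · rw [div_lt_one (by positivity)]
    nlinarith [mul_pos hκ2 hp]

/-- The creases of the first inner row lie on one side of the plane of the first two column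
directions. -/
lemma cross_motion_neg (hD : ‖D₀‖ = 1) {κ : ℝ} (hκ : κ ∈ Set.Ioo (0 : ℝ) 1) (j : ℕ) :
    inner ℝ (cross (spacePoint (p.dir D₀ κ 0) 0) (spacePoint (p.dir D₀ κ 1) 0))
      (p.motion D₀ V₀ κ (1, j + 1) - p.motion D₀ V₀ κ (1, j)) < 0 := by
  have hr := p.rise_pos ⟨hκ.1.le, hκ.2.le⟩ (j := j) (Or.inl hκ.2)
  have hz := p.z_pos 1
  have h : D₀.re * D₀.re + D₀.im * D₀.im = 1 := by
    rw [← Complex.normSq_apply, Complex.normSq_eq_norm_sq, hD, one_pow]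
  have him : (tanRot (p.turn κ 1)).im < 0 := by
    rw [tanRot_im]
    refine div_neg_of_neg_of_pos ?_ (by positivity)
    have : 0 < κ / p.z 1 := div_pos hκ.1 hz
    rw [turn, pow_one, neg_one_mul, neg_div]
    linarith
  rw [motion_sub_row, inner_cross]
  have e : (p.dir D₀ κ 0).re * (p.dir D₀ κ 1).im - (p.dir D₀ κ 0).im * (p.dir D₀ κ 1).re
      = (tanRot (p.turn κ 1)).im := by
    rw [dir_succ, zero_add]
    change D₀.re * (D₀ * _).im - D₀.im * (D₀ * _).re = _
    rw [Complex.mul_re, Complex.mul_im]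
    linear_combination (tanRot (p.turn κ 1)).im * h
  simp only [spacePoint, PiLp.toLp_apply, Matrix.cons_val_zero, Matrix.cons_val_one,
      Matrix.cons_val]
  rw [e]
  nlinarith

/-- A folded state near a state of the motion is congruent to a state of the motion. The time of
the latter is read off from the scalar product of the first two column directions; a linear isometry
matches these directions and the side on which the first row lies, and `sameShape_motion`
applies. -/
lemma eventually_sameShape (hD : ‖D₀‖ = 1) {κ : ℝ} (hκ : κ ∈ Set.Ioo (0 : ℝ) 1) :
    ∀ᶠ G in nhds (p.motion D₀ V₀ κ), p.paper.IsFolded G →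
      ∃ κ' ∈ Set.Icc (0 : ℝ) 1, p.paper.SameShape G (p.motion D₀ V₀ κ') := by
  have hr := p.one_le_rows
  have hFD : ∀ i ≤ p.rows, p.columnDir (p.motion D₀ V₀ κ) i = spacePoint (p.dir D₀ κ i) 0 :=
    fun i hi => (p.columnDir_eq (p.isDirection_motion V₀ hD κ) hi).symm
  have hq : ∀ᶠ G in nhds (p.motion D₀ V₀ κ),
      inner ℝ (p.columnDir G 0) (p.columnDir G 1) ∈
        Set.Ioo ((1 - (1 / p.z 1) ^ 2) / (1 + (1 / p.z 1) ^ 2)) 1 := by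
    refine ((p.continuous_columnDir 0).inner (p.continuous_columnDir 1)).continuousAt.eventually_mem
      (Ioo_mem_nhds ?_ ?_)
    all_goals rw [hFD 0 (Nat.zero_le _), hFD 1 hr, p.inner_dir_one hD]
    · exact (p.inner_dir_one_mem hκ).1
    · exact (p.inner_dir_one_mem hκ).2
  have hc : ∀ᶠ G in nhds (p.motion D₀ V₀ κ), ∀ j ∈ Set.Iic p.cols,
      inner ℝ (cross (p.columnDir G 0) (p.columnDir G 1)) (G (1, j + 1) - G (1, j)) < 0 := by
    refine (Filter.eventually_all_finite (Set.finite_Iic _)).2 fun j _ => ?_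
    refine (continuous_inner_cross (p.continuous_columnDir 0) (p.continuous_columnDir 1)
      ((continuous_apply (1, j + 1)).sub (continuous_apply (1, j)))).continuousAt.eventually_lt
      continuousAt_const ?_
    rw [hFD 0 (Nat.zero_le _), hFD 1 hr]
    exact p.cross_motion_neg V₀ hD hκ j
  have hne : ∀ᶠ G in nhds (p.motion D₀ V₀ κ), ∀ i ∈ Set.Iio p.rows,
      p.columnDir G (i + 1) ≠ p.columnDir G i := by
    refine (Filter.eventually_all_finite (Set.finite_Iio _)).2 fun i hi => ?_
    have hi' : i < p.rows := hi
    have h : ContinuousAt (fun G : ℕ × ℕ → E3 => p.columnDir G (i + 1) - p.columnDir G i)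
        (p.motion D₀ V₀ κ) :=
      ((p.continuous_columnDir (i + 1)).sub (p.continuous_columnDir i)).continuousAt
    refine (h.eventually_ne (y := 0) ?_).mono fun G hG => sub_ne_zero.1 hG
    rw [hFD (i + 1) hi', hFD i hi'.le, sub_ne_zero]
    intro h
    exact p.dir_succ_ne hD hκ.1 i (spacePoint_inj.1 h).1
  filter_upwards [hq, hc, hne] with G hq hc hne hG
  obtain ⟨C, hC⟩ := hG.exists_isDirection
  have c0 := p.columnDir_eq hC (Nat.zero_le _)
  have c1 := p.columnDir_eq hC hr
  rw [← c0, ← c1] at hq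
  obtain ⟨κ', hκ', hre⟩ := p.exists_time hq.1 hq.2
  have hn0 := hC.norm_eq 0 (Nat.zero_le _)
  have hn1 := hC.norm_eq 1 hr
  set u := (tanRot (p.turn κ' 1)).re with hu
  set v := (tanRot (p.turn κ' 1)).im with hv
  have hv0 : v ≠ 0 := tanRot_im_ne_zero (p.turn_ne_zero hκ'.1 1)
  have huv : u ^ 2 + v ^ 2 = 1 := by
    have := norm_tanRot (p.turn κ' 1)
    rw [← pow_left_inj₀ (norm_nonneg _) zero_le_one two_ne_zero, ← Complex.normSq_eq_norm_sq,
      Complex.normSq_apply] at this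
    linear_combination this
  set f := v⁻¹ • (C 1 - u • C 0) with hf
  have hC1 : C 1 = u • C 0 + v • f := by
    rw [hf, smul_smul, mul_inv_cancel₀ hv0, one_smul]; abel
  have hef : inner ℝ (C 0) f = 0 := by
    rw [hf, inner_smul_right, inner_sub_right, inner_smul_right, real_inner_self_eq_norm_sq, hn0,
      ← hre]; ring
  have hf1 : ‖f‖ = 1 := by
    have h := norm_add_sq_real (u • C 0) (v • f)
    rw [← hC1, hn1, inner_smul_left, inner_smul_right, hef, norm_smul, norm_smul, hn0,
      Real.norm_eq_abs, Real.norm_eq_abs, mul_one, sq_abs, mul_pow, sq_abs] at h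
    rw [← pow_left_inj₀ (norm_nonneg _) zero_le_one two_ne_zero]
    have : 0 < v ^ 2 := by positivity
    apply mul_left_cancel₀ this.ne'
    linear_combination -huv - h
  set k := cross (C 0) (C 1) with hk
  have hc' : ∀ j ≤ p.cols, inner ℝ k (G (1, j + 1) - G (1, j)) < 0 := by
    intro j hj
    have := hc j hj
    rwa [← c0, ← c1] at this
  have hk0 : k ≠ 0 := by
    intro h
    have := hc' 0 (Nat.zero_le _)
    rw [h, inner_zero_left] at this
    exact lt_irrefl _ this
  have hkn : 0 < ‖k‖ := norm_pos_iff.2 hk0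
  set n := (-‖k‖⁻¹) • k with hn
  have hnn : ‖n‖ = 1 := by
    rw [hn, norm_smul, norm_neg, norm_inv, norm_norm, inv_mul_cancel₀ hkn.ne']
  have hkC0 : inner ℝ (C 0) k = 0 := by rw [real_inner_comm]; exact inner_cross_left _ _
  have hkC1 : inner ℝ (C 1) k = 0 := by rw [real_inner_comm]; exact inner_cross_right _ _
  have hen : inner ℝ (C 0) n = 0 := by rw [hn, inner_smul_right, hkC0, mul_zero]
  have hfn : inner ℝ f n = 0 := by
    rw [hn, inner_smul_right, hf, inner_smul_left, inner_sub_left, inner_smul_left, hkC0, hkC1]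
    simp
  have hDI : ‖D₀ * Complex.I‖ = 1 := by rw [norm_mul, hD, Complex.norm_I, one_mul]
  obtain ⟨L, L0, L1, L2⟩ := exists_isometry_of_orthonormal hn0 hf1 hnn hef hen hfn
    (e' := spacePoint D₀ 0) (f' := spacePoint (D₀ * Complex.I) 0) (n' := spacePoint 0 1)
    (by rw [norm_spacePoint_zero, hD]) (by rw [norm_spacePoint_zero, hDI])
    (by rw [← pow_left_inj₀ (norm_nonneg _) zero_le_one two_ne_zero, norm_spacePoint_sq]; simp)
    (by rw [inner_spacePoint]; simp; ring) (by rw [inner_spacePoint]; simp)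
    (by rw [inner_spacePoint]; simp)
  refine ⟨κ', ⟨hκ'.1.le, hκ'.2.le⟩, ?_⟩
  have hsame := p.sameShape_motion V₀ hD hκ' (hG.comp L) (hC.comp L) ?_ ?_ ?_ ?_
  · intro x hx y hy
    rw [← hsame x hx y hy, L.dist_map]
  · rw [L0]; rfl
  · rw [hC1, L.map_add, L.map_smul, L.map_smul, L0, L1, smul_spacePoint, smul_spacePoint,
      spacePoint_add, spacePoint_inj]
    refine ⟨?_, by ring⟩
    rw [dir_succ, zero_add]
    change _ = D₀ * tanRot (p.turn κ' 1)
    rw [← Complex.re_add_im (tanRot (p.turn κ' 1)), ← hu, ← hv]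
    ring
  · intro j hj
    rw [← L.map_sub, ← L2, L.inner_map_map, hn, inner_smul_left]
    have := hc' j hj
    have h2 : 0 < ‖k‖⁻¹ := inv_pos.2 hkn
    simp only [RCLike.conj_to_real]
    nlinarith
  · intro i hi h
    have h2 := L.injective h
    rw [p.columnDir_eq hC (i := i + 1) hi, p.columnDir_eq hC (i := i) hi.le] at h2
    exact hne i hi h2

/-- The motion is a rigid folding motion with one degree of freedom, which halts at time `1`. -/
theorem isHaltingMotion (hD : ‖D₀‖ = 1) : p.paper.IsHaltingMotion (p.motion D₀ V₀) where
  continuous v _ := (p.continuous_motion V₀ v).continuousOn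
  folded _ hs := p.isFolded_motion V₀ hD hs
  planar v _ w _ := p.planar_motion V₀ hD v w
  injective _ hs _ hs' h := p.motion_injective V₀ hD hs.1 hs'.1 h
  one_dof s hs := by
    have hloc : ∀ G G' : ℕ × ℕ → E3, (∀ v ∈ p.paper.grid, G v = G' v) →
        (p.paper.IsFolded G → ∃ κ' ∈ Set.Icc (0 : ℝ) 1,
          p.paper.SameShape G (p.motion D₀ V₀ κ')) →
        p.paper.IsFolded G' → ∃ κ' ∈ Set.Icc (0 : ℝ) 1,
          p.paper.SameShape G' (p.motion D₀ V₀ κ') := by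
      intro G G' heq hG hG'
      have hcor : ∀ i ≤ p.rows, ∀ j ≤ p.cols, ∀ v ∈ OrthodiagonalPaper.corners i j,
          v ∈ p.paper.grid := by
        intro i hi j hj v hv
        simp only [OrthodiagonalPaper.corners, Set.mem_insert_iff, Set.mem_singleton_iff] at hv
        rcases hv with rfl | rfl | rfl | rfl <;> exact p.mem_grid (by omega) (by omega)
      obtain ⟨κ', hκ', hs'⟩ := hG (fun i hi j hj v hv w hw => by
        rw [heq v (hcor i hi j hj v hv), heq w (hcor i hi j hj w hw)]
        exact hG' i hi j hj v hv w hw)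
      refine ⟨κ', hκ', fun v hv w hw => ?_⟩
      rw [← heq v hv, ← heq w hw]
      exact hs' v hv w hw
    obtain ⟨η, hη, h⟩ := exists_pos_of_eventually (p.eventually_sameShape V₀ hD hs) hloc
    exact ⟨η, hη, fun G hG hd => h G hd hG⟩
  unclashed s hs :=
    ⟨fun i hi j hj => p.not_rowClash V₀ hD ⟨hs.1, hs.2.le⟩ hi hj (Or.inl hs.2),
      fun i _ j hj => p.not_colClash V₀ ⟨hs.1, hs.2.le⟩ hj⟩
  final := ⟨p.isFolded_motion V₀ hD ⟨zero_le_one, le_rfl⟩,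
    fun i hi => p.rowClash_motion_one V₀ hD hi,
    fun i hi j hj => p.not_rowClash V₀ hD ⟨zero_le_one, le_rfl⟩ hi hj.2 (Or.inr hj.1),
    fun i _ j hj => p.not_colClash V₀ ⟨zero_le_one, le_rfl⟩ hj⟩

end PaperData

/-! ### Zigzag approximation of the profile curves -/

/-- The profile curves of the pieces, in coordinates `A k` and `B k` along the two crease
directions, in which they are monotone. The crease directions of piece `k` are `(d k, e k)` and
`(d k, - e k)`. -/
structure ProfileData where
  num : ℕ
  lo : ℕ → ℝ
  hi : ℕ → ℝ
  A : ℕ → ℝ → ℝ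
  B : ℕ → ℝ → ℝ
  d : ℕ → ℝ
  e : ℕ → ℝ
  num_pos : 0 < num
  le : ∀ k < num, lo k ≤ hi k
  contA : ∀ k < num, ContinuousOn (A k) (Set.Icc (lo k) (hi k))
  contB : ∀ k < num, ContinuousOn (B k) (Set.Icc (lo k) (hi k))
  monoA : ∀ k < num, MonotoneOn (A k) (Set.Icc (lo k) (hi k))
  antiB : ∀ k < num, AntitoneOn (B k) (Set.Icc (lo k) (hi k))
  d_mem : ∀ k < num, d k ∈ Set.Icc (0 : ℝ) 1
  e_mem : ∀ k < num, e k ∈ Set.Icc (0 : ℝ) 1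
  start_x : d 0 * (A 0 (lo 0) + B 0 (lo 0)) = 0
  start_y : e 0 * (A 0 (lo 0) - B 0 (lo 0)) = 0
  stitch_x : ∀ k, k + 1 < num → d (k + 1) * (A (k + 1) (lo (k + 1)) + B (k + 1) (lo (k + 1)))
    = d k * (A k (hi k) + B k (hi k))
  stitch_y : ∀ k, k + 1 < num → e (k + 1) * (A (k + 1) (lo (k + 1)) - B (k + 1) (lo (k + 1)))
    = e k * (A k (hi k) - B k (hi k))

namespace ProfileData

variable (c : ProfileData)

/-- The coordinate of the profile along the tangent of the datum curve. -/
def x (k : ℕ) (t : ℝ) : ℝ := c.d k * (c.A k t + c.B k t)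

/-- The height of the profile. -/
def y (k : ℕ) (t : ℝ) : ℝ := c.e k * (c.A k t - c.B k t)

/-- The `r`-th of the points that divide the parameter interval of piece `k` into `M` parts. -/
def sample (M k r : ℕ) : ℝ := c.lo k + (c.hi k - c.lo k) * (r / M)

/-- The widths of a zigzag: each part of each piece is replaced by a step along the first crease
direction and a step along the second one; the small summand `η` makes the widths positive. -/
def stepWidth (M : ℕ) (η : ℝ) (j : ℕ) : ℝ :=
  let k := (j - 1) / 2 / M
  let r := (j - 1) / 2 % M
  if 1 ≤ j ∧ j ≤ 2 * (M * c.num) then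
    (if Odd j then c.A k (c.sample M k (r + 1)) - c.A k (c.sample M k r)
      else c.B k (c.sample M k r) - c.B k (c.sample M k (r + 1))) + η
  else η

variable {c} {M : ℕ}

lemma sample_mem (hM : 0 < M) {k r : ℕ} (hk : k < c.num) (hr : r ≤ M) :
    c.sample M k r ∈ Set.Icc (c.lo k) (c.hi k) := by
  have h1 : (r : ℝ) / M ≤ 1 := by
    rw [div_le_one (by exact_mod_cast hM)]; exact_mod_cast hr
  have h2 : (0 : ℝ) ≤ r / M := by positivity
  have h3 := sub_nonneg.2 (c.le k hk)
  unfold sample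
  constructor <;> nlinarith

lemma sample_mono (hM : 0 < M) {k r : ℕ} (hk : k < c.num) :
    c.sample M k r ≤ c.sample M k (r + 1) := by
  have h3 := sub_nonneg.2 (c.le k hk)
  unfold sample
  gcongr
  norm_num

lemma sample_zero (k : ℕ) : c.sample M k 0 = c.lo k := by simp [sample]

lemma sample_last (hM : 0 < M) (k : ℕ) : c.sample M k M = c.hi k := by
  rw [sample, div_self (by exact_mod_cast hM.ne')]; ring

lemma stepWidth_pos (hM : 0 < M) {η : ℝ} (hη : 0 < η) (j : ℕ) : 0 < c.stepWidth M η j := by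
  simp only [stepWidth]
  split_ifs with h1 h2
  all_goals try exact hη
  all_goals
    have hk : (j - 1) / 2 / M < c.num := by
      rw [Nat.div_lt_iff_lt_mul hM, Nat.div_lt_iff_lt_mul two_pos, mul_comm c.num]; omega
    have hr : (j - 1) / 2 % M + 1 ≤ M := Nat.mod_lt _ hM
    have m0 := sample_mem (c := c) hM hk (r := (j - 1) / 2 % M) (by omega)
    have m1 := sample_mem (c := c) hM hk hr
    have hm := sample_mono (c := c) hM hk (r := (j - 1) / 2 % M)
  · have := c.monoA _ hk m0 m1 hm; linarith
  · have := c.antiB _ hk m0 m1 hm; linarith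

lemma div_mod_aux {k r : ℕ} (hr : r < M) : (k * M + r) / M = k ∧ (k * M + r) % M = r := by
  constructor
  · rw [mul_comm, Nat.mul_add_div (by omega), Nat.div_eq_of_lt hr, add_zero]
  · rw [mul_comm, Nat.mul_add_mod, Nat.mod_eq_of_lt hr]

lemma stepWidth_odd {k r : ℕ} (hk : k < c.num) (hr : r < M) (η : ℝ) :
    c.stepWidth M η (2 * (k * M + r) + 1) =
      c.A k (c.sample M k (r + 1)) - c.A k (c.sample M k r) + η := by
  have h1 : (k * M + r) < M * c.num := by
    calc k * M + r < k * M + M := by omega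
      _ = (k + 1) * M := by ring
      _ ≤ c.num * M := Nat.mul_le_mul_right _ hk
      _ = M * c.num := mul_comm _ _
  have h2 : (2 * (k * M + r) + 1 - 1) / 2 = k * M + r := by omega
  obtain ⟨a1, a2⟩ := div_mod_aux (k := k) hr
  have ho : Odd (2 * (k * M + r) + 1) := ⟨_, rfl⟩
  simp only [stepWidth, h2, a1, a2]
  rw [if_pos ⟨by omega, by omega⟩, if_pos ho]

lemma stepWidth_even {k r : ℕ} (hk : k < c.num) (hr : r < M) (η : ℝ) :
    c.stepWidth M η (2 * (k * M + r) + 2) =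
      c.B k (c.sample M k r) - c.B k (c.sample M k (r + 1)) + η := by
  have h1 : (k * M + r) < M * c.num := by
    calc k * M + r < k * M + M := by omega
      _ = (k + 1) * M := by ring
      _ ≤ c.num * M := Nat.mul_le_mul_right _ hk
      _ = M * c.num := mul_comm _ _
  have h2 : (2 * (k * M + r) + 2 - 1) / 2 = k * M + r := by omega
  obtain ⟨a1, a2⟩ := div_mod_aux (k := k) hr
  have ho : ¬ Odd (2 * (k * M + r) + 2) := by
    rw [Nat.not_odd_iff_even]; exact ⟨k * M + r + 1, by ring⟩
  simp only [stepWidth, h2, a1, a2]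
  rw [if_pos ⟨by omega, by omega⟩, if_neg ho]

lemma colSign_odd (q : ℕ) : colSign (2 * q + 1) = 1 := if_pos ⟨_, rfl⟩

lemma colSign_even (q : ℕ) : colSign (2 * q + 2) = -1 := by
  rw [colSign_succ (2 * q + 1), colSign_odd]

lemma piece_odd {k r : ℕ} (hr : r < M) : (2 * (k * M + r) + 1 - 1) / 2 / M = k := by
  have h2 : (2 * (k * M + r) + 1 - 1) / 2 = k * M + r := by omega
  rw [h2, (div_mod_aux hr).1]

lemma piece_even {k r : ℕ} (hr : r < M) : (2 * (k * M + r) + 2 - 1) / 2 / M = k := by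
  have h2 : (2 * (k * M + r) + 2 - 1) / 2 = k * M + r := by omega
  rw [h2, (div_mod_aux hr).1]

lemma step_le {k r m : ℕ} (hk : k < c.num) (hr : r < M) (hm : m = 2 * (M * c.num)) :
    2 * (k * M + r) + 2 ≤ m := by
  have : k * M + r + 1 ≤ M * c.num := by
    calc k * M + r + 1 ≤ k * M + M := by omega
      _ = (k + 1) * M := by ring
      _ ≤ c.num * M := Nat.mul_le_mul_right _ hk
      _ = M * c.num := mul_comm _ _
  omega

/-- The zigzag meets the profile at every second vertex, up to an error in height caused by the
summand `η` of the widths. -/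
lemma zigzag_node (hM : 0 < M) {η : ℝ} (hη : 0 < η) {S Z : ℕ → ℝ} (hS1 : S 1 = 0) (hZ1 : Z 1 = 0)
    (hS : ∀ j, 1 ≤ j → j ≤ 2 * (M * c.num) →
      S (j + 1) = S j + colSign j * c.stepWidth M η j * c.d ((j - 1) / 2 / M))
    (hZ : ∀ j, 1 ≤ j → j ≤ 2 * (M * c.num) →
      Z (j + 1) = Z j + c.stepWidth M η j * c.e ((j - 1) / 2 / M)) (q : ℕ) :
    ∀ k r, q = k * M + r → r ≤ M → k < c.num → S (2 * q + 1) = c.x k (c.sample M k r) ∧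
      0 ≤ Z (2 * q + 1) - c.y k (c.sample M k r) ∧
      Z (2 * q + 1) - c.y k (c.sample M k r) ≤ 2 * η * q := by
  induction q with
  | zero =>
    intro k r h _ _
    have hr : r = 0 := by omega
    have hk : k = 0 := by
      rcases Nat.mul_eq_zero.1 (show k * M = 0 by omega) with h | h <;> omega
    subst hr hk
    rw [sample_zero, x, y, c.start_x, c.start_y]
    simp [hS1, hZ1]
  | succ q ih =>
    have step : ∀ k r, q = k * M + r → r < M → k < c.num →
        S (2 * (q + 1) + 1) = c.x k (c.sample M k (r + 1)) ∧
        0 ≤ Z (2 * (q + 1) + 1) - c.y k (c.sample M k (r + 1)) ∧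
        Z (2 * (q + 1) + 1) - c.y k (c.sample M k (r + 1)) ≤ 2 * η * (q + 1 : ℕ) := by
      intro k r hq hr hk
      obtain ⟨i1, i2, i3⟩ := ih k r hq hr.le hk
      have hle := step_le hk hr rfl
      have s1 := hS (2 * (k * M + r) + 1) (by omega) (by omega)
      have s2 := hS (2 * (k * M + r) + 2) (by omega) (by omega)
      have z1 := hZ (2 * (k * M + r) + 1) (by omega) (by omega)
      have z2 := hZ (2 * (k * M + r) + 2) (by omega) (by omega)
      rw [stepWidth_odd hk hr, piece_odd hr] at s1 z1
      rw [stepWidth_even hk hr, piece_even hr] at s2 z2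
      rw [colSign_odd] at s1
      rw [colSign_even, show 2 * (k * M + r) + 2 = 2 * (k * M + r) + 1 + 1 by ring, s1] at s2
      rw [show 2 * (k * M + r) + 2 = 2 * (k * M + r) + 1 + 1 by ring, z1] at z2
      rw [← hq] at s2 z2
      have e0 := (c.e_mem k hk).1
      have e1 := (c.e_mem k hk).2
      rw [show 2 * (q + 1) + 1 = 2 * q + 1 + 1 + 1 by ring, s2, z2, i1]
      unfold x
      unfold y at i2 i3 ⊢
      refine ⟨by ring, ?_, ?_⟩
      · nlinarith
      · push_cast; nlinarith
    intro k r hq hr hk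
    rcases Nat.eq_zero_or_pos r with rfl | hr0
    · have hk0 : k ≠ 0 := by rintro rfl; simp at hq
      obtain ⟨k', rfl⟩ := Nat.exists_eq_succ_of_ne_zero hk0
      have h := step k' (M - 1) (by
        have : (k' + 1) * M = k' * M + M := by ring
        rw [Nat.succ_eq_add_one, this] at hq
        omega) (by omega) (by omega)
      rw [Nat.sub_add_cancel hM, sample_last hM] at h
      rw [sample_zero, x, y, Nat.succ_eq_add_one, c.stitch_x k' hk, c.stitch_y k' hk]
      exact h
    · have h := step k (r - 1) (by omega) (by omega) hk
      rwa [Nat.sub_add_cancel hr0] at h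

/-- Every parameter is close to one of the sample points. -/
lemma exists_sample (hM : 0 < M) {k : ℕ} {t : ℝ} (hk : k < c.num)
    (ht : t ∈ Set.Icc (c.lo k) (c.hi k)) :
    ∃ r ≤ M, |t - c.sample M k r| ≤ (c.hi k - c.lo k) / M := by
  have hM' : (0 : ℝ) < M := by exact_mod_cast hM
  rcases (c.le k hk).eq_or_lt with h | h
  · refine ⟨0, Nat.zero_le _, ?_⟩
    rw [sample_zero, le_antisymm (ht.2.trans h.ge) ht.1, h]; simp
  · have hlen : 0 < c.hi k - c.lo k := sub_pos.2 h
    set s := (t - c.lo k) / (c.hi k - c.lo k) * M with hs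
    have hs0 : 0 ≤ s := mul_nonneg (div_nonneg (by linarith [ht.1]) hlen.le) hM'.le
    have hsM : s ≤ M := by
      have : (t - c.lo k) / (c.hi k - c.lo k) ≤ 1 := by
        rw [div_le_one hlen]; linarith [ht.2]
      nlinarith
    have f1 := Nat.floor_le hs0
    have f2 := (Nat.lt_floor_add_one s).le
    refine ⟨⌊s⌋₊, Nat.floor_le_of_le hsM, ?_⟩
    have e : t - c.sample M k ⌊s⌋₊ = (c.hi k - c.lo k) / M * (s - ⌊s⌋₊) := by
      rw [sample, hs]; field_simp; ring
    rw [e, abs_mul, abs_of_pos (div_pos hlen hM')]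
    have : |s - ⌊s⌋₊| ≤ 1 := by rw [abs_of_nonneg (by linarith)]; linarith
    have hp := div_pos hlen hM'
    nlinarith

/-- The profile of finitely many pieces is approximated by a zigzag with finitely many steps along
the crease directions. -/
theorem exists_zigzag (c : ProfileData) {ε : ℝ} (hε : 0 < ε) :
    ∃ (m : ℕ) (w : ℕ → ℝ) (piece : ℕ → ℕ), 1 ≤ m ∧ (∀ j, 0 < w j) ∧ Monotone piece ∧
      (∀ j ∈ Set.Icc 1 m, piece j < c.num ∧ w j ≤ ε) ∧
      ∀ S Z : ℕ → ℝ, S 1 = 0 → Z 1 = 0 →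
        (∀ j, 1 ≤ j → j ≤ m → S (j + 1) = S j + colSign j * w j * c.d (piece j)) →
        (∀ j, 1 ≤ j → j ≤ m → Z (j + 1) = Z j + w j * c.e (piece j)) →
        (∀ j ∈ Set.Icc 1 (m + 1), ∃ k < c.num, ∃ t ∈ Set.Icc (c.lo k) (c.hi k),
          |S j - c.x k t| ≤ ε ∧ |Z j - c.y k t| ≤ ε) ∧
        (∀ k < c.num, ∀ t ∈ Set.Icc (c.lo k) (c.hi k), ∃ j ∈ Set.Icc 1 (m + 1),
          |S j - c.x k t| ≤ ε ∧ |Z j - c.y k t| ≤ ε) := by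
  obtain ⟨M, hM, hosc⟩ : ∃ M : ℕ, 0 < M ∧ ∀ k < c.num, ∀ s ∈ Set.Icc (c.lo k) (c.hi k),
      ∀ t ∈ Set.Icc (c.lo k) (c.hi k), |s - t| ≤ (c.hi k - c.lo k) / M →
        |c.A k s - c.A k t| ≤ ε / 4 ∧ |c.B k s - c.B k t| ≤ ε / 4 := by
    have h : ∀ k ∈ Set.Iio c.num, ∀ᶠ M : ℕ in Filter.atTop, ∀ s ∈ Set.Icc (c.lo k) (c.hi k),
        ∀ t ∈ Set.Icc (c.lo k) (c.hi k), |s - t| ≤ (c.hi k - c.lo k) / M →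
        |c.A k s - c.A k t| ≤ ε / 4 ∧ |c.B k s - c.B k t| ≤ ε / 4 := by
      intro k hk
      have hA := Metric.uniformContinuousOn_iff.1
        (isCompact_Icc.uniformContinuousOn_of_continuous (c.contA k hk)) (ε / 4) (by linarith)
      have hB := Metric.uniformContinuousOn_iff.1
        (isCompact_Icc.uniformContinuousOn_of_continuous (c.contB k hk)) (ε / 4) (by linarith)
      obtain ⟨δ₁, h1, hA⟩ := hA
      obtain ⟨δ₂, h2, hB⟩ := hB
      have ht := tendsto_const_div_atTop_nhds_zero_nat (c.hi k - c.lo k)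
      filter_upwards [ht.eventually_lt_const h1, ht.eventually_lt_const h2] with
        M e1 e2 s hs t ht hst
      rw [← Real.dist_eq] at hst
      exact ⟨(hA s hs t ht (hst.trans_lt e1)).le, (hB s hs t ht (hst.trans_lt e2)).le⟩
    obtain ⟨M, h1, h2⟩ := ((Filter.eventually_gt_atTop 0).and
      ((Filter.eventually_all_finite (Set.finite_Iio c.num)).2 h)).exists
    exact ⟨M, h1, h2⟩
  have hnum : (0 : ℝ) < (M * c.num : ℕ) := by exact_mod_cast Nat.mul_pos hM c.num_pos
  set η : ℝ := ε / (8 * (M * c.num : ℕ)) with hη_def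
  have hη : 0 < η := by positivity
  have hηN : 2 * η * (M * c.num : ℕ) = ε / 4 := by rw [hη_def]; field_simp; norm_num
  have hηε : η ≤ ε / 4 := by
    have : (1 : ℝ) ≤ (M * c.num : ℕ) := by exact_mod_cast Nat.mul_pos hM c.num_pos
    nlinarith
  have hsame : ∀ k < c.num, ∀ r < M,
      |c.A k (c.sample M k (r + 1)) - c.A k (c.sample M k r)| ≤ ε / 4 ∧
      |c.B k (c.sample M k (r + 1)) - c.B k (c.sample M k r)| ≤ ε / 4 := by
    intro k hk r hr
    refine hosc k hk _ (sample_mem hM hk hr) _ (sample_mem hM hk hr.le) ?_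
    have e : c.sample M k (r + 1) - c.sample M k r = (c.hi k - c.lo k) / M := by
      rw [sample, sample]; push_cast; ring
    rw [e, abs_of_nonneg (div_nonneg (sub_nonneg.2 (c.le k hk)) (Nat.cast_nonneg _))]
  have hsplit : ∀ q, q < M * c.num → ∃ k r, q = k * M + r ∧ r < M ∧ k < c.num := by
    intro q hq
    refine ⟨q / M, q % M, ?_, Nat.mod_lt _ hM, ?_⟩
    · rw [mul_comm]; exact (Nat.div_add_mod q M).symm
    · rw [Nat.div_lt_iff_lt_mul hM, mul_comm]; exact hq
  refine ⟨2 * (M * c.num), c.stepWidth M η, fun j => (j - 1) / 2 / M, ?_,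
    stepWidth_pos hM hη, ?_, ?_, ?_⟩
  · have := Nat.mul_pos hM c.num_pos; omega
  · intro i j hij
    exact Nat.div_le_div_right (Nat.div_le_div_right (Nat.sub_le_sub_right hij 1))
  · rintro j ⟨hj1, hj2⟩
    obtain ⟨k, r, hq, hr, hk⟩ := hsplit ((j - 1) / 2) (by omega)
    obtain ⟨hA, hB⟩ := hsame k hk r hr
    have hA' := (abs_le.1 hA).2
    have hB' := (abs_le.1 hB).1
    rcases (show j = 2 * ((j - 1) / 2) + 1 ∨ j = 2 * ((j - 1) / 2) + 2 by omega) with h | h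
    · rw [hq] at h
      beta_reduce
      rw [h, stepWidth_odd hk hr, piece_odd hr]
      exact ⟨hk, by linarith⟩
    · rw [hq] at h
      beta_reduce
      rw [h, stepWidth_even hk hr, piece_even hr]
      exact ⟨hk, by linarith⟩
  · intro S Z hS1 hZ1 hS hZ
    beta_reduce at hS hZ
    have node := zigzag_node hM hη hS1 hZ1 hS hZ
    have herr : ∀ q ≤ M * c.num, 2 * η * (q : ℕ) ≤ ε / 4 := by
      intro q hq
      rw [← hηN]
      have : (q : ℝ) ≤ (M * c.num : ℕ) := by exact_mod_cast hq
      nlinarith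
    constructor
    · rintro j ⟨hj1, hj2⟩
      rcases eq_or_lt_of_le hj2 with h | h
      · have hk : c.num - 1 < c.num := by have := c.num_pos; omega
        obtain ⟨n1, n2, n3⟩ := node (M * c.num) (c.num - 1) M (by
          have : c.num = c.num - 1 + 1 := by omega
          rw [mul_comm]
          nth_rewrite 1 [this]
          ring) le_rfl hk
        have := herr (M * c.num) le_rfl
        refine ⟨c.num - 1, hk, _, sample_mem hM hk le_rfl, ?_, ?_⟩
        · rw [h, n1, sub_self, abs_zero]; exact hε.le
        · rw [h, abs_of_nonneg n2]; linarith
      · obtain ⟨k, r, hq, hr, hk⟩ := hsplit ((j - 1) / 2) (by omega)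
        obtain ⟨n1, n2, n3⟩ := node _ k r hq hr.le hk
        have hle := herr ((j - 1) / 2) (by omega)
        refine ⟨k, hk, _, sample_mem hM hk hr.le, ?_⟩
        rcases (show j = 2 * ((j - 1) / 2) + 1 ∨ j = 2 * ((j - 1) / 2) + 1 + 1 by omega)
            with h' | h'
        · rw [h']
          refine ⟨?_, ?_⟩
          · rw [n1, sub_self, abs_zero]; exact hε.le
          · rw [abs_of_nonneg n2]; linarith
        · obtain ⟨hA, -⟩ := hsame k hk r hr
          have s1 := hS (2 * (k * M + r) + 1) (by omega) (by have := step_le hk hr rfl; omega)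
          have z1 := hZ (2 * (k * M + r) + 1) (by omega) (by have := step_le hk hr rfl; omega)
          rw [stepWidth_odd hk hr, piece_odd hr, ← hq] at s1 z1
          rw [colSign_odd, one_mul] at s1
          have hmono := c.monoA k hk (sample_mem hM hk hr.le) (sample_mem hM hk hr)
            (sample_mono hM hk)
          have hA' := (abs_le.1 hA).2
          have e0 := c.e_mem k hk
          have d0 := c.d_mem k hk
          set a := c.A k (c.sample M k (r + 1)) - c.A k (c.sample M k r) + η with ha
          have ha0 : 0 ≤ a := by linarith
          have ha1 : a ≤ ε / 2 := by linarith
          rw [h', s1, z1]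
          constructor
          · rw [n1, add_sub_cancel_left, abs_of_nonneg (mul_nonneg ha0 d0.1)]
            nlinarith [d0.2]
          · rw [add_sub_right_comm, abs_of_nonneg (add_nonneg n2 (mul_nonneg ha0 e0.1))]
            nlinarith [e0.2]
    · intro k hk t ht
      obtain ⟨r, hr, hrt⟩ := exists_sample hM hk ht
      obtain ⟨hA, hB⟩ := hosc k hk t ht _ (sample_mem hM hk hr) hrt
      obtain ⟨n1, n2, n3⟩ := node _ k r rfl hr hk
      have hq : k * M + r ≤ M * c.num := by
        calc k * M + r ≤ k * M + M := by omega
          _ = (k + 1) * M := by ring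
          _ ≤ c.num * M := Nat.mul_le_mul_right _ hk
          _ = M * c.num := mul_comm _ _
      have hle := herr _ hq
      have e0 := c.e_mem k hk
      have d0 := c.d_mem k hk
      refine ⟨2 * (k * M + r) + 1, ⟨by omega, by omega⟩, ?_, ?_⟩
      · have e1 : S (2 * (k * M + r) + 1) - c.x k t = -(c.d k * ((c.A k t - c.A k (c.sample M k r))
            + (c.B k t - c.B k (c.sample M k r)))) := by
          rw [n1, x, x]; ring
        rw [e1, abs_neg, abs_mul, abs_of_nonneg d0.1]
        have := abs_add_le (c.A k t - c.A k (c.sample M k r)) (c.B k t - c.B k (c.sample M k r))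
        nlinarith [d0.2, abs_nonneg ((c.A k t - c.A k (c.sample M k r))
          + (c.B k t - c.B k (c.sample M k r)))]
      · have e1 : Z (2 * (k * M + r) + 1) - c.y k t =
            (Z (2 * (k * M + r) + 1) - c.y k (c.sample M k r))
            + -(c.e k * ((c.A k t - c.A k (c.sample M k r))
              - (c.B k t - c.B k (c.sample M k r)))) := by
          rw [y, y]; ring
        rw [e1]
        refine (abs_add_le _ _).trans ?_
        rw [abs_neg, abs_mul, abs_of_nonneg e0.1, abs_of_nonneg n2]
        have := abs_sub (c.A k t - c.A k (c.sample M k r)) (c.B k t - c.B k (c.sample M k r))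
        nlinarith [e0.2, abs_nonneg ((c.A k t - c.A k (c.sample M k r))
          - (c.B k t - c.B k (c.sample M k r)))]

end ProfileData

/-! ### Plane vectors as complex numbers -/

/-- The oriented area spanned by two plane vectors. -/
def area (P Q : ℂ) : ℝ := P.re * Q.im - P.im * Q.re

/-- The cotangent of half the angle from the unit vector `P` to the unit vector `Q`. -/
def halfCot (P Q : ℂ) : ℝ := (1 + (P.re * Q.re + P.im * Q.im)) / area P Q

lemma area_add_left (P P' Q : ℂ) : area (P + P') Q = area P Q + area P' Q := by
  simp [area]; ring

lemma area_add_right (P Q Q' : ℂ) : area P (Q + Q') = area P Q + area P Q' := by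
  simp [area]; ring

lemma area_mul_left (r : ℝ) (P Q : ℂ) : area (r * P) Q = r * area P Q := by
  simp [area]; ring

lemma area_mul_right (r : ℝ) (P Q : ℂ) : area P (r * Q) = r * area P Q := by
  simp [area]; ring

lemma area_self (P : ℂ) : area P P = 0 := by simp [area]; ring

lemma abs_area_le (P Q : ℂ) : |area P Q| ≤ ‖P‖ * ‖Q‖ := by
  apply abs_le_of_sq_le_sq _ (by positivity)
  rw [mul_pow, ← Complex.normSq_eq_norm_sq, ← Complex.normSq_eq_norm_sq, Complex.normSq_apply,
    Complex.normSq_apply, area]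
  nlinarith [sq_nonneg (P.re * Q.re + P.im * Q.im)]

lemma eq_add_of_area_ne_zero {P Q : ℂ} (h : area P Q ≠ 0) (W : ℂ) :
    W = (area W Q / area P Q : ℝ) * P + (area P W / area P Q : ℝ) * Q := by
  apply Complex.ext
  · rw [Complex.add_re, Complex.re_ofReal_mul, Complex.re_ofReal_mul]
    field_simp
    simp only [area]; ring
  · rw [Complex.add_im, Complex.im_ofReal_mul, Complex.im_ofReal_mul]
    field_simp
    simp only [area]; ring

lemma continuous_area : Continuous fun p : ℂ × ℂ => area p.1 p.2 := by
  unfold area; fun_prop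

lemma re_sq_add_im_sq {P : ℂ} (hP : ‖P‖ = 1) : P.re ^ 2 + P.im ^ 2 = 1 := by
  have := Complex.normSq_eq_norm_sq P
  rw [hP, Complex.normSq_apply] at this
  linarith

lemma halfCot_pos {P Q : ℂ} (hP : ‖P‖ = 1) (hQ : ‖Q‖ = 1) (h : 0 < area P Q) :
    0 < halfCot P Q := by
  apply div_pos _ h
  have h1 := re_sq_add_im_sq hP
  have h2 := re_sq_add_im_sq hQ
  have h3 : (P.re * Q.re + P.im * Q.im) ^ 2 + area P Q ^ 2 = 1 := by
    rw [area]
    linear_combination (Q.re ^ 2 + Q.im ^ 2) * h1 + h2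
  have h4 : 0 < area P Q ^ 2 := by positivity
  nlinarith

/-- The half-angle relation between two unit vectors, without trigonometric functions. -/
lemma mul_halfCot_add {P Q : ℂ} (hP : ‖P‖ = 1) (hQ : ‖Q‖ = 1) (h : 0 < area P Q) :
    P * (halfCot P Q + Complex.I) = Q * (halfCot P Q - Complex.I) := by
  have h1 := re_sq_add_im_sq hP
  have h2 := re_sq_add_im_sq hQ
  have hc : halfCot P Q * area P Q = 1 + (P.re * Q.re + P.im * Q.im) := div_mul_cancel₀ _ h.ne'
  have e1 : (P * (halfCot P Q + Complex.I) - Q * (halfCot P Q - Complex.I)) =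
      ⟨(P.re - Q.re) * halfCot P Q - P.im - Q.im, (P.im - Q.im) * halfCot P Q + P.re + Q.re⟩ := by
    apply Complex.ext <;> simp <;> ring
  have h0 : (0 : ℂ) = ⟨0, 0⟩ := rfl
  rw [← sub_eq_zero, e1, h0, Complex.mk.injEq]
  have key : ∀ x : ℝ, x * area P Q = 0 → x = 0 := fun x hx =>
    (mul_eq_zero.1 hx).resolve_right h.ne'
  constructor <;> apply key
  · calc _ = (P.re - Q.re) * (halfCot P Q * area P Q) - (P.im + Q.im) * area P Q := by ring
      _ = 0 := by
        rw [hc, area]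
        linear_combination Q.re * h1 - P.re * h2
  · calc _ = (P.im - Q.im) * (halfCot P Q * area P Q) + (P.re + Q.re) * area P Q := by ring
      _ = 0 := by
        rw [hc, area]
        linear_combination Q.im * h1 - P.im * h2

lemma mul_tanRot_halfCot {P Q : ℂ} (hP : ‖P‖ = 1) (hQ : ‖Q‖ = 1) (h : 0 < area P Q) :
    P * tanRot (1 / halfCot P Q) = Q := by
  have hz := halfCot_pos hP hQ h
  have hz' : (halfCot P Q : ℂ) ≠ 0 := by exact_mod_cast hz.ne'
  have e := mul_halfCot_add hP hQ h
  rw [tanRot, ← mul_div_assoc, div_eq_iff (one_sub_mul_I_ne _)]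
  push_cast
  field_simp
  linear_combination e

lemma mul_tanRot_neg_halfCot {P Q : ℂ} (hP : ‖P‖ = 1) (hQ : ‖Q‖ = 1) (h : 0 < area P Q) :
    Q * tanRot (-1 / halfCot P Q) = P := by
  have hz := halfCot_pos hP hQ h
  have hz' : (halfCot P Q : ℂ) ≠ 0 := by exact_mod_cast hz.ne'
  have e := mul_halfCot_add hP hQ h
  rw [tanRot, ← mul_div_assoc, div_eq_iff (one_sub_mul_I_ne _)]
  push_cast
  field_simp
  linear_combination -e

/-! ### Continuity near the diagonal -/

section diagonal

variable {a b : ℝ} {F : ℝ × ℝ → ℝ}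

lemma exists_abs_sub_diag_le {K : Set (ℝ × ℝ)} (hK : IsCompact K) (hF : ContinuousOn F K) {ε : ℝ}
    (hε : 0 < ε) : ∃ h > 0, ∀ u v, (u, u) ∈ K → (u, v) ∈ K → |u - v| ≤ h →
      |F (u, v) - F (u, u)| ≤ ε := by
  obtain ⟨δ, hδ, H⟩ := Metric.uniformContinuousOn_iff.1
    (hK.uniformContinuousOn_of_continuous hF) ε hε
  refine ⟨δ / 2, by linarith, fun u v hu hv huv => ?_⟩
  refine (H (u, v) hv (u, u) hu ?_).le
  rw [Prod.dist_eq, dist_self, max_eq_right dist_nonneg, Real.dist_eq, abs_sub_comm]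
  linarith

lemma exists_le_near_diag (hab : a ≤ b) (hF : ContinuousOn F (Set.Icc a b ×ˢ Set.Icc a b))
    (hpos : ∀ u ∈ Set.Icc a b, 0 < F (u, u)) :
    ∃ h > 0, ∃ c > 0, ∀ u ∈ Set.Icc a b, ∀ v ∈ Set.Icc a b, |u - v| ≤ h → c ≤ F (u, v) := by
  have hd : ContinuousOn (fun u => F (u, u)) (Set.Icc a b) :=
    hF.comp (f := fun u => (u, u)) (by fun_prop) fun u hu => ⟨hu, hu⟩
  obtain ⟨u₀, hu₀, hmin⟩ := isCompact_Icc.exists_isMinOn (Set.nonempty_Icc.2 hab) hd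
  have h0 := hpos u₀ hu₀
  obtain ⟨h, hh, H⟩ := exists_abs_sub_diag_le (isCompact_Icc.prod isCompact_Icc) hF (half_pos h0)
  refine ⟨h, hh, _, half_pos h0, fun u hu v hv huv => ?_⟩
  have h1 := (abs_le.1 (H u v ⟨hu, hu⟩ ⟨hu, hv⟩ huv)).1
  have h2 : F (u₀, u₀) ≤ F (u, u) := hmin hu
  linarith

end diagonal

/-! ### The rows -/

/-- The datum curve `γ` on `[a, b]`, the directions `Dm`, `Dp` of the two creases of the folded
datum column that meet at a point of it, and the vector field `g` along which the columns are
shifted. The curves `γ + X g` with `X` between `Xlo` and `Xhi` run between the crease directions. -/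
structure SpineData where
  a : ℝ
  b : ℝ
  γ : ℝ → ℂ
  γ' : ℝ → ℂ
  g : ℝ → ℂ
  g' : ℝ → ℂ
  Dm : ℝ → ℂ
  Dp : ℝ → ℂ
  Xlo : ℝ
  Xhi : ℝ
  lt : a < b
  hasDeriv : ∀ u ∈ Set.Icc a b, HasDerivWithinAt γ (γ' u) (Set.Icc a b) u
  hasDeriv_g : ∀ u ∈ Set.Icc a b, HasDerivWithinAt g (g' u) (Set.Icc a b) u
  cont : ContinuousOn γ' (Set.Icc a b)
  cont_g : ContinuousOn g' (Set.Icc a b)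
  contm : ContinuousOn Dm (Set.Icc a b)
  contp : ContinuousOn Dp (Set.Icc a b)
  normm : ∀ u ∈ Set.Icc a b, ‖Dm u‖ = 1
  normp : ∀ u ∈ Set.Icc a b, ‖Dp u‖ = 1
  area_pos : ∀ u ∈ Set.Icc a b, 0 < area (Dm u) (Dp u)
  g_eq : ∀ u ∈ Set.Icc a b, g u = Dm u * (halfCot (Dm u) (Dp u) + Complex.I)
  cone : ∀ X ∈ ({Xlo, Xhi} : Set ℝ), ∀ u ∈ Set.Icc a b,
    0 < area (Dm u) (γ' u + X * g' u) ∧ 0 < area (γ' u + X * g' u) (Dp u)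

lemma HasDerivAt.area_const {c : ℝ → ℂ} {c' : ℂ} {u : ℝ} (h : HasDerivAt c c' u) (P : ℂ) :
    HasDerivAt (fun u => area P (c u)) (area P c') u :=
  ((Complex.imCLM.hasFDerivAt.comp_hasDerivAt u h).const_mul P.re).sub
    ((Complex.reCLM.hasFDerivAt.comp_hasDerivAt u h).const_mul P.im)

lemma area_swap (P Q : ℂ) : area P Q = -area Q P := by simp [area]; ring

namespace SpineData

variable (s : SpineData)

lemma continuousOn : ContinuousOn s.γ (Set.Icc s.a s.b) :=
  fun u hu => (s.hasDeriv u hu).continuousWithinAt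

lemma continuousOn_g : ContinuousOn s.g (Set.Icc s.a s.b) :=
  fun u hu => (s.hasDeriv_g u hu).continuousWithinAt

lemma continuousOn_area {F G : ℝ → ℂ} (hF : ContinuousOn F (Set.Icc s.a s.b))
    (hG : ContinuousOn G (Set.Icc s.a s.b)) :
    ContinuousOn (fun q : ℝ × ℝ => area (F q.1) (G q.2))
      (Set.Icc s.a s.b ×ˢ Set.Icc s.a s.b) :=
  continuous_area.comp_continuousOn
    ((hF.comp continuousOn_fst fun _ h => h.1).prodMk (hG.comp continuousOn_snd fun _ h => h.2))

/-- A short chord of a column curve lies between the crease directions at its ends. -/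
lemma exists_chord_pos {X : ℝ} (hX : X ∈ ({s.Xlo, s.Xhi} : Set ℝ)) :
    ∃ h > 0, ∀ u ∈ Set.Icc s.a s.b, ∀ v ∈ Set.Icc s.a s.b, u < v → v - u ≤ h →
      0 < area (s.Dm u) (s.γ v - s.γ u + X * (s.g v - s.g u)) ∧
      0 < area (s.γ v - s.γ u + X * (s.g v - s.g u)) (s.Dp v) := by
  have hc : ContinuousOn (fun u => s.γ' u + X * s.g' u) (Set.Icc s.a s.b) :=
    s.cont.add (continuousOn_const.mul s.cont_g)
  obtain ⟨h₁, hh₁, c₁, hc₁, H₁⟩ := exists_le_near_diag s.lt.le (s.continuousOn_area s.contm hc)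
    fun u hu => (s.cone X hX u hu).1
  obtain ⟨h₂, hh₂, c₂, hc₂, H₂⟩ := exists_le_near_diag s.lt.le (s.continuousOn_area hc s.contp)
    fun u hu => (s.cone X hX u hu).2
  refine ⟨min h₁ h₂, lt_min hh₁ hh₂, fun u hu v hv huv hle => ?_⟩
  have hsub : Set.Icc u v ⊆ Set.Icc s.a s.b := Set.Icc_subset_Icc hu.1 hv.2
  have hcont : ContinuousOn (fun u => s.γ u + X * s.g u) (Set.Icc u v) :=
    (s.continuousOn.add (continuousOn_const.mul s.continuousOn_g)).mono hsub
  have hder : ∀ x ∈ interior (Set.Icc u v),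
      HasDerivAt (fun u => s.γ u + X * s.g u) (s.γ' x + X * s.g' x) x := by
    intro x hx
    rw [interior_Icc] at hx
    have hx' : x ∈ Set.Icc s.a s.b := hsub ⟨hx.1.le, hx.2.le⟩
    have hn : Set.Icc s.a s.b ∈ nhds x :=
      Icc_mem_nhds (hu.1.trans_lt hx.1) (hx.2.trans_le hv.2)
    exact ((s.hasDeriv x hx').hasDerivAt hn).add
      (((s.hasDeriv_g x hx').hasDerivAt hn).const_mul (X : ℂ))
  have e : s.γ v - s.γ u + X * (s.g v - s.g u) =
      (s.γ v + X * s.g v) - (s.γ u + X * s.g u) := by ring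
  have esub : ∀ P W W' : ℂ, area P (W - W') = area P W - area P W' := by
    intro P W W'; simp [area]; ring
  have hxi : ∀ x ∈ interior (Set.Icc u v), x ∈ Set.Icc s.a s.b ∧ |u - x| ≤ h₁ ∧ |x - v| ≤ h₂ := by
    intro x hx
    rw [interior_Icc] at hx
    refine ⟨hsub ⟨hx.1.le, hx.2.le⟩, ?_, ?_⟩
    · rw [abs_sub_comm, abs_of_pos (by linarith [hx.1])]
      linarith [hx.2, min_le_left h₁ h₂]
    · rw [abs_sub_comm, abs_of_pos (by linarith [hx.2])]
      linarith [hx.1, min_le_right h₁ h₂]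
  have hcl : ∀ P : ℂ, ContinuousOn (fun x => area P (s.γ x + X * s.g x)) (Set.Icc u v) :=
    fun P => continuous_area.comp_continuousOn (continuousOn_const.prodMk hcont)
  constructor
  · rw [e, esub, sub_pos]
    refine strictMonoOn_of_deriv_pos (convex_Icc u v) (hcl (s.Dm u)) (fun x hx => ?_)
      ⟨le_rfl, huv.le⟩ ⟨huv.le, le_rfl⟩ huv
    rw [((hder x hx).area_const (s.Dm u)).deriv]
    obtain ⟨m1, m2, m3⟩ := hxi x hx
    exact hc₁.trans_le (H₁ u hu x m1 m2)
  · rw [area_swap, neg_pos, e, esub, sub_neg]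
    refine strictAntiOn_of_deriv_neg (convex_Icc u v) (hcl (s.Dp v)) (fun x hx => ?_)
      ⟨le_rfl, huv.le⟩ ⟨huv.le, le_rfl⟩ huv
    rw [((hder x hx).area_const (s.Dp v)).deriv, area_swap, neg_lt_zero]
    obtain ⟨m1, m2, m3⟩ := hxi x hx
    exact hc₂.trans_le (H₂ x m1 v hv m3)

/-- The `q`-th of the points that divide `[a, b]` into `M` parts; the last one is repeated. -/
def node (M q : ℕ) : ℝ := s.a + (s.b - s.a) * ((min q M : ℕ) / M)

/-- The direction of the `i`-th crease of the datum column. -/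
def dirSeq (M i : ℕ) : ℂ := if Even i then s.Dp (s.node M (i / 2)) else s.Dm (s.node M (i / 2))

/-- The half-angle cotangent at the `i`-th vertex of the datum column. -/
def cotSeq (M i : ℕ) : ℝ :=
  halfCot (s.Dm (s.node M ((i - 1) / 2))) (s.Dp (s.node M (i / 2)))

/-- The length of the `i`-th crease of the datum column: two consecutive creases lead from a node
of the datum curve to the next one; the two boundary creases have length `η`. -/
def lenSeq (M : ℕ) (η : ℝ) (i : ℕ) : ℝ :=
  let u := s.node M ((i - 1) / 2)
  let v := s.node M ((i - 1) / 2 + 1)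
  if i = 0 ∨ i = 2 * M + 1 then η
  else if Odd i then area (s.γ v - s.γ u) (s.Dp v) / area (s.Dm u) (s.Dp v)
  else area (s.Dm u) (s.γ v - s.γ u) / area (s.Dm u) (s.Dp v)

variable {M : ℕ}

lemma node_mem (hM : 0 < M) (q : ℕ) : s.node M q ∈ Set.Icc s.a s.b := by
  have h1 : ((min q M : ℕ) : ℝ) / M ≤ 1 := by
    rw [div_le_one (by exact_mod_cast hM)]; exact_mod_cast min_le_right q M
  have h2 : (0 : ℝ) ≤ ((min q M : ℕ) : ℝ) / M := by positivity
  have h3 := s.lt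
  unfold node
  constructor <;> nlinarith

lemma node_mono : Monotone (s.node M) := by
  intro q r h
  unfold node
  have := s.lt
  have h' : min q M ≤ min r M := min_le_min_right M h
  gcongr

lemma node_zero : s.node M 0 = s.a := by simp [node]

lemma node_succ_sub {q : ℕ} (hq : q < M) :
    s.node M (q + 1) - s.node M q = (s.b - s.a) / M := by
  rw [node, node, min_eq_left hq.le, min_eq_left (show q + 1 ≤ M from hq)]
  push_cast
  ring

lemma node_of_le {q : ℕ} (hM : 0 < M) (hq : M ≤ q) : s.node M q = s.b := by
  rw [node, min_eq_right hq, div_self (by exact_mod_cast hM.ne')]; ring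

/-- Every point of `[a, b]` is close to a node. -/
lemma exists_node (hM : 0 < M) {v : ℝ} (hv : v ∈ Set.Icc s.a s.b) :
    ∃ q ≤ M, |v - s.node M q| ≤ (s.b - s.a) / M := by
  have hM' : (0 : ℝ) < M := by exact_mod_cast hM
  have hlen : 0 < s.b - s.a := sub_pos.2 s.lt
  set t := (v - s.a) / (s.b - s.a) * M with ht
  have ht0 : 0 ≤ t := mul_nonneg (div_nonneg (by linarith [hv.1]) hlen.le) hM'.le
  have htM : t ≤ M := by
    have : (v - s.a) / (s.b - s.a) ≤ 1 := by
      rw [div_le_one hlen]; linarith [hv.2]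
    nlinarith
  have f1 := Nat.floor_le ht0
  have f2 := (Nat.lt_floor_add_one t).le
  have hfl : ⌊t⌋₊ ≤ M := Nat.floor_le_of_le htM
  refine ⟨⌊t⌋₊, hfl, ?_⟩
  have ht' : (s.b - s.a) * t = (v - s.a) * M := by rw [ht]; field_simp
  have e : v - s.node M ⌊t⌋₊ = (s.b - s.a) / M * (t - ⌊t⌋₊) := by
    rw [node, min_eq_left hfl]; field_simp; linear_combination -ht'
  have hp := div_pos hlen hM'
  rw [e, abs_mul, abs_of_pos hp]
  have : |t - ⌊t⌋₊| ≤ 1 := by rw [abs_of_nonneg (by linarith)]; linarith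
  nlinarith

end SpineData

/-! ### The vertices of the datum column -/

namespace SpineData

variable (s : SpineData) {M : ℕ}

/-- The first vertex of the datum column, on the boundary of the paper. -/
def startPoint (η : ℝ) : ℂ := s.γ s.a - η * s.Dp s.a

/-- The `i`-th vertex of the datum column. -/
def vertexSeq (M : ℕ) (η : ℝ) (i : ℕ) : ℂ :=
  s.startPoint η + ∑ k ∈ Finset.range i, s.lenSeq M η k * s.dirSeq M k

lemma vertexSeq_succ (η : ℝ) (i : ℕ) :
    s.vertexSeq M η (i + 1) = s.vertexSeq M η i + s.lenSeq M η i * s.dirSeq M i := by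
  rw [vertexSeq, vertexSeq, Finset.sum_range_succ, add_assoc]

lemma dirSeq_odd (q : ℕ) : s.dirSeq M (2 * q + 1) = s.Dm (s.node M q) := by
  have h : ¬ Even (2 * q + 1) := Nat.not_even_iff_odd.2 ⟨q, rfl⟩
  rw [dirSeq, if_neg h, show (2 * q + 1) / 2 = q by omega]

lemma dirSeq_even (q : ℕ) : s.dirSeq M (2 * q) = s.Dp (s.node M q) := by
  rw [dirSeq, if_pos (even_two_mul q), show (2 * q) / 2 = q by omega]

lemma cotSeq_odd (q : ℕ) :
    s.cotSeq M (2 * q + 1) = halfCot (s.Dm (s.node M q)) (s.Dp (s.node M q)) := by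
  rw [cotSeq, show (2 * q + 1 - 1) / 2 = q by omega, show (2 * q + 1) / 2 = q by omega]

lemma cotSeq_even (q : ℕ) :
    s.cotSeq M (2 * q + 2) = halfCot (s.Dm (s.node M q)) (s.Dp (s.node M (q + 1))) := by
  rw [cotSeq, show (2 * q + 2 - 1) / 2 = q by omega, show (2 * q + 2) / 2 = q + 1 by omega]

lemma norm_dirSeq (hM : 0 < M) (i : ℕ) : ‖s.dirSeq M i‖ = 1 := by
  rw [dirSeq]
  split_ifs
  · exact s.normp _ (s.node_mem hM _)
  · exact s.normm _ (s.node_mem hM _)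

/-- Any two consecutive nodes are so close that the crease directions at them enclose positive
area. -/
def AreaPos (M : ℕ) : Prop :=
  ∀ q, 0 < area (s.Dm (s.node M q)) (s.Dp (s.node M (q + 1)))

variable {s}

lemma cotSeq_pos (hM : 0 < M) (h : s.AreaPos M) (i : ℕ) : 0 < s.cotSeq M i := by
  obtain ⟨q, rfl | rfl⟩ := i.even_or_odd'
  · rcases Nat.eq_zero_or_pos q with rfl | hq
    · exact halfCot_pos (s.normm _ (s.node_mem hM _)) (s.normp _ (s.node_mem hM _))
        (s.area_pos _ (s.node_mem hM _))
    · obtain ⟨r, rfl⟩ := Nat.exists_eq_add_of_le' hq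
      rw [show 2 * (r + 1) = 2 * r + 2 by ring, cotSeq_even]
      exact halfCot_pos (s.normm _ (s.node_mem hM _)) (s.normp _ (s.node_mem hM _)) (h r)
  · rw [cotSeq_odd]
    exact halfCot_pos (s.normm _ (s.node_mem hM _)) (s.normp _ (s.node_mem hM _))
      (s.area_pos _ (s.node_mem hM _))

/-- The crease directions turn at each vertex by twice the angle whose cotangent is given by
`cotSeq`. -/
lemma dirSeq_succ (hM : 0 < M) (h : s.AreaPos M) (i : ℕ) :
    s.dirSeq M (i + 1) = s.dirSeq M i * tanRot ((-1) ^ (i + 1) * 1 / s.cotSeq M (i + 1)) := by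
  obtain ⟨q, rfl | rfl⟩ := i.even_or_odd'
  · have e : ((-1) ^ (2 * q + 1) * 1 : ℝ) = -1 := by
      rw [mul_one, pow_succ, pow_mul]; norm_num
    rw [e, cotSeq_odd, dirSeq_odd, dirSeq_even]
    exact (mul_tanRot_neg_halfCot (s.normm _ (s.node_mem hM _)) (s.normp _ (s.node_mem hM _))
      (s.area_pos _ (s.node_mem hM _))).symm
  · have e : ((-1) ^ (2 * q + 1 + 1) * 1 : ℝ) = 1 := by
      rw [mul_one, pow_succ, pow_succ, pow_mul]; norm_num
    rw [e, show 2 * q + 1 + 1 = 2 * q + 2 by ring, cotSeq_even, dirSeq_odd,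
      show 2 * q + 2 = 2 * (q + 1) by ring, dirSeq_even]
    exact (mul_tanRot_halfCot (s.normm _ (s.node_mem hM _)) (s.normp _ (s.node_mem hM _))
      (h q)).symm

/-- The shift vector at a vertex, expressed by the second of the crease directions there. -/
lemma dirSeq_mul (hM : 0 < M) (h : s.AreaPos M) (i : ℕ) :
    s.dirSeq M i * (s.cotSeq M i - (-1) ^ i * Complex.I) =
      s.Dm (s.node M ((i - 1) / 2)) * (s.cotSeq M i + Complex.I) := by
  obtain ⟨q, rfl | rfl⟩ := i.even_or_odd'
  · rw [dirSeq_even, pow_mul]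
    have e : (((-1 : ℂ) ^ 2) ^ q) = 1 := by norm_num
    rw [e, one_mul]
    rcases Nat.eq_zero_or_pos q with rfl | hq
    · exact (mul_halfCot_add (s.normm _ (s.node_mem hM _)) (s.normp _ (s.node_mem hM _))
        (s.area_pos _ (s.node_mem hM _))).symm
    · obtain ⟨r, rfl⟩ := Nat.exists_eq_add_of_le' hq
      rw [show 2 * (r + 1) = 2 * r + 2 by ring, cotSeq_even,
        show (2 * r + 2 - 1) / 2 = r by omega]
      exact (mul_halfCot_add (s.normm _ (s.node_mem hM _)) (s.normp _ (s.node_mem hM _))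
        (h r)).symm
  · rw [dirSeq_odd, show (2 * q + 1 - 1) / 2 = q by omega, pow_succ, pow_mul]
    norm_num

/-- The increments of the shift field along two consecutive creases. -/
lemma g_sub_g (hM : 0 < M) (h : s.AreaPos M) (q : ℕ) :
    s.g (s.node M (q + 1)) - s.g (s.node M q) =
      (s.cotSeq M (2 * q + 2) - s.cotSeq M (2 * q + 1) : ℝ) * s.Dm (s.node M q) +
      (s.cotSeq M (2 * q + 3) - s.cotSeq M (2 * q + 2) : ℝ) * s.Dp (s.node M (q + 1)) := by
  have m0 := s.node_mem hM q
  have m1 := s.node_mem hM (q + 1)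
  rw [s.g_eq _ m0, s.g_eq _ m1, show 2 * q + 3 = 2 * (q + 1) + 1 by ring, cotSeq_odd, cotSeq_odd,
    cotSeq_even]
  have e1 := mul_halfCot_add (s.normm _ m1) (s.normp _ m1) (s.area_pos _ m1)
  have e2 := mul_halfCot_add (s.normm _ m0) (s.normp _ m1) (h q)
  push_cast
  linear_combination e1 - e2

lemma lenSeq_odd {q : ℕ} (hq : q < M) (η : ℝ) : s.lenSeq M η (2 * q + 1) =
    area (s.γ (s.node M (q + 1)) - s.γ (s.node M q)) (s.Dp (s.node M (q + 1))) /
      area (s.Dm (s.node M q)) (s.Dp (s.node M (q + 1))) := by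
  have h1 : ¬ (2 * q + 1 = 0 ∨ 2 * q + 1 = 2 * M + 1) := by omega
  simp only [lenSeq]
  rw [if_neg h1, if_pos ⟨q, rfl⟩, show (2 * q + 1 - 1) / 2 = q by omega]

lemma lenSeq_even (q : ℕ) (η : ℝ) : s.lenSeq M η (2 * q + 2) =
    area (s.Dm (s.node M q)) (s.γ (s.node M (q + 1)) - s.γ (s.node M q)) /
      area (s.Dm (s.node M q)) (s.Dp (s.node M (q + 1))) := by
  have h1 : ¬ (2 * q + 2 = 0 ∨ 2 * q + 2 = 2 * M + 1) := by omega
  have h2 : ¬ Odd (2 * q + 2) := Nat.not_odd_iff_even.2 ⟨q + 1, by ring⟩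
  simp only [lenSeq]
  rw [if_neg h1, if_neg h2, show (2 * q + 2 - 1) / 2 = q by omega]

lemma lenSeq_zero (η : ℝ) : s.lenSeq M η 0 = η := by simp [lenSeq]

lemma lenSeq_last (η : ℝ) : s.lenSeq M η (2 * M + 1) = η := by simp [lenSeq]

/-- The column creases, at the shift `X` from the datum column, cut the chord of the column curve
in the crease directions. -/
lemma length_odd (hM : 0 < M) (h : s.AreaPos M) {q : ℕ} (hq : q < M) (η X : ℝ) :
    s.lenSeq M η (2 * q + 1) + X * (s.cotSeq M (2 * q + 2) - s.cotSeq M (2 * q + 1)) =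
    area (s.γ (s.node M (q + 1)) - s.γ (s.node M q)
      + X * (s.g (s.node M (q + 1)) - s.g (s.node M q))) (s.Dp (s.node M (q + 1))) /
      area (s.Dm (s.node M q)) (s.Dp (s.node M (q + 1))) := by
  rw [lenSeq_odd hq, area_add_left, add_div, g_sub_g hM h, area_mul_left, area_add_left,
    area_mul_left, area_mul_left, area_self, mul_zero, add_zero]
  have := (h q).ne'
  field_simp

lemma length_even (hM : 0 < M) (h : s.AreaPos M) (q : ℕ) (η X : ℝ) :
    s.lenSeq M η (2 * q + 2) + X * (s.cotSeq M (2 * q + 3) - s.cotSeq M (2 * q + 2)) =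
    area (s.Dm (s.node M q)) (s.γ (s.node M (q + 1)) - s.γ (s.node M q)
      + X * (s.g (s.node M (q + 1)) - s.g (s.node M q))) /
      area (s.Dm (s.node M q)) (s.Dp (s.node M (q + 1))) := by
  rw [lenSeq_even, area_add_right, add_div, g_sub_g hM h, area_mul_right, area_add_right,
    area_mul_right, area_mul_right, area_self, mul_zero, zero_add]
  have := (h q).ne'
  field_simp

/-- The odd vertices lie on the datum curve. -/
lemma vertexSeq_odd (h : s.AreaPos M) (η : ℝ) {q : ℕ} (hq : q ≤ M) :
    s.vertexSeq M η (2 * q + 1) = s.γ (s.node M q) := by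
  induction q with
  | zero =>
    have e : s.dirSeq M 0 = s.Dp s.a := by
      have := s.dirSeq_even (M := M) 0
      rwa [mul_zero, node_zero] at this
    rw [vertexSeq, mul_zero, zero_add, Finset.sum_range_one, lenSeq_zero, e, startPoint, node_zero]
    ring
  | succ q ih =>
    have ih := ih (by omega)
    rw [show 2 * (q + 1) + 1 = 2 * q + 1 + 1 + 1 by ring, vertexSeq_succ, vertexSeq_succ, ih,
      dirSeq_odd, show 2 * q + 1 + 1 = 2 * q + 2 by ring, lenSeq_even, lenSeq_odd (by omega),
      show 2 * q + 2 = 2 * (q + 1) by ring, dirSeq_even, add_assoc,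
      ← eq_add_of_area_ne_zero (h q).ne']
    ring

end SpineData

namespace SpineData

variable (s : SpineData)

lemma exists_norm_sub_le {F : ℝ → ℂ} (hF : ContinuousOn F (Set.Icc s.a s.b)) {ε : ℝ} (hε : 0 < ε) :
    ∃ h > 0, ∀ u ∈ Set.Icc s.a s.b, ∀ v ∈ Set.Icc s.a s.b, |u - v| ≤ h → ‖F u - F v‖ ≤ ε := by
  obtain ⟨δ, hδ, H⟩ := Metric.uniformContinuousOn_iff.1
    (isCompact_Icc.uniformContinuousOn_of_continuous hF) ε hε
  refine ⟨δ / 2, by linarith, fun u hu v hv huv => ?_⟩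
  rw [← dist_eq_norm]
  exact (H u hu v hv (by rw [Real.dist_eq]; linarith)).le

/-- The cotangent of half the angle between crease directions at nearby points is close to that at
one point. -/
lemma exists_halfCot_close {ε : ℝ} (hε : 0 < ε) :
    ∃ h > 0, ∀ u ∈ Set.Icc s.a s.b, ∀ v ∈ Set.Icc s.a s.b, |u - v| ≤ h →
      |halfCot (s.Dm u) (s.Dp v) - halfCot (s.Dm u) (s.Dp u)| ≤ ε := by
  obtain ⟨h₀, hh₀, c₀, hc₀, H₀⟩ := exists_le_near_diag s.lt.le (s.continuousOn_area s.contm s.contp)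
    s.area_pos
  set K : Set (ℝ × ℝ) := (Set.Icc s.a s.b ×ˢ Set.Icc s.a s.b) ∩ {q | |q.1 - q.2| ≤ h₀} with hK
  have hKc : IsCompact K := (isCompact_Icc.prod isCompact_Icc).inter_right
    (isClosed_le (by fun_prop) continuous_const)
  have hm : ContinuousOn (fun q : ℝ × ℝ => s.Dm q.1) K :=
    s.contm.comp continuousOn_fst fun _ h => h.1.1
  have hp : ContinuousOn (fun q : ℝ × ℝ => s.Dp q.2) K :=
    s.contp.comp continuousOn_snd fun _ h => h.1.2
  have hF : ContinuousOn (fun q : ℝ × ℝ => halfCot (s.Dm q.1) (s.Dp q.2)) K := by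
    have num : Continuous fun q : ℂ × ℂ => 1 + (q.1.re * q.2.re + q.1.im * q.2.im) := by fun_prop
    exact (num.comp_continuousOn (hm.prodMk hp)).div
      (continuous_area.comp_continuousOn (hm.prodMk hp))
      fun q hq => (hc₀.trans_le (H₀ q.1 hq.1.1 q.2 hq.1.2 hq.2)).ne'
  obtain ⟨h₁, hh₁, H₁⟩ := exists_abs_sub_diag_le hKc hF hε
  refine ⟨min h₀ h₁, lt_min hh₀ hh₁, fun u hu v hv huv => ?_⟩
  refine H₁ u v ⟨⟨hu, hu⟩, ?_⟩ ⟨⟨hu, hv⟩, huv.trans (min_le_left _ _)⟩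
      (huv.trans (min_le_right _ _))
  simp [hh₀.le]

/-- If the nodes are dense enough then the column creases have positive length and the rows
approximate the curves they are taken from. -/
theorem exists_rows {ε : ℝ} (hε : 0 < ε) : ∃ M : ℕ, 0 < M ∧ s.AreaPos M ∧
    (∀ i ≤ 2 * M + 1, ∀ X ∈ Set.Icc s.Xlo s.Xhi,
      0 < s.lenSeq M ε i + X * (s.cotSeq M (i + 1) - s.cotSeq M i)) ∧
    (∀ i ≤ 2 * M + 2, ‖s.vertexSeq M ε i - s.γ (s.node M ((i - 1) / 2))‖ ≤ ε) ∧
    (∀ i, |s.cotSeq M i - halfCot (s.Dm (s.node M ((i - 1) / 2)))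
      (s.Dp (s.node M ((i - 1) / 2)))| ≤ ε) ∧
    (∀ q, ‖s.γ (s.node M (q + 1)) - s.γ (s.node M q)‖ ≤ ε ∧
      ‖s.g (s.node M (q + 1)) - s.g (s.node M q)‖ ≤ ε) ∧
    ∀ v ∈ Set.Icc s.a s.b, ∃ q ≤ M,
      ‖s.γ v - s.γ (s.node M q)‖ ≤ ε ∧ ‖s.g v - s.g (s.node M q)‖ ≤ ε := by
  obtain ⟨h₀, hh₀, c₀, hc₀, H₀⟩ := exists_le_near_diag s.lt.le (s.continuousOn_area s.contm s.contp)
    s.area_pos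
  obtain ⟨h₁, hh₁, H₁⟩ := s.exists_chord_pos (X := s.Xlo) (by simp)
  obtain ⟨h₂, hh₂, H₂⟩ := s.exists_chord_pos (X := s.Xhi) (by simp)
  obtain ⟨h₃, hh₃, H₃⟩ := s.exists_norm_sub_le s.continuousOn (lt_min hε (mul_pos hε hc₀))
  obtain ⟨h₄, hh₄, H₄⟩ := s.exists_norm_sub_le s.continuousOn_g hε
  obtain ⟨h₅, hh₅, H₅⟩ := s.exists_halfCot_close hε
  obtain ⟨M, hM0, hM⟩ : ∃ M : ℕ, 0 < M ∧
      (s.b - s.a) / M < min h₀ (min h₁ (min h₂ (min h₃ (min h₄ h₅)))) := by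
    have ht := tendsto_const_div_atTop_nhds_zero_nat (s.b - s.a)
    obtain ⟨M, a1, a2⟩ := ((Filter.eventually_gt_atTop 0).and
      (ht.eventually_lt_const (lt_min hh₀ (lt_min hh₁ (lt_min hh₂ (lt_min hh₃
        (lt_min hh₄ hh₅))))))).exists
    exact ⟨M, a1, a2⟩
  simp only [lt_min_iff] at hM
  obtain ⟨l0, l1, l2, l3, l4, l5⟩ := hM
  have hMpos : (0 : ℝ) < M := by exact_mod_cast hM0
  have hL : 0 < (s.b - s.a) / M := div_pos (sub_pos.2 s.lt) hMpos
  have mem := s.node_mem hM0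
  have near : ∀ q, |s.node M q - s.node M (q + 1)| ≤ (s.b - s.a) / M := by
    intro q
    rw [abs_sub_comm]
    rcases lt_or_ge q M with hq | hq
    · rw [s.node_succ_sub hq, abs_of_pos hL]
    · rw [s.node_of_le hM0 hq, s.node_of_le hM0 (by omega), sub_self, abs_zero]; exact hL.le
  have hA : s.AreaPos M := fun q =>
    hc₀.trans_le (H₀ _ (mem q) _ (mem (q + 1)) ((near q).trans l0.le))
  have hlast : s.node M (M + 1) = s.node M M := by
    rw [s.node_of_le hM0 le_rfl, s.node_of_le hM0 (by omega)]
  have hγ : ∀ q, ‖s.γ (s.node M (q + 1)) - s.γ (s.node M q)‖ ≤ min ε (ε * c₀) := fun q =>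
    H₃ _ (mem _) _ (mem _) (by rw [abs_sub_comm]; exact (near q).trans l3.le)
  refine ⟨M, hM0, hA, ?_, ?_, ?_, ?_, ?_⟩
  · intro i hi X hX
    -- the length is affine in `X`, so that it suffices to consider the two extreme shifts
    have affine : ∀ l c : ℝ, 0 < l + s.Xlo * c → 0 < l + s.Xhi * c → 0 < l + X * c := by
      intro l c e1 e2
      rcases le_total 0 c with hc | hc
      · nlinarith [hX.1]
      · nlinarith [hX.2]
    rcases Nat.eq_zero_or_pos i with rfl | hi0
    · have : s.cotSeq M (0 + 1) = s.cotSeq M 0 := rfl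
      rw [this, sub_self, mul_zero, add_zero, lenSeq_zero]
      exact hε
    obtain ⟨q, rfl | rfl⟩ := i.even_or_odd'
    · obtain ⟨r, rfl⟩ := Nat.exists_eq_add_of_le' (show 1 ≤ q by omega)
      have hr : r < M := by omega
      have hlt : s.node M r < s.node M (r + 1) := by linarith [s.node_succ_sub hr]
      have hle := s.node_succ_sub hr
      rw [show 2 * (r + 1) = 2 * r + 2 by ring]
      apply affine
      · rw [show 2 * r + 2 + 1 = 2 * r + 3 by ring, length_even hM0 hA]
        exact div_pos (H₁ _ (mem _) _ (mem _) hlt (by linarith)).1 (hA r)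
      · rw [show 2 * r + 2 + 1 = 2 * r + 3 by ring, length_even hM0 hA]
        exact div_pos (H₂ _ (mem _) _ (mem _) hlt (by linarith)).1 (hA r)
    · rcases eq_or_lt_of_le (show q ≤ M by omega) with rfl | hr
      · have : s.cotSeq q (2 * q + 1 + 1) = s.cotSeq q (2 * q + 1) := by
          rw [show 2 * q + 1 + 1 = 2 * q + 2 by ring, cotSeq_even, cotSeq_odd, hlast]
        rw [this, sub_self, mul_zero, add_zero, lenSeq_last]
        exact hε
      have hlt : s.node M q < s.node M (q + 1) := by linarith [s.node_succ_sub hr]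
      have hle := s.node_succ_sub hr
      rw [show 2 * q + 1 + 1 = 2 * q + 2 by ring]
      apply affine
      · rw [length_odd hM0 hA hr]
        exact div_pos (H₁ _ (mem _) _ (mem _) hlt (by linarith)).2 (hA q)
      · rw [length_odd hM0 hA hr]
        exact div_pos (H₂ _ (mem _) _ (mem _) hlt (by linarith)).2 (hA q)
  · intro i hi
    rcases Nat.eq_zero_or_pos i with rfl | hi0
    · rw [vertexSeq, Finset.sum_range_zero, add_zero, startPoint, Nat.zero_sub, Nat.zero_div,
        node_zero, sub_sub_cancel_left, norm_neg, norm_mul, s.normp _ ⟨le_rfl, s.lt.le⟩, mul_one,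
        Complex.norm_real, Real.norm_of_nonneg hε.le]
    obtain ⟨q, rfl | rfl⟩ := i.even_or_odd'
    · obtain ⟨r, rfl⟩ := Nat.exists_eq_add_of_le' (show 1 ≤ q by omega)
      rw [show 2 * (r + 1) = 2 * r + 1 + 1 by ring, vertexSeq_succ,
        vertexSeq_odd hA ε (show r ≤ M by omega), show (2 * r + 1 + 1 - 1) / 2 = r by omega,
        add_sub_cancel_left, norm_mul, s.norm_dirSeq hM0, mul_one, Complex.norm_real,
            Real.norm_eq_abs]
      rcases eq_or_lt_of_le (show r ≤ M by omega) with rfl | hr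
      · rw [lenSeq_last, abs_of_pos hε]
      · rw [lenSeq_odd hr, abs_div, abs_of_pos (hA r), div_le_iff₀ (hA r)]
        refine (abs_area_le _ _).trans ?_
        rw [s.normp _ (mem _), mul_one]
        refine ((hγ r).trans (min_le_right _ _)).trans ?_
        exact mul_le_mul_of_nonneg_left
          (H₀ _ (mem r) _ (mem (r + 1)) ((near r).trans l0.le)) hε.le
    · rw [vertexSeq_odd hA ε (show q ≤ M by omega), show (2 * q + 1 - 1) / 2 = q by omega, sub_self,
        norm_zero]
      exact hε.le
  · intro i
    rw [cotSeq]
    refine H₅ _ (mem _) _ (mem _) ?_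
    rcases (show i / 2 = (i - 1) / 2 ∨ i / 2 = (i - 1) / 2 + 1 by omega) with h | h
    · rw [h, sub_self, abs_zero]; exact hh₅.le
    · rw [h]; exact (near _).trans l5.le
  · exact fun q => ⟨(hγ q).trans (min_le_left _ _),
      H₄ _ (mem _) _ (mem _) (by rw [abs_sub_comm]; exact (near q).trans l4.le)⟩
  · intro v hv
    obtain ⟨q, hq, hqv⟩ := s.exists_node hM0 hv
    exact ⟨q, hq, (H₃ _ hv _ (mem q) (hqv.trans l3.le)).trans (min_le_left _ _),
      H₄ _ hv _ (mem q) (hqv.trans l4.le)⟩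

end SpineData

/-! ### The angles of a piece -/

lemma tan_div_tan_mem {x y : ℝ}
    (hy : y ∈ Set.Ioo (-(Real.pi / 2)) (Real.pi / 2)) (hxy : 0 < x * y) (h : |x| < |y|) :
    Real.tan x / Real.tan y ∈ Set.Ioo (0 : ℝ) 1 := by
  have key : ∀ x y : ℝ, 0 < x → x < y → y < Real.pi / 2 →
      Real.tan x / Real.tan y ∈ Set.Ioo (0 : ℝ) 1 := by
    intro x y h0 h1 h2
    have t0 := Real.tan_pos_of_pos_of_lt_pi_div_two h0 (h1.trans h2)
    have t1 := Real.tan_lt_tan_of_lt_of_lt_pi_div_two (by linarith [Real.pi_pos]) h2 h1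
    exact ⟨div_pos t0 (t0.trans t1), (div_lt_one (t0.trans t1)).2 t1⟩
  rcases lt_trichotomy 0 y with hy0 | rfl | hy0
  · have hx0 : 0 < x := by by_contra! hh; nlinarith
    rw [abs_of_pos hx0, abs_of_pos hy0] at h
    exact key x y hx0 h hy.2
  · simp at hxy
  · have hx0 : x < 0 := by by_contra! hh; nlinarith
    rw [abs_of_neg hx0, abs_of_neg hy0] at h
    have := key (-x) (-y) (by linarith) h (by linarith [hy.1])
    rwa [Real.tan_neg, Real.tan_neg, neg_div_neg_eq] at this

/-- A point of the Euclidean plane as a complex number. -/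
def planeC (v : EuclideanSpace ℝ (Fin 2)) : ℂ := Complex.orthonormalBasisOneI.repr.symm v

lemma norm_planeC (v : EuclideanSpace ℝ (Fin 2)) : ‖planeC v‖ = ‖v‖ :=
  LinearIsometryEquiv.norm_map _ v

lemma liftPlane_eq (v : EuclideanSpace ℝ (Fin 2)) : liftPlane v = spacePoint (planeC v) 0 := by
  have h : planeC v = v 0 + v 1 * Complex.I := rfl
  rw [spacePoint, liftPlane, h]
  simp

/-- The unit tangent of the datum curve. -/
def tangentC (Γ : ℝ → EuclideanSpace ℝ (Fin 2)) (a b u : ℝ) : ℂ :=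
  (‖derivWithin Γ (Set.Icc a b) u‖⁻¹ : ℝ) * planeC (derivWithin Γ (Set.Icc a b) u)

/-- The vector field along the datum curve by which the columns are shifted. -/
def shiftC (Γ : ℝ → EuclideanSpace ℝ (Fin 2)) (a b : ℝ) (β : ℝ → ℝ) (u : ℝ) : ℂ :=
  ((Real.cos (β u / 2))⁻¹ : ℝ) * tangentC Γ a b u

lemma unitTangent_eq (Γ : ℝ → EuclideanSpace ℝ (Fin 2)) (a b u : ℝ) :
    unitTangent Γ a b u = spacePoint (tangentC Γ a b u) 0 := by
  rw [unitTangent, liftPlane_eq, tangentC, planeC, planeC, map_smul, Complex.real_smul]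

lemma planeNormal_eq : planeNormal = spacePoint 0 1 := by
  rw [spacePoint, planeNormal]; simp

namespace SurfacePiece

variable (p : SurfacePiece)

/-- The constant ratio of the tangents of the sector angles to the left of the datum curve and in
the piece. -/
def ratio (a : ℝ) (α₀ : ℝ → ℝ) : ℝ := Real.tan (α₀ a) / Real.tan (p.α a)

/-- The first coordinate of the target curve along the crease directions, divided by the factor
`1 / sin α` of the row. -/
def coordA (a : ℝ) (β : ℝ → ℝ) (t : ℝ) : ℝ :=
  Real.sin (p.α a) * (shearRotation (creaseAngle (p.α a) (β a)) p.θ *ᵥ p.f t) 0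

/-- The second coordinate of the target curve along the crease directions, divided by the factor
`1 / sin α` of the row. -/
def coordB (a : ℝ) (β : ℝ → ℝ) (t : ℝ) : ℝ :=
  Real.sin (p.α a) * (shearRotation (creaseAngle (p.α a) (β a)) p.θ *ᵥ p.f t) 1

variable {p} {Γ : ℝ → EuclideanSpace ℝ (Fin 2)} {a b σ : ℝ} {α₀ β : ℝ → ℝ}

namespace Admissible

variable (hp : p.Admissible Γ a b α₀ β) (hab : a ≤ b) (hσ : σ = 1 ∨ σ = -1)
  (hα : ∀ u ∈ Set.Icc a b, α₀ u = Real.pi / 2 - σ * (β u / 2))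
  (hβ : ∀ u ∈ Set.Icc a b, β u ∈ Set.Ioo 0 Real.pi)
include hp hab hσ hα hβ

lemma ratio_mem : p.ratio a α₀ ∈ Set.Ioo (0 : ℝ) 1 := by
  have ha : a ∈ Set.Icc a b := ⟨le_rfl, hab⟩
  have h2 := hβ a ha
  have e : p.ratio a α₀ = Real.tan (Real.pi / 2 - p.α a) / Real.tan (Real.pi / 2 - α₀ a) := by
    rw [Real.tan_pi_div_two_sub, Real.tan_pi_div_two_sub, ratio, div_eq_mul_inv, div_eq_mul_inv,
      inv_inv, mul_comm]
  rw [e]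
  apply tan_div_tan_mem
  · rw [hα a ha, sub_sub_cancel]
    rcases hσ with rfl | rfl
    · exact ⟨by linarith [h2.1, Real.pi_pos], by linarith [h2.2]⟩
    · exact ⟨by linarith [h2.2], by linarith [h2.1, Real.pi_pos]⟩
  · have := hp.same_side; linarith
  · have := hp.closer
    rwa [abs_sub_comm (p.α a), abs_sub_comm (α₀ a)] at this

lemma α_eq {u : ℝ} (hu : u ∈ Set.Icc a b) :
    p.α u = Real.pi / 2 - Real.arctan (σ * Real.tan (β u / 2) * p.ratio a α₀) := by
  have ha : a ∈ Set.Icc a b := ⟨le_rfl, hab⟩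
  have h1 := hp.α_mem u hu
  have h2 := hβ u hu
  have hr := (ratio_mem hp hab hσ hα hβ).1
  have ht : Real.tan (α₀ u) / Real.tan (p.α u) = p.ratio a α₀ := hp.tan_ratio u hu a ha
  have h0 : Real.tan (Real.pi / 2 - α₀ u) = σ * Real.tan (β u / 2) := by
    rw [hα u hu, sub_sub_cancel]
    rcases hσ with rfl | rfl
    · rw [one_mul, one_mul]
    · rw [neg_one_mul, neg_one_mul, Real.tan_neg]
  have hne : Real.tan (α₀ u) ≠ 0 := by
    intro h
    rw [h, zero_div] at ht
    exact hr.ne ht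
  have e : Real.tan (Real.pi / 2 - p.α u) = σ * Real.tan (β u / 2) * p.ratio a α₀ := by
    rw [← h0, ← ht, Real.tan_pi_div_two_sub, Real.tan_pi_div_two_sub]
    field_simp
  rw [← e, Real.arctan_tan (by linarith [h1.2]) (by linarith [h1.1])]
  ring

/-- The half of the angle between consecutive creases. -/
lemma creaseAngle_half {u : ℝ} (hu : u ∈ Set.Icc a b) :
    Real.cos (creaseAngle (p.α u) (β u) / 2) =
      Real.sin (p.α u) * p.ratio a α₀ * (Real.cos (β u / 2))⁻¹ ∧
    Real.sin (creaseAngle (p.α u) (β u) / 2) = Real.sin (p.α u) * √(1 - p.ratio a α₀ ^ 2) ∧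
    0 < Real.sin (creaseAngle (p.α u) (β u)) := by
  have h2 := hβ u hu
  obtain ⟨hd0, hd1⟩ := ratio_mem hp hab hσ hα hβ
  have hs : 0 < Real.sin (p.α u) := Real.sin_pos_of_mem_Ioo (hp.α_mem u hu)
  set d := p.ratio a α₀ with hd
  have hc : 0 < Real.cos (β u / 2) :=
    Real.cos_pos_of_mem_Ioo ⟨by linarith [h2.1, Real.pi_pos], by linarith [h2.2]⟩
  have hsb : 0 < Real.sin (β u / 2) := Real.sin_pos_of_mem_Ioo ⟨by linarith [h2.1],
    by linarith [h2.2, Real.pi_pos]⟩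
  have hcos2 : Real.cos (p.α u) ^ 2 = (Real.tan (β u / 2) * d) ^ 2 * Real.sin (p.α u) ^ 2 := by
    have hσ2 : σ ^ 2 = 1 := by rcases hσ with rfl | rfl <;> norm_num
    rw [α_eq hp hab hσ hα hβ hu, Real.cos_pi_div_two_sub, Real.sin_pi_div_two_sub,
      Real.sin_arctan, Real.cos_arctan, div_pow, div_pow]
    rw [mul_pow, mul_pow, mul_pow, hσ2]
    ring
  have hpy := Real.sin_sq_add_cos_sq (p.α u)
  have hpb := Real.sin_sq_add_cos_sq (β u / 2)
  rw [hcos2, Real.tan_eq_sin_div_cos] at hpy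
  -- the two squares add up to one
  have hsum : (Real.sin (p.α u) * d * (Real.cos (β u / 2))⁻¹) ^ 2 +
      Real.sin (p.α u) ^ 2 * (1 - d ^ 2) = 1 := by
    field_simp at hpy ⊢
    linear_combination hpy - d ^ 2 * Real.sin (p.α u) ^ 2 * hpb
  have hd2 : 0 < 1 - d ^ 2 := by nlinarith
  have hpos : 0 < Real.sin (p.α u) ^ 2 * (1 - d ^ 2) := by positivity
  have hmem : Real.sin (p.α u) * d * (Real.cos (β u / 2))⁻¹ ∈ Set.Ioo (0 : ℝ) 1 := by
    have h0 : 0 < Real.sin (p.α u) * d * (Real.cos (β u / 2))⁻¹ := by positivity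
    exact ⟨h0, by nlinarith⟩
  obtain ⟨-, e1, e2, e3⟩ := _root_.creaseAngle_half hmem (α := p.α u) (β := β u) (by
    have hb : 1 - Real.cos (β u) = 2 * Real.sin (β u / 2) ^ 2 := by
      have := Real.cos_sq' (β u / 2)
      have h := Real.cos_sq (β u / 2)
      rw [mul_div_cancel₀ _ two_ne_zero] at h
      linarith
    rw [hb, hcos2, Real.tan_eq_sin_div_cos]
    field_simp
    norm_num)
  refine ⟨e1, ?_, e3⟩
  rw [e2, show 1 - (Real.sin (p.α u) * d * (Real.cos (β u / 2))⁻¹) ^ 2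
    = Real.sin (p.α u) ^ 2 * (1 - d ^ 2) by linarith, Real.sqrt_mul (by positivity),
    Real.sqrt_sq hs.le]

/-- The parametrization of a piece: the datum curve is shifted along its tangents and lifted. The
scale of the shift and the height depend on `t` only, so that each piece consists of plane curves
parallel to the plane of `Γ`. -/
lemma param_eq {u : ℝ} (hu : u ∈ Set.Icc a b) (t : ℝ) :
    p.param Γ a b β u t = spacePoint
      (planeC (Γ u) + (p.ratio a α₀ * (p.coordA a β t + p.coordB a β t) : ℝ) * shiftC Γ a b β u)
      (√(1 - p.ratio a α₀ ^ 2) * (p.coordA a β t - p.coordB a β t)) := by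
  obtain ⟨e1, e2, e3⟩ := creaseAngle_half hp hab hσ hα hβ hu
  have hs : Real.sin (p.α u) ≠ 0 := (Real.sin_pos_of_mem_Ioo (hp.α_mem u hu)).ne'
  set ξ := creaseAngle (p.α u) (β u) with hξ
  set v := shearRotation (creaseAngle (p.α a) (β a)) p.θ *ᵥ p.f t with hv
  have hv2 : v = ![v 0, v 1] := by ext k; fin_cases k <;> rfl
  have hg : p.targetCurve a β u t = (Real.sin (p.α a) / Real.sin (p.α u)) •
      (v 0 • polarDir p.θ + v 1 • polarDir (p.θ + ξ)) := by
    rw [targetCurve, rowMatrix_mulVec, ← hv, hv2, shearRotation_inv_mulVec e3.ne']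
    rfl
  obtain ⟨f1, f2⟩ := polarDir_frame (V := E3) (unitTangent Γ a b u) planeNormal p.θ ξ
  have hspace : p.spaceCurve Γ a b β u t =
      ((Real.sin (p.α u))⁻¹ * Real.cos (ξ / 2) * (p.coordA a β t + p.coordB a β t)) •
        unitTangent Γ a b u +
      ((Real.sin (p.α u))⁻¹ * Real.sin (ξ / 2) * (p.coordA a β t - p.coordB a β t)) •
        planeNormal := by
    have : p.spaceCurve Γ a b β u t = (Real.sin (p.α a) / Real.sin (p.α u)) •
        (v 0 • (Real.cos (ξ / 2) • unitTangent Γ a b u + Real.sin (ξ / 2) • planeNormal) +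
        v 1 • (Real.cos (ξ / 2) • unitTangent Γ a b u - Real.sin (ξ / 2) • planeNormal)) := by
      rw [← f1, ← f2, spaceCurve, hg, ← hξ]
      simp only [Pi.smul_apply, Pi.add_apply, smul_eq_mul]
      module
    rw [this, coordA, coordB, ← hv, div_eq_mul_inv]
    module
  rw [param, hspace, e1, e2, unitTangent_eq, planeNormal_eq, liftPlane_eq, smul_spacePoint,
    smul_spacePoint, spacePoint_add, spacePoint_add, spacePoint_inj, shiftC]
  constructor
  · push_cast
    have hs' : (Complex.sin (p.α u)) ≠ 0 := by
      rw [← Complex.ofReal_sin]; exact_mod_cast hs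
    field_simp
    ring
  · field_simp
    ring

end Admissible

end SurfacePiece

/-! ### The crease directions along the datum curve -/

/-- The direction in which a crease of the datum column leaves a point of the datum curve. -/
def creaseM (Γ : ℝ → EuclideanSpace ℝ (Fin 2)) (a b : ℝ) (β : ℝ → ℝ) (u : ℝ) : ℂ :=
  tangentC Γ a b u * (Real.sin (β u / 2) - Real.cos (β u / 2) * Complex.I)

/-- The direction in which a crease of the datum column arrives at a point of the datum curve. -/
def creaseP (Γ : ℝ → EuclideanSpace ℝ (Fin 2)) (a b : ℝ) (β : ℝ → ℝ) (u : ℝ) : ℂ :=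
  tangentC Γ a b u * (Real.sin (β u / 2) + Real.cos (β u / 2) * Complex.I)

lemma area_mul_of_norm_eq_one {T : ℂ} (hT : ‖T‖ = 1) (P Q : ℂ) :
    area (T * P) (T * Q) = area P Q := by
  have h := re_sq_add_im_sq hT
  simp only [area, Complex.mul_re, Complex.mul_im]
  linear_combination (P.re * Q.im - P.im * Q.re) * h

lemma norm_sin_add_cos_mul_I (x : ℝ) : ‖(Real.sin x + Real.cos x * Complex.I : ℂ)‖ = 1 := by
  rw [← pow_left_inj₀ (norm_nonneg _) zero_le_one two_ne_zero, ← Complex.normSq_eq_norm_sq,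
    Complex.normSq_add_mul_I, Real.sin_sq_add_cos_sq, one_pow]

lemma norm_sin_sub_cos_mul_I (x : ℝ) : ‖(Real.sin x - Real.cos x * Complex.I : ℂ)‖ = 1 := by
  have : (Real.sin x - Real.cos x * Complex.I : ℂ)
      = Real.sin x + (-Real.cos x : ℝ) * Complex.I := by push_cast; ring
  rw [this, ← pow_left_inj₀ (norm_nonneg _) zero_le_one two_ne_zero, ← Complex.normSq_eq_norm_sq,
    Complex.normSq_add_mul_I, neg_sq, Real.sin_sq_add_cos_sq, one_pow]

lemma area_sin_cos (x : ℝ) : area (Real.sin x - Real.cos x * Complex.I)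
    (Real.sin x + Real.cos x * Complex.I) = 2 * Real.sin x * Real.cos x := by
  simp only [area, Complex.add_re, Complex.sub_re, Complex.add_im, Complex.sub_im,
    Complex.ofReal_re, Complex.ofReal_im, Complex.re_ofReal_mul, Complex.im_ofReal_mul,
    Complex.I_re, Complex.I_im]
  ring

section datum

variable {Γ : ℝ → EuclideanSpace ℝ (Fin 2)} {a b : ℝ} {β : ℝ → ℝ}

lemma norm_tangentC {u : ℝ} (h : derivWithin Γ (Set.Icc a b) u ≠ 0) : ‖tangentC Γ a b u‖ = 1 := by
  rw [tangentC, norm_mul, Complex.norm_real, norm_planeC, norm_inv, norm_norm,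
    inv_mul_cancel₀ (norm_ne_zero_iff.2 h)]

lemma norm_creaseM {u : ℝ} (h : derivWithin Γ (Set.Icc a b) u ≠ 0) :
    ‖creaseM Γ a b β u‖ = 1 := by
  rw [creaseM, norm_mul, norm_tangentC h, norm_sin_sub_cos_mul_I, one_mul]

lemma norm_creaseP {u : ℝ} (h : derivWithin Γ (Set.Icc a b) u ≠ 0) :
    ‖creaseP Γ a b β u‖ = 1 := by
  rw [creaseP, norm_mul, norm_tangentC h, norm_sin_add_cos_mul_I, one_mul]

lemma area_crease {u : ℝ} (h : derivWithin Γ (Set.Icc a b) u ≠ 0) :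
    area (creaseM Γ a b β u) (creaseP Γ a b β u) =
      2 * Real.sin (β u / 2) * Real.cos (β u / 2) := by
  rw [creaseM, creaseP, area_mul_of_norm_eq_one (norm_tangentC h), area_sin_cos]

lemma half_angle_pos {x : ℝ} (h : x ∈ Set.Ioo 0 Real.pi) :
    0 < Real.sin (x / 2) ∧ 0 < Real.cos (x / 2) :=
  ⟨Real.sin_pos_of_mem_Ioo ⟨by linarith [h.1], by linarith [h.2, Real.pi_pos]⟩,
    Real.cos_pos_of_mem_Ioo ⟨by linarith [h.1, Real.pi_pos], by linarith [h.2]⟩⟩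

lemma halfCot_crease {u : ℝ} (h : derivWithin Γ (Set.Icc a b) u ≠ 0)
    (hβ : β u ∈ Set.Ioo 0 Real.pi) :
    halfCot (creaseM Γ a b β u) (creaseP Γ a b β u) = Real.tan (β u / 2) := by
  obtain ⟨hs, hc⟩ := half_angle_pos hβ
  have hT := re_sq_add_im_sq (norm_tangentC h)
  have hx := Real.sin_sq_add_cos_sq (β u / 2)
  rw [halfCot, area_crease h, Real.tan_eq_sin_div_cos, div_eq_div_iff (by positivity) hc.ne']
  simp only [creaseM, creaseP, Complex.mul_re, Complex.mul_im, Complex.add_re, Complex.sub_re,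
    Complex.add_im, Complex.sub_im, Complex.ofReal_re, Complex.ofReal_im, Complex.I_re,
    Complex.I_im]
  linear_combination (Real.cos (β u / 2) * (Real.sin (β u / 2) ^ 2 - Real.cos (β u / 2) ^ 2)) * hT
    - Real.cos (β u / 2) * hx

lemma shiftC_eq {u : ℝ} (h : derivWithin Γ (Set.Icc a b) u ≠ 0) (hβ : β u ∈ Set.Ioo 0 Real.pi) :
    shiftC Γ a b β u = creaseM Γ a b β u *
      (halfCot (creaseM Γ a b β u) (creaseP Γ a b β u) + Complex.I) := by
  obtain ⟨hs, hc⟩ := half_angle_pos hβ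
  rw [halfCot_crease h hβ, shiftC, creaseM, Real.tan_eq_sin_div_cos]
  have hc' : (Real.cos (β u / 2) : ℂ) ≠ 0 := by exact_mod_cast hc.ne'
  have hx : (Real.sin (β u / 2) : ℂ) ^ 2 + (Real.cos (β u / 2) : ℂ) ^ 2 = 1 := by
    exact_mod_cast Real.sin_sq_add_cos_sq (β u / 2)
  rw [Complex.ofReal_inv, Complex.ofReal_div]
  generalize (Real.cos (β u / 2) : ℂ) = c at *
  generalize (Real.sin (β u / 2) : ℂ) = s at *
  field_simp
  linear_combination (-tangentC Γ a b u) * hx + tangentC Γ a b u * c ^ 2 * Complex.I_sq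

variable (hab : a < b) (hΓ : ContDiffOn ℝ 2 Γ (Set.Icc a b))
  (hΓ' : ∀ u ∈ Set.Icc a b, derivWithin Γ (Set.Icc a b) u ≠ 0)
  (hβ : ContDiffOn ℝ 1 β (Set.Icc a b)) (hβ' : ∀ u ∈ Set.Icc a b, β u ∈ Set.Ioo 0 Real.pi)

lemma contDiff_planeC : ContDiff ℝ 1 planeC :=
  Complex.orthonormalBasisOneI.repr.symm.toContinuousLinearEquiv.contDiff

include hab hΓ hΓ' in
lemma contDiffOn_tangentC : ContDiffOn ℝ 1 (tangentC Γ a b) (Set.Icc a b) := by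
  have h1 : ContDiffOn ℝ 1 (derivWithin Γ (Set.Icc a b)) (Set.Icc a b) :=
    hΓ.derivWithin (uniqueDiffOn_Icc hab) (by norm_num)
  have h2 : ContDiffOn ℝ 1 (fun u => ‖derivWithin Γ (Set.Icc a b) u‖⁻¹) (Set.Icc a b) :=
    (h1.norm ℝ hΓ').inv fun u hu => norm_ne_zero_iff.2 (hΓ' u hu)
  exact (Complex.ofRealCLM.contDiff.comp_contDiffOn h2).mul (contDiff_planeC.comp_contDiffOn h1)

include hab hΓ hΓ' hβ hβ' in
lemma contDiffOn_shiftC : ContDiffOn ℝ 1 (shiftC Γ a b β) (Set.Icc a b) := by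
  have h2 : ContDiffOn ℝ 1 (fun u => (Real.cos (β u / 2))⁻¹) (Set.Icc a b) :=
    (Real.contDiff_cos.comp_contDiffOn (hβ.div_const 2)).inv
      fun u hu => (half_angle_pos (hβ' u hu)).2.ne'
  exact (Complex.ofRealCLM.contDiff.comp_contDiffOn h2).mul (contDiffOn_tangentC hab hΓ hΓ')

lemma hasDerivWithinAt_planeC (hΓ : ContDiffOn ℝ 2 Γ (Set.Icc a b)) {u : ℝ}
    (hu : u ∈ Set.Icc a b) :
    HasDerivWithinAt (fun u => planeC (Γ u)) (planeC (derivWithin Γ (Set.Icc a b) u))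
      (Set.Icc a b) u :=
  (Complex.orthonormalBasisOneI.repr.symm.toContinuousLinearEquiv.toContinuousLinearMap.hasFDerivAt
    |>.comp_hasDerivWithinAt u
      ((hΓ.differentiableOn (by norm_num)) u hu).hasDerivWithinAt)

lemma hasDerivWithinAt_spacePoint {c : ℝ → ℂ} {c' : ℂ} {s : Set ℝ} {u : ℝ}
    (h : HasDerivWithinAt c c' s u) (y : ℝ) :
    HasDerivWithinAt (fun u => spacePoint (c u) y) (spacePoint c' 0) s u := by
  have e : ∀ (z : ℂ) (y : ℝ), spacePoint z y = z.re • spacePoint 1 0 + z.im • spacePoint Complex.I 0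
      + y • spacePoint 0 1 := by
    intro z y
    ext k; fin_cases k <;> simp [spacePoint]
  have h1 := Complex.reCLM.hasFDerivAt.comp_hasDerivWithinAt u h
  have h2 := Complex.imCLM.hasFDerivAt.comp_hasDerivWithinAt u h
  have h3 := ((h1.smul_const (spacePoint 1 0)).add
    (h2.smul_const (spacePoint Complex.I 0))).add_const
    (y • spacePoint 0 1)
  rw [e c' 0, zero_smul, add_zero]
  exact h3.congr (fun v _ => e (c v) y) (e (c u) y)

/-- A plane vector whose angle with the tangent is less than that of the crease directions lies
between the latter. -/
lemma area_pos_of_angle_lt {T W : ℂ} (hT : ‖T‖ = 1) {x : ℝ} (hx : x ∈ Set.Ioo 0 Real.pi)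
    (h : InnerProductGeometry.angle (spacePoint W 0) (spacePoint T 0) < (Real.pi - x) / 2) :
    0 < area (T * (Real.sin (x / 2) - Real.cos (x / 2) * Complex.I)) W ∧
    0 < area W (T * (Real.sin (x / 2) + Real.cos (x / 2) * Complex.I)) := by
  obtain ⟨hs, hc⟩ := half_angle_pos hx
  have hTT := re_sq_add_im_sq hT
  have hT0 : T ≠ 0 := by rw [← norm_ne_zero_iff, hT]; exact one_ne_zero
  obtain ⟨V, rfl⟩ : ∃ V, W = T * V := ⟨W / T, by field_simp⟩
  rw [area_mul_of_norm_eq_one hT, area_mul_of_norm_eq_one hT]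
  have hcos := Real.cos_lt_cos_of_nonneg_of_le_pi (InnerProductGeometry.angle_nonneg _ _)
    (by linarith [hx.1, Real.pi_pos]) h
  rw [show (Real.pi - x) / 2 = Real.pi / 2 - x / 2 by ring, Real.cos_pi_div_two_sub] at hcos
  have hV : 0 < ‖V‖ := by
    rw [norm_pos_iff]
    rintro rfl
    have e : spacePoint (T * 0) 0 = 0 := by ext k; fin_cases k <;> simp [spacePoint]
    rw [e, InnerProductGeometry.angle_zero_left] at h
    linarith [hx.1]
  have hin := InnerProductGeometry.cos_angle_mul_norm_mul_norm (spacePoint (T * V) 0)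
    (spacePoint T 0)
  rw [inner_spacePoint, norm_spacePoint_zero, norm_spacePoint_zero, norm_mul, hT, one_mul, mul_one,
    Complex.mul_re, Complex.mul_im] at hin
  have hre : Real.cos (InnerProductGeometry.angle (spacePoint (T * V) 0) (spacePoint T 0)) * ‖V‖
      = V.re := by
    rw [hin]; linear_combination V.re * hTT
  have hlt : Real.sin (x / 2) * ‖V‖ < V.re := by
    rw [← hre]; exact mul_lt_mul_of_pos_right hcos hV
  have hVV : ‖V‖ ^ 2 = V.re ^ 2 + V.im ^ 2 := by
    rw [← Complex.normSq_eq_norm_sq, Complex.normSq_apply]; ring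
  have hre0 : 0 < V.re := lt_trans (by positivity) hlt
  have hsq : Real.sin (x / 2) ^ 2 * (V.re ^ 2 + V.im ^ 2) < V.re ^ 2 := by
    rw [← hVV, ← mul_pow]
    exact pow_lt_pow_left₀ hlt (by positivity) two_ne_zero
  have hpy := Real.sin_sq_add_cos_sq (x / 2)
  have habs : |Real.sin (x / 2) * V.im| < Real.cos (x / 2) * V.re := by
    apply abs_lt_of_sq_lt_sq _ (by positivity)
    rw [mul_pow, mul_pow]
    nlinarith
  have := abs_lt.1 habs
  simp only [area, Complex.add_re, Complex.sub_re, Complex.add_im, Complex.sub_im,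
    Complex.ofReal_re, Complex.ofReal_im, Complex.re_ofReal_mul, Complex.im_ofReal_mul,
    Complex.I_re, Complex.I_im]
  constructor <;> nlinarith

end datum

/-! ### Column curves that run between the crease directions -/

section datum

variable {Γ : ℝ → EuclideanSpace ℝ (Fin 2)} {a b : ℝ} {β : ℝ → ℝ}

/-- The curve `γ + X g` runs between the crease directions of the datum column. -/
def InCone (Γ : ℝ → EuclideanSpace ℝ (Fin 2)) (a b : ℝ) (β : ℝ → ℝ) (X : ℝ) : Prop :=
  ∀ u ∈ Set.Icc a b,
    0 < area (creaseM Γ a b β u) (planeC (derivWithin Γ (Set.Icc a b) u)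
      + X * derivWithin (shiftC Γ a b β) (Set.Icc a b) u) ∧
    0 < area (planeC (derivWithin Γ (Set.Icc a b) u)
      + X * derivWithin (shiftC Γ a b β) (Set.Icc a b) u) (creaseP Γ a b β u)

variable (hab : a < b) (hΓ : ContDiffOn ℝ 2 Γ (Set.Icc a b))
  (hΓ' : ∀ u ∈ Set.Icc a b, derivWithin Γ (Set.Icc a b) u ≠ 0)
  (hβ : ContDiffOn ℝ 1 β (Set.Icc a b)) (hβ' : ∀ u ∈ Set.Icc a b, β u ∈ Set.Ioo 0 Real.pi)
include hab hΓ hΓ' hβ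

lemma continuousOn_creaseM : ContinuousOn (creaseM Γ a b β) (Set.Icc a b) := by
  have h1 := (contDiffOn_tangentC hab hΓ hΓ').continuousOn
  have h2 := hβ.continuousOn
  unfold creaseM
  fun_prop

lemma continuousOn_creaseP : ContinuousOn (creaseP Γ a b β) (Set.Icc a b) := by
  have h1 := (contDiffOn_tangentC hab hΓ hΓ').continuousOn
  have h2 := hβ.continuousOn
  unfold creaseP
  fun_prop

omit hΓ' hβ in
lemma continuousOn_planeC_deriv :
    ContinuousOn (fun u => planeC (derivWithin Γ (Set.Icc a b) u)) (Set.Icc a b) :=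
  contDiff_planeC.continuous.comp_continuousOn
    (hΓ.continuousOn_derivWithin (uniqueDiffOn_Icc hab) (by norm_num))

include hβ'

lemma continuousOn_shiftC_deriv :
    ContinuousOn (derivWithin (shiftC Γ a b β) (Set.Icc a b)) (Set.Icc a b) :=
  (contDiffOn_shiftC hab hΓ hΓ' hβ hβ').continuousOn_derivWithin (uniqueDiffOn_Icc hab) le_rfl

lemma hasDerivWithinAt_shiftC {u : ℝ} (hu : u ∈ Set.Icc a b) :
    HasDerivWithinAt (shiftC Γ a b β) (derivWithin (shiftC Γ a b β) (Set.Icc a b) u)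
      (Set.Icc a b) u :=
  ((contDiffOn_shiftC hab hΓ hΓ' hβ hβ').differentiableOn (by norm_num) u hu).hasDerivWithinAt

/-- The condition that the column curves run between the crease directions is open. -/
lemma InCone.exists_margin {X₀ : ℝ} (h : InCone Γ a b β X₀) :
    ∃ μ > 0, ∀ X, |X - X₀| ≤ μ → InCone Γ a b β X := by
  have hm := continuousOn_creaseM hab hΓ hΓ' hβ
  have hp := continuousOn_creaseP hab hΓ hΓ' hβ
  have hg := continuousOn_shiftC_deriv hab hΓ hΓ' hβ hβ'
  have hc : ContinuousOn (fun u => planeC (derivWithin Γ (Set.Icc a b) u)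
      + X₀ * derivWithin (shiftC Γ a b β) (Set.Icc a b) u) (Set.Icc a b) :=
    (continuousOn_planeC_deriv hab hΓ).add (continuousOn_const.mul hg)
  have hne : (Set.Icc a b).Nonempty := ⟨a, le_rfl, hab.le⟩
  obtain ⟨u₁, hu₁, h1⟩ := isCompact_Icc.exists_isMinOn hne
    (continuous_area.comp_continuousOn (hm.prodMk hc))
  obtain ⟨u₂, hu₂, h2⟩ := isCompact_Icc.exists_isMinOn hne
    (continuous_area.comp_continuousOn (hc.prodMk hp))
  obtain ⟨u₃, hu₃, h3⟩ := isCompact_Icc.exists_isMaxOn hne hg.norm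
  set c₁ := area (creaseM Γ a b β u₁) (planeC (derivWithin Γ (Set.Icc a b) u₁)
      + X₀ * derivWithin (shiftC Γ a b β) (Set.Icc a b) u₁)
  set c₂ := area (planeC (derivWithin Γ (Set.Icc a b) u₂)
      + X₀ * derivWithin (shiftC Γ a b β) (Set.Icc a b) u₂) (creaseP Γ a b β u₂)
  set G := ‖derivWithin (shiftC Γ a b β) (Set.Icc a b) u₃‖
  have hc₁ : 0 < c₁ := (h u₁ hu₁).1
  have hc₂ : 0 < c₂ := (h u₂ hu₂).2
  have hG : 0 ≤ G := norm_nonneg _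
  refine ⟨min c₁ c₂ / (2 * (G + 1)), by positivity, fun X hX u hu => ?_⟩
  have l1 : c₁ ≤ area (creaseM Γ a b β u) (planeC (derivWithin Γ (Set.Icc a b) u)
      + X₀ * derivWithin (shiftC Γ a b β) (Set.Icc a b) u) := h1 hu
  have l2 : c₂ ≤ area (planeC (derivWithin Γ (Set.Icc a b) u)
      + X₀ * derivWithin (shiftC Γ a b β) (Set.Icc a b) u) (creaseP Γ a b β u) := h2 hu
  have l3 : ‖derivWithin (shiftC Γ a b β) (Set.Icc a b) u‖ ≤ G := h3 hu
  have e : planeC (derivWithin Γ (Set.Icc a b) u)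
      + X * derivWithin (shiftC Γ a b β) (Set.Icc a b) u
      = (planeC (derivWithin Γ (Set.Icc a b) u)
      + X₀ * derivWithin (shiftC Γ a b β) (Set.Icc a b) u)
      + (X - X₀ : ℝ) * derivWithin (shiftC Γ a b β) (Set.Icc a b) u := by push_cast; ring
  have small : |X - X₀| * ‖derivWithin (shiftC Γ a b β) (Set.Icc a b) u‖ ≤ min c₁ c₂ / 2 := by
    calc _ ≤ min c₁ c₂ / (2 * (G + 1)) * (G + 1) := by gcongr; linarith
      _ = min c₁ c₂ / 2 := by field_simp
  have s1 := abs_area_le (creaseM Γ a b β u) (derivWithin (shiftC Γ a b β) (Set.Icc a b) u)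
  have s2 := abs_area_le (derivWithin (shiftC Γ a b β) (Set.Icc a b) u) (creaseP Γ a b β u)
  rw [norm_creaseM (hΓ' u hu), one_mul] at s1
  rw [norm_creaseP (hΓ' u hu), mul_one] at s2
  have m1 := min_le_left c₁ c₂
  have m2 := min_le_right c₁ c₂
  rw [e, area_add_right, area_add_left, area_mul_left, area_mul_right]
  constructor
  · have := (abs_le.1 ((abs_mul _ _).le.trans
      ((mul_le_mul_of_nonneg_left s1 (abs_nonneg (X - X₀))).trans small))).1
    linarith
  · have := (abs_le.1 ((abs_mul _ _).le.trans
      ((mul_le_mul_of_nonneg_left s2 (abs_nonneg (X - X₀))).trans small))).1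
    linarith

/-- The data of the datum column for the rows of the paper. -/
def SpineData.ofDatum (Xlo Xhi : ℝ) (hlo : InCone Γ a b β Xlo) (hhi : InCone Γ a b β Xhi) :
    SpineData where
  a := a
  b := b
  γ u := planeC (Γ u)
  γ' u := planeC (derivWithin Γ (Set.Icc a b) u)
  g := shiftC Γ a b β
  g' := derivWithin (shiftC Γ a b β) (Set.Icc a b)
  Dm := creaseM Γ a b β
  Dp := creaseP Γ a b β
  Xlo := Xlo
  Xhi := Xhi
  lt := hab
  hasDeriv _ hu := hasDerivWithinAt_planeC hΓ hu
  hasDeriv_g _ hu := hasDerivWithinAt_shiftC hab hΓ hΓ' hβ hβ' hu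
  cont := continuousOn_planeC_deriv hab hΓ
  cont_g := continuousOn_shiftC_deriv hab hΓ hΓ' hβ hβ'
  contm := continuousOn_creaseM hab hΓ hΓ' hβ
  contp := continuousOn_creaseP hab hΓ hΓ' hβ
  normm u hu := norm_creaseM (hΓ' u hu)
  normp u hu := norm_creaseP (hΓ' u hu)
  area_pos u hu := by
    rw [area_crease (hΓ' u hu)]
    obtain ⟨h1, h2⟩ := half_angle_pos (hβ' u hu)
    positivity
  g_eq u hu := shiftC_eq (hΓ' u hu) (hβ' u hu)
  cone X hX := by
    rcases hX with rfl | rfl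
    · exact hlo
    · exact hhi

variable {p : SurfacePiece} {σ : ℝ} {α₀ : ℝ → ℝ}

/-- The condition that creases of different rows do not cross, in the coordinates of the profile. -/
lemma SurfacePiece.Admissible.inCone (hp : p.Admissible Γ a b α₀ β) (hσ : σ = 1 ∨ σ = -1)
    (hα : ∀ u ∈ Set.Icc a b, α₀ u = Real.pi / 2 - σ * (β u / 2)) {t : ℝ}
    (ht : t ∈ Set.Icc p.lo p.hi) :
    InCone Γ a b β (p.ratio a α₀ * (p.coordA a β t + p.coordB a β t)) := by
  intro u hu
  have hd : HasDerivWithinAt (fun v => p.param Γ a b β v t) (spacePoint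
      (planeC (derivWithin Γ (Set.Icc a b) u)
        + (p.ratio a α₀ * (p.coordA a β t + p.coordB a β t) : ℝ)
          * derivWithin (shiftC Γ a b β) (Set.Icc a b) u) 0) (Set.Icc a b) u := by
    refine (hasDerivWithinAt_spacePoint ((hasDerivWithinAt_planeC hΓ hu).add
      ((hasDerivWithinAt_shiftC hab hΓ hΓ' hβ hβ' hu).const_mul _)) _).congr
      (fun v hv => hp.param_eq hab.le hσ hα hβ' hv t) (hp.param_eq hab.le hσ hα hβ' hu t)
  have hn := hp.noncrossing u hu t ht
  rw [hd.derivWithin (uniqueDiffOn_Icc hab u hu), unitTangent_eq] at hn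
  exact area_pos_of_angle_lt (norm_tangentC (hΓ' u hu)) (hβ' u hu) hn

end datum

/-! ### Reduction to finitely many pieces -/

/-- Finitely many of the pieces of a bounded profile approximate all of them. -/
lemma exists_finite_pieces {x y : ℕ → ℝ → ℝ} {I : ℕ → Set ℝ} {K : ℕ∞} (hK : 0 < K) {R : ℝ}
    (hR : ∀ k : ℕ, (k : ℕ∞) < K → ∀ t ∈ I k, |x k t| ≤ R ∧ |y k t| ≤ R) {ε : ℝ} (hε : 0 < ε) :
    ∃ N : ℕ, 0 < N ∧ (∀ k < N, (k : ℕ∞) < K) ∧ ∀ k : ℕ, (k : ℕ∞) < K → ∀ t ∈ I k,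
      ∃ k' < N, ∃ t' ∈ I k', |x k' t' - x k t| ≤ ε ∧ |y k' t' - y k t| ≤ ε := by
  set P : Set (ℝ × ℝ) := {q | ∃ k : ℕ, (k : ℕ∞) < K ∧ ∃ t ∈ I k, q = (x k t, y k t)} with hP
  have hb : TotallyBounded P := by
    refine (isCompact_closedBall (0 : ℝ × ℝ) R).totallyBounded.subset ?_
    rintro q ⟨k, hk, t, ht, rfl⟩
    rw [mem_closedBall_zero_iff, Prod.norm_def]
    exact max_le (hR k hk t ht).1 (hR k hk t ht).2
  obtain ⟨Q, hQP, hQ, hcov⟩ := Metric.finite_approx_of_totallyBounded hb ε hε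
  have key : ∃ N : ℕ, 0 < N ∧ (∀ k < N, (k : ℕ∞) < K) ∧
      ∀ q ∈ Q, ∃ k' < N, ∃ t' ∈ I k', q = (x k' t', y k' t') := by
    clear hcov
    induction Q, hQ using Set.Finite.induction_on with
    | empty => exact ⟨1, one_pos, fun k hk => by obtain rfl : k = 0 := by omega
                                                 simpa using hK, by simp⟩
    | insert _ _ ih =>
      rename_i q Q _ _
      obtain ⟨N, h0, h1, h2⟩ := ih fun z hz => hQP (Set.mem_insert_of_mem _ hz)
      obtain ⟨k, hk, t, ht, e⟩ := hQP (Set.mem_insert q Q)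
      refine ⟨max N (k + 1), lt_max_of_lt_left h0, fun j hj => ?_, fun z hz => ?_⟩
      · rcases lt_max_iff.1 hj with h | h
        · exact h1 j h
        · exact lt_of_le_of_lt (by exact_mod_cast Nat.lt_succ_iff.1 h) hk
      · rcases hz with rfl | hz
        · exact ⟨k, lt_max_of_lt_right (Nat.lt_succ_self k), t, ht, e⟩
        · obtain ⟨k', hk', r⟩ := h2 z hz
          exact ⟨k', lt_max_of_lt_left hk', r⟩
  obtain ⟨N, h0, h1, h2⟩ := key
  refine ⟨N, h0, h1, fun k hk t ht => ?_⟩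
  obtain ⟨q, hq, hd⟩ := Set.mem_iUnion₂.1 (hcov ⟨k, hk, t, ht, rfl⟩)
  obtain ⟨k', hk', t', ht', rfl⟩ := h2 q hq
  rw [Metric.mem_ball, dist_comm, Prod.dist_eq, Real.dist_eq, Real.dist_eq, max_lt_iff] at hd
  exact ⟨k', hk', t', ht', hd.1.le, hd.2.le⟩

namespace ProfileData

variable (c : ProfileData)

lemma continuousOn_x {k : ℕ} (hk : k < c.num) : ContinuousOn (c.x k) (Set.Icc (c.lo k) (c.hi k)) :=
  continuousOn_const.mul ((c.contA k hk).add (c.contB k hk))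

lemma exists_min_x : ∃ k₀ < c.num, ∃ t₀ ∈ Set.Icc (c.lo k₀) (c.hi k₀),
    ∀ k < c.num, ∀ t ∈ Set.Icc (c.lo k) (c.hi k), c.x k₀ t₀ ≤ c.x k t := by
  have h : ∀ k, ∃ t₀, k < c.num → t₀ ∈ Set.Icc (c.lo k) (c.hi k) ∧
      ∀ t ∈ Set.Icc (c.lo k) (c.hi k), c.x k t₀ ≤ c.x k t := by
    intro k
    by_cases hk : k < c.num
    · obtain ⟨t₀, h0, h1⟩ := isCompact_Icc.exists_isMinOn (Set.nonempty_Icc.2 (c.le k hk))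
        (c.continuousOn_x hk)
      exact ⟨t₀, fun _ => ⟨h0, fun t ht => h1 ht⟩⟩
    · exact ⟨0, fun h => absurd h hk⟩
  choose τ hτ using h
  obtain ⟨k₀, hk₀, hmin⟩ := (Finset.range c.num).exists_min_image (fun k => c.x k (τ k))
    ⟨0, Finset.mem_range.2 c.num_pos⟩
  rw [Finset.mem_range] at hk₀
  exact ⟨k₀, hk₀, τ k₀, (hτ k₀ hk₀).1, fun k hk t ht =>
    (hmin k (Finset.mem_range.2 hk)).trans ((hτ k hk).2 t ht)⟩

lemma exists_max_x : ∃ k₀ < c.num, ∃ t₀ ∈ Set.Icc (c.lo k₀) (c.hi k₀),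
    ∀ k < c.num, ∀ t ∈ Set.Icc (c.lo k) (c.hi k), c.x k t ≤ c.x k₀ t₀ := by
  have h : ∀ k, ∃ t₀, k < c.num → t₀ ∈ Set.Icc (c.lo k) (c.hi k) ∧
      ∀ t ∈ Set.Icc (c.lo k) (c.hi k), c.x k t ≤ c.x k t₀ := by
    intro k
    by_cases hk : k < c.num
    · obtain ⟨t₀, h0, h1⟩ := isCompact_Icc.exists_isMaxOn (Set.nonempty_Icc.2 (c.le k hk))
        (c.continuousOn_x hk)
      exact ⟨t₀, fun _ => ⟨h0, fun t ht => h1 ht⟩⟩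
    · exact ⟨0, fun h => absurd h hk⟩
  choose τ hτ using h
  obtain ⟨k₀, hk₀, hmax⟩ := (Finset.range c.num).exists_max_image (fun k => c.x k (τ k))
    ⟨0, Finset.mem_range.2 c.num_pos⟩
  rw [Finset.mem_range] at hk₀
  exact ⟨k₀, hk₀, τ k₀, (hτ k₀ hk₀).1, fun k hk t ht =>
    ((hτ k hk).2 t ht).trans (hmax k (Finset.mem_range.2 hk))⟩

end ProfileData

/-! ### The profile of the stitched surface -/

section profile

variable {Γ : ℝ → EuclideanSpace ℝ (Fin 2)} {a b σ : ℝ} {α₀ β : ℝ → ℝ} {K : ℕ∞}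
  {p : ℕ → SurfacePiece}

namespace SurfacePiece

/-- The shift of the column through a point of the profile. -/
def profileX (p : SurfacePiece) (a : ℝ) (α₀ β : ℝ → ℝ) (t : ℝ) : ℝ :=
  p.ratio a α₀ * (p.coordA a β t + p.coordB a β t)

/-- The height of a point of the profile. -/
def profileZ (p : SurfacePiece) (a : ℝ) (α₀ β : ℝ → ℝ) (t : ℝ) : ℝ :=
  √(1 - p.ratio a α₀ ^ 2) * (p.coordA a β t - p.coordB a β t)

end SurfacePiece

variable (hab : a < b) (hσ : σ = 1 ∨ σ = -1)
  (hα : ∀ u ∈ Set.Icc a b, α₀ u = Real.pi / 2 - σ * (β u / 2))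
  (hΓ' : ∀ u ∈ Set.Icc a b, derivWithin Γ (Set.Icc a b) u ≠ 0)
  (hβ' : ∀ u ∈ Set.Icc a b, β u ∈ Set.Ioo 0 Real.pi)
  (hp : ∀ k : ℕ, (k : ℕ∞) < K → (p k).Admissible Γ a b α₀ β)

include hab hσ hα hβ' in
lemma param_eq_spacePoint {q : SurfacePiece} (hq : q.Admissible Γ a b α₀ β) {u : ℝ}
    (hu : u ∈ Set.Icc a b) (t : ℝ) :
    q.param Γ a b β u t = spacePoint (planeC (Γ u) + q.profileX a α₀ β t * shiftC Γ a b β u)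
      (q.profileZ a α₀ β t) :=
  hq.param_eq hab.le hσ hα hβ' hu t

include hΓ' hβ' in
lemma one_le_norm_shiftC {u : ℝ} (hu : u ∈ Set.Icc a b) : 1 ≤ ‖shiftC Γ a b β u‖ := by
  have hc := (half_angle_pos (hβ' u hu)).2
  rw [shiftC, norm_mul, norm_tangentC (hΓ' u hu), mul_one, Complex.norm_real,
    Real.norm_of_nonneg (by positivity)]
  exact one_le_inv₀ hc |>.2 (Real.cos_le_one _)

include hab hσ hα hΓ' hβ' hp

/-- The profile of a bounded surface is bounded. -/
lemma exists_profile_bound (hS : Bornology.IsBounded (stitchedSurface K p Γ a b β)) :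
    ∃ R, ∀ k : ℕ, (k : ℕ∞) < K → ∀ t ∈ Set.Icc (p k).lo (p k).hi,
      |(p k).profileX a α₀ β t| ≤ R ∧ |(p k).profileZ a α₀ β t| ≤ R := by
  obtain ⟨C, hC⟩ := hS.exists_norm_le
  have ha : a ∈ Set.Icc a b := ⟨le_rfl, hab.le⟩
  refine ⟨C + ‖planeC (Γ a)‖, fun k hk t ht => ?_⟩
  have h := hC ((p k).param Γ a b β a t)
    (Set.mem_iUnion₂.2 ⟨a, ha, k, hk, t, ht, rfl⟩)
  rw [param_eq_spacePoint hab hσ hα hβ' (hp k hk) ha] at h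
  have h2 := norm_spacePoint_sq (planeC (Γ a) + (p k).profileX a α₀ β t * shiftC Γ a b β a)
    ((p k).profileZ a α₀ β t)
  have hC0 : 0 ≤ C := (norm_nonneg _).trans h
  have h3 : ‖planeC (Γ a) + (p k).profileX a α₀ β t * shiftC Γ a b β a‖ ≤ C := by
    apply le_trans _ h
    apply le_of_sq_le_sq _ (norm_nonneg _)
    rw [h2]; nlinarith [sq_nonneg ((p k).profileZ a α₀ β t)]
  have h4 : |(p k).profileZ a α₀ β t| ≤ C := by
    apply le_trans _ h
    apply abs_le_of_sq_le_sq _ (norm_nonneg _)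
    rw [h2]; nlinarith [sq_nonneg ‖planeC (Γ a) + (p k).profileX a α₀ β t * shiftC Γ a b β a‖]
  refine ⟨?_, h4.trans (le_add_of_nonneg_right (norm_nonneg _))⟩
  have h5 := norm_sub_le (planeC (Γ a) + (p k).profileX a α₀ β t * shiftC Γ a b β a) (planeC (Γ a))
  rw [add_sub_cancel_left, norm_mul, Complex.norm_real, Real.norm_eq_abs] at h5
  have h6 := one_le_norm_shiftC hΓ' hβ' ha
  nlinarith [abs_nonneg ((p k).profileX a α₀ β t)]

/-- The profile of finitely many pieces in crease coordinates. For the second choice of `α₀` the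
profile is reflected, so that the first coordinate is the increasing one in either case. -/
lemma exists_profile {N : ℕ} (hN : 0 < N) (hNK : ∀ k < N, (k : ℕ∞) < K)
    (h0 : (p 0).f (p 0).lo = 0)
    (hst : ∀ k : ℕ, ((k + 1 : ℕ) : ℕ∞) < K → ∀ u ∈ Set.Icc a b,
      (p (k + 1)).param Γ a b β u (p (k + 1)).lo = (p k).param Γ a b β u (p k).hi) :
    ∃ c : ProfileData, c.num = N ∧ (∀ k, c.lo k = (p k).lo ∧ c.hi k = (p k).hi) ∧
      (∀ k, c.d k = (p k).ratio a α₀ ∧ c.e k = √(1 - (p k).ratio a α₀ ^ 2)) ∧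
      ∀ k t, c.x k t = -σ * (p k).profileX a α₀ β t ∧ c.y k t = (p k).profileZ a α₀ β t := by
  have ha : a ∈ Set.Icc a b := ⟨le_rfl, hab.le⟩
  have hs : ∀ k < N, 0 < Real.sin ((p k).α a) := fun k hk =>
    Real.sin_pos_of_mem_Ioo ((hp k (hNK k hk)).α_mem a ha)
  have hd : ∀ k < N, (p k).ratio a α₀ ∈ Set.Ioo (0 : ℝ) 1 := fun k hk =>
    (hp k (hNK k hk)).ratio_mem hab.le hσ hα hβ'
  have hd' : ∀ k < N, (p k).ratio a α₀ ∈ Set.Icc (0 : ℝ) 1 := fun k hk =>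
    ⟨(hd k hk).1.le, (hd k hk).2.le⟩
  have he : ∀ k < N, √(1 - (p k).ratio a α₀ ^ 2) ∈ Set.Icc (0 : ℝ) 1 := fun k hk =>
    ⟨Real.sqrt_nonneg _, Real.sqrt_le_one.2 (by nlinarith [sq_nonneg ((p k).ratio a α₀)])⟩
  have hcont : ∀ k < N, ∀ i : Fin 2, ContinuousOn
      (fun t => (shearRotation (creaseAngle ((p k).α a) (β a)) (p k).θ *ᵥ (p k).f t) i)
      (Set.Icc (p k).lo (p k).hi) := by
    intro k hk i
    exact ((Continuous.matrix_mulVec continuous_const continuous_id).comp_continuousOn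
      (hp k (hNK k hk)).continuousOn |> continuousOn_pi.1) i
  have cA : ∀ k < N, ContinuousOn ((p k).coordA a β) (Set.Icc (p k).lo (p k).hi) :=
    fun k hk => continuousOn_const.mul (hcont k hk 0)
  have cB : ∀ k < N, ContinuousOn ((p k).coordB a β) (Set.Icc (p k).lo (p k).hi) :=
    fun k hk => continuousOn_const.mul (hcont k hk 1)
  have mA : ∀ k < N, MonotoneOn ((p k).coordA a β) (Set.Icc (p k).lo (p k).hi) :=
    fun k hk s hs' t ht hst => mul_le_mul_of_nonneg_left
      ((hp k (hNK k hk)).monotoneOn hs' ht hst) (hs k hk).le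
  have mB : ∀ k < N, AntitoneOn ((p k).coordB a β) (Set.Icc (p k).lo (p k).hi) :=
    fun k hk s hs' t ht hst => mul_le_mul_of_nonneg_left
      ((hp k (hNK k hk)).antitoneOn hs' ht hst) (hs k hk).le
  have zA : (p 0).coordA a β (p 0).lo = 0 := by simp [SurfacePiece.coordA, h0]
  have zB : (p 0).coordB a β (p 0).lo = 0 := by simp [SurfacePiece.coordB, h0]
  have stitch : ∀ k, k + 1 < N →
      (p (k + 1)).profileX a α₀ β (p (k + 1)).lo = (p k).profileX a α₀ β (p k).hi ∧
      (p (k + 1)).profileZ a α₀ β (p (k + 1)).lo = (p k).profileZ a α₀ β (p k).hi := by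
    intro k hk
    have h := hst k (hNK (k + 1) hk) a ha
    rw [param_eq_spacePoint hab hσ hα hβ' (hp _ (hNK (k + 1) hk)) ha,
      param_eq_spacePoint hab hσ hα hβ' (hp _ (hNK k (by omega))) ha, spacePoint_inj] at h
    have hg : shiftC Γ a b β a ≠ 0 := by
      rw [← norm_pos_iff]; exact one_pos.trans_le (one_le_norm_shiftC hΓ' hβ' ha)
    refine ⟨?_, h.2⟩
    exact_mod_cast mul_right_cancel₀ hg (add_left_cancel h.1)
  rcases hσ with rfl | rfl
  · refine ⟨{ num := N
              lo := fun k => (p k).lo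
              hi := fun k => (p k).hi
              A := fun k t => -(p k).coordB a β t
              B := fun k t => -(p k).coordA a β t
              d := fun k => (p k).ratio a α₀
              e := fun k => √(1 - (p k).ratio a α₀ ^ 2)
              num_pos := hN
              le := fun k hk => (hp k (hNK k hk)).le
              contA := fun k hk => (cB k hk).neg
              contB := fun k hk => (cA k hk).neg
              monoA := fun k hk => (mB k hk).neg
              antiB := fun k hk => (mA k hk).neg
              d_mem := hd'
              e_mem := he
              start_x := by simp [zA, zB]
              start_y := by simp [zA, zB]
              stitch_x := ?_
              stitch_y := ?_ }, rfl, fun k => ⟨rfl, rfl⟩, fun k => ⟨rfl, rfl⟩, ?_⟩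
    · intro k hk
      have := (stitch k hk).1
      simp only [SurfacePiece.profileX] at this
      linear_combination -this
    · intro k hk
      have := (stitch k hk).2
      simp only [SurfacePiece.profileZ] at this
      linear_combination this
    · intro k t
      simp only [ProfileData.x, ProfileData.y, SurfacePiece.profileX, SurfacePiece.profileZ]
      constructor <;> ring
  · refine ⟨{ num := N
              lo := fun k => (p k).lo
              hi := fun k => (p k).hi
              A := fun k t => (p k).coordA a β t
              B := fun k t => (p k).coordB a β t
              d := fun k => (p k).ratio a α₀
              e := fun k => √(1 - (p k).ratio a α₀ ^ 2)
              num_pos := hN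
              le := fun k hk => (hp k (hNK k hk)).le
              contA := cA
              contB := cB
              monoA := mA
              antiB := mB
              d_mem := hd'
              e_mem := he
              start_x := by simp [zA, zB]
              start_y := by simp [zA, zB]
              stitch_x := fun k hk => (stitch k hk).1
              stitch_y := fun k hk => (stitch k hk).2 },
      rfl, fun k => ⟨rfl, rfl⟩, fun k => ⟨rfl, rfl⟩, ?_⟩
    intro k t
    refine ⟨?_, rfl⟩
    rw [neg_neg, one_mul]
    rfl

end profile

/-! ### The paper of a fine mesh -/

/-- Rows and columns, fine at the scale `δ`, for the datum curve `s` and the profile `c`: the rows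
come from a subdivision into `M` parts, the columns from a zigzag with `m` steps of the widths
`w`. -/
structure Mesh where
  s : SpineData
  c : ProfileData
  σ : ℝ
  δ : ℝ
  M : ℕ
  m : ℕ
  w : ℕ → ℝ
  piece : ℕ → ℕ
  σ_sq : σ ^ 2 = 1
  δ_pos : 0 < δ
  M_pos : 0 < M
  areaPos : s.AreaPos M
  length_pos : ∀ i ≤ 2 * M + 1, ∀ X ∈ Set.Icc s.Xlo s.Xhi,
    0 < s.lenSeq M δ i + X * (s.cotSeq M (i + 1) - s.cotSeq M i)
  vertex_near : ∀ i ≤ 2 * M + 2, ‖s.vertexSeq M δ i - s.γ (s.node M ((i - 1) / 2))‖ ≤ δ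
  cot_near : ∀ i, |s.cotSeq M i - halfCot (s.Dm (s.node M ((i - 1) / 2)))
    (s.Dp (s.node M ((i - 1) / 2)))| ≤ δ
  step_near : ∀ q, ‖s.γ (s.node M (q + 1)) - s.γ (s.node M q)‖ ≤ δ ∧
    ‖s.g (s.node M (q + 1)) - s.g (s.node M q)‖ ≤ δ
  dense : ∀ v ∈ Set.Icc s.a s.b, ∃ q ≤ M,
    ‖s.γ v - s.γ (s.node M q)‖ ≤ δ ∧ ‖s.g v - s.g (s.node M q)‖ ≤ δ
  one_le : 1 ≤ m
  w_pos : ∀ j, 0 < w j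
  piece_lt : ∀ j ∈ Set.Icc 1 m, piece j < c.num ∧ w j ≤ δ
  zigzag : ∀ S Z : ℕ → ℝ, S 1 = 0 → Z 1 = 0 →
    (∀ j, 1 ≤ j → j ≤ m → S (j + 1) = S j + colSign j * w j * c.d (piece j)) →
    (∀ j, 1 ≤ j → j ≤ m → Z (j + 1) = Z j + w j * c.e (piece j)) →
    (∀ j ∈ Set.Icc 1 (m + 1), ∃ k < c.num, ∃ t ∈ Set.Icc (c.lo k) (c.hi k),
      |S j - c.x k t| ≤ δ ∧ |Z j - c.y k t| ≤ δ) ∧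
    (∀ k < c.num, ∀ t ∈ Set.Icc (c.lo k) (c.hi k), ∃ j ∈ Set.Icc 1 (m + 1),
      |S j - c.x k t| ≤ δ ∧ |Z j - c.y k t| ≤ δ)
  d_mem : ∀ k < c.num, c.d k ∈ Set.Ioo (0 : ℝ) 1
  e_eq : ∀ k, c.e k = √(1 - c.d k ^ 2)
  range : ∀ k < c.num, ∀ t ∈ Set.Icc (c.lo k) (c.hi k), ∀ x : ℝ, |x - c.x k t| ≤ δ →
    -σ * x ∈ Set.Icc s.Xlo s.Xhi

namespace Mesh

variable (h : Mesh)

/-- The widths of the panel columns, including the leftmost one. -/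
def width (j : ℕ) : ℝ := if j = 0 then h.δ else h.w j

/-- The ratios of the cotangents of the sector angles. -/
def ratioSeq (j : ℕ) : ℝ := if j = 0 then 1 else if j ≤ h.m then h.c.d (h.piece j) else 1 / 2

lemma ratioSeq_eq {j : ℕ} (hj : j ∈ Set.Icc 1 h.m) : h.ratioSeq j = h.c.d (h.piece j) := by
  have := hj.1
  rw [ratioSeq, if_neg (by omega), if_pos hj.2]

lemma ratioSeq_mem (j : ℕ) (hj : 1 ≤ j) : h.ratioSeq j ∈ Set.Ioo (0 : ℝ) 1 := by
  by_cases hm : j ≤ h.m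
  · rw [h.ratioSeq_eq ⟨hj, hm⟩]
    exact h.d_mem _ (h.piece_lt j ⟨hj, hm⟩).1
  · rw [ratioSeq, if_neg (by omega), if_neg hm]
    norm_num

lemma width_eq {j : ℕ} (hj : 1 ≤ j) : h.width j = h.w j := by rw [width, if_neg (by omega)]

/-- The shift of column `j` from the first inner column, before the choice of the sign `-σ`. -/
def shiftSeq (j : ℕ) : ℝ :=
  h.width 0 + ∑ k ∈ Finset.range j, colSign k * h.width k * h.ratioSeq k

/-- The height of column `j` in the final state. -/
def heightSeq (j : ℕ) : ℝ := ∑ k ∈ Finset.range j, h.width k * √(1 - h.ratioSeq k ^ 2 * 1 ^ 2)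

lemma ratioSeq_zero : h.ratioSeq 0 = 1 := if_pos rfl

lemma shiftSeq_one : h.shiftSeq 1 = 0 := by simp [shiftSeq, colSign_zero, h.ratioSeq_zero]

lemma heightSeq_one : h.heightSeq 1 = 0 := by simp [heightSeq, h.ratioSeq_zero]

lemma shiftSeq_succ (j : ℕ) :
    h.shiftSeq (j + 1) = h.shiftSeq j + colSign j * h.width j * h.ratioSeq j := by
  rw [shiftSeq, shiftSeq, Finset.sum_range_succ, add_assoc]

lemma heightSeq_succ (j : ℕ) :
    h.heightSeq (j + 1) = h.heightSeq j + h.width j * √(1 - h.ratioSeq j ^ 2 * 1 ^ 2) := by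
  rw [heightSeq, heightSeq, Finset.sum_range_succ]

lemma zigzag_near :
    (∀ j ∈ Set.Icc 1 (h.m + 1), ∃ k < h.c.num, ∃ t ∈ Set.Icc (h.c.lo k) (h.c.hi k),
      |h.shiftSeq j - h.c.x k t| ≤ h.δ ∧ |h.heightSeq j - h.c.y k t| ≤ h.δ) ∧
    (∀ k < h.c.num, ∀ t ∈ Set.Icc (h.c.lo k) (h.c.hi k), ∃ j ∈ Set.Icc 1 (h.m + 1),
      |h.shiftSeq j - h.c.x k t| ≤ h.δ ∧ |h.heightSeq j - h.c.y k t| ≤ h.δ) := by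
  refine h.zigzag _ _ h.shiftSeq_one h.heightSeq_one (fun j h1 h2 => ?_) fun j h1 h2 => ?_
  · rw [shiftSeq_succ, h.width_eq h1, h.ratioSeq_eq ⟨h1, h2⟩]
  · rw [heightSeq_succ, h.width_eq h1, h.ratioSeq_eq ⟨h1, h2⟩, h.e_eq, one_pow, mul_one]

lemma width_le {j : ℕ} (hj : j ≤ h.m) : h.width j ≤ h.δ := by
  rcases Nat.eq_zero_or_pos j with rfl | h0
  · rw [width, if_pos rfl]
  · rw [h.width_eq h0]; exact (h.piece_lt j ⟨h0, hj⟩).2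

lemma width_pos (j : ℕ) : 0 < h.width j := by
  rw [width]
  split_ifs
  · exact h.δ_pos
  · exact h.w_pos j

lemma abs_shiftSeq_zero : |h.shiftSeq 0| = h.δ := by
  rw [shiftSeq, Finset.sum_range_zero, add_zero, width, if_pos rfl, abs_of_pos h.δ_pos]

/-- All columns are close to points of the profile, in their shifts. -/
lemma exists_profile_near {j : ℕ} (hj : j ≤ h.m + 1) : ∃ k < h.c.num,
    ∃ t ∈ Set.Icc (h.c.lo k) (h.c.hi k), |h.shiftSeq j - h.c.x k t| ≤ h.δ := by
  rcases Nat.eq_zero_or_pos j with rfl | h0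
  · refine ⟨0, h.c.num_pos, h.c.lo 0, ⟨le_rfl, h.c.le 0 h.c.num_pos⟩, ?_⟩
    rw [ProfileData.x, h.c.start_x, sub_zero, abs_shiftSeq_zero]
  · obtain ⟨k, hk, t, ht, e, -⟩ := h.zigzag_near.1 j ⟨h0, hj⟩
    exact ⟨k, hk, t, ht, e⟩

/-- The creased paper of a mesh. -/
def paperData : PaperData where
  rows := 2 * h.M + 1
  cols := h.m
  σ := h.σ
  z := h.s.cotSeq h.M
  d := h.ratioSeq
  w := h.width
  ℓ := h.s.lenSeq h.M h.δ
  one_le_rows := by omega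
  one_le_cols := h.one_le
  σ_sq := h.σ_sq
  z_pos := SpineData.cotSeq_pos h.M_pos h.areaPos
  d_zero := h.ratioSeq_zero
  d_pos j := by
    rcases Nat.eq_zero_or_pos j with rfl | h0
    · rw [ratioSeq_zero]; exact one_pos
    · exact (h.ratioSeq_mem j h0).1
  d_lt j hj := (h.ratioSeq_mem j hj).2
  w_pos := h.width_pos
  length_pos i hi j hj := by
    obtain ⟨k, hk, t, ht, e⟩ := h.exists_profile_near hj
    have := h.length_pos i hi _ (h.range k hk t ht _ e)
    rw [neg_mul, neg_mul, ← sub_eq_add_neg] at this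
    exact this

/-- The direction of the first crease of the datum column. -/
def startDir : ℂ := h.s.dirSeq h.M 0

/-- The first vertex of the datum column. -/
def startVertex : ℂ := h.s.startPoint h.δ

/-- The final state of the paper of a mesh. -/
def final : ℕ × ℕ → E3 := h.paperData.motion h.startDir h.startVertex 1

lemma norm_startDir : ‖h.startDir‖ = 1 := h.s.norm_dirSeq h.M_pos 0

lemma dir_one (i : ℕ) : h.paperData.dir h.startDir 1 i = h.s.dirSeq h.M i := by
  induction i with
  | zero => rfl
  | succ i ih => rw [PaperData.dir_succ, ih, SpineData.dirSeq_succ h.M_pos h.areaPos]; rfl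

lemma spine_one (i : ℕ) :
    h.paperData.spine h.startDir h.startVertex 1 i = h.s.vertexSeq h.M h.δ i := by
  rw [PaperData.spine, SpineData.vertexSeq]
  simp only [dir_one]
  rfl

/-- The parameter of the datum curve that belongs to row `i`. -/
def param (i : ℕ) : ℝ := h.s.node h.M ((i - 1) / 2)

lemma param_mem (i : ℕ) : h.param i ∈ Set.Icc h.s.a h.s.b := h.s.node_mem h.M_pos _

lemma param_mono : Monotone h.param := fun _ _ hij =>
  h.s.node_mono (Nat.div_le_div_right (Nat.sub_le_sub_right hij 1))

lemma shift_near (i : ℕ) : ‖h.paperData.shift h.startDir 1 i - h.s.g (h.param i)‖ ≤ h.δ := by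
  have e : h.paperData.shift h.startDir 1 i =
      h.s.Dm (h.param i) * (h.s.cotSeq h.M i + Complex.I) := by
    rw [PaperData.shift, dir_one, Complex.ofReal_one, mul_one]
    exact SpineData.dirSeq_mul h.M_pos h.areaPos i
  rw [e, h.s.g_eq _ (h.param_mem i), ← mul_sub, norm_mul, h.s.normm _ (h.param_mem i), one_mul,
    add_sub_add_right_eq_sub, ← Complex.ofReal_sub, Complex.norm_real]
  exact h.cot_near i

lemma final_eq (i j : ℕ) : h.final (i, j) = spacePoint (h.s.vertexSeq h.M h.δ i
    - (h.σ * h.shiftSeq j : ℝ) * h.paperData.shift h.startDir 1 i) (h.heightSeq j) := by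
  rw [final, PaperData.motion, spine_one]
  rfl

/-- The point of the surface over the parameter `u` of the datum curve. -/
def target (u : ℝ) (k : ℕ) (t : ℝ) : E3 :=
  spacePoint (h.s.γ u - (h.σ * h.c.x k t : ℝ) * h.s.g u) (h.c.y k t)

lemma abs_σ : |h.σ| = 1 := by
  rw [← pow_left_inj₀ (abs_nonneg _) zero_le_one two_ne_zero, sq_abs, h.σ_sq, one_pow]

/-- Comparison of two points of space, given by points of the datum curve, shifts and heights. -/
lemma norm_spacePoint_sub_le {V V' H H' : ℂ} {σ x x' y y' : ℝ} (hσ : |σ| = 1) :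
    dist (spacePoint (V - (σ * x : ℝ) * H) y) (spacePoint (V' - (σ * x' : ℝ) * H') y') ≤
      ‖V - V'‖ + |x'| * ‖H - H'‖ + |x - x'| * ‖H‖ + |y - y'| := by
  rw [dist_eq_norm, spacePoint_sub]
  refine (norm_spacePoint_le _ _).trans ?_
  gcongr
  have e : V - (σ * x : ℝ) * H - (V' - (σ * x' : ℝ) * H') =
      (V - V') + (-(σ * x' : ℝ)) * (H - H') + (-(σ * (x - x') : ℝ)) * H := by push_cast; ring
  rw [e]
  refine (norm_add₃_le).trans ?_
  rw [norm_mul, norm_mul, norm_neg, norm_neg, Complex.norm_real, Complex.norm_real,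
    Real.norm_eq_abs, Real.norm_eq_abs, abs_mul, abs_mul, hσ, one_mul, one_mul]

variable {G R : ℝ}

lemma norm_shift_le (hδ : h.δ ≤ 1)
    (hG : ∀ u ∈ Set.Icc h.s.a h.s.b, ‖h.s.g u‖ ≤ G) (i : ℕ) :
    ‖h.paperData.shift h.startDir 1 i‖ ≤ G + 1 := by
  have h1 := norm_le_norm_add_norm_sub (h.s.g (h.param i)) (h.paperData.shift h.startDir 1 i)
  have h2 := hG _ (h.param_mem i)
  have h3 := h.shift_near i
  rw [norm_sub_rev] at h3
  linarith

lemma bound_nonneg (hG : ∀ u ∈ Set.Icc h.s.a h.s.b, ‖h.s.g u‖ ≤ G)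
    (hR : ∀ k < h.c.num, ∀ t ∈ Set.Icc (h.c.lo k) (h.c.hi k), |h.c.x k t| ≤ R) :
    0 ≤ G ∧ 0 ≤ R :=
  ⟨(norm_nonneg _).trans (hG h.s.a ⟨le_rfl, h.s.lt.le⟩),
    (abs_nonneg _).trans (hR 0 h.c.num_pos _ ⟨le_rfl, h.c.le 0 h.c.num_pos⟩)⟩

lemma abs_shiftSeq_le (hδ : h.δ ≤ 1)
    (hR : ∀ k < h.c.num, ∀ t ∈ Set.Icc (h.c.lo k) (h.c.hi k), |h.c.x k t| ≤ R)
    {j : ℕ} (hj : j ≤ h.m + 1) : |h.shiftSeq j| ≤ R + 1 := by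
  obtain ⟨k, hk, t, ht, e⟩ := h.exists_profile_near hj
  have h1 := hR k hk t ht
  have h2 := abs_sub_abs_le_abs_sub (h.shiftSeq j) (h.c.x k t)
  linarith

/-- A vertex of the final state is close to a point of the surface if its column is close to a point
of the profile. -/
lemma dist_final_target (hδ : h.δ ≤ 1)
    (hG : ∀ u ∈ Set.Icc h.s.a h.s.b, ‖h.s.g u‖ ≤ G)
    (hR : ∀ k < h.c.num, ∀ t ∈ Set.Icc (h.c.lo k) (h.c.hi k), |h.c.x k t| ≤ R)
    {i j k : ℕ} {t : ℝ} (hi : i ≤ 2 * h.M + 2) (hk : k < h.c.num)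
    (ht : t ∈ Set.Icc (h.c.lo k) (h.c.hi k)) (h1 : |h.shiftSeq j - h.c.x k t| ≤ h.δ)
    (h2 : |h.heightSeq j - h.c.y k t| ≤ h.δ) :
    dist (h.final (i, j)) (h.target (h.param i) k t) ≤ (3 + R + G) * h.δ := by
  obtain ⟨hG0, hR0⟩ := h.bound_nonneg hG hR
  have hδ0 := h.δ_pos.le
  have b1 := h.vertex_near i hi
  have b2 := hR k hk t ht
  have b3 := h.shift_near i
  have b4 := h.norm_shift_le hδ hG i
  rw [final_eq, target]
  refine (norm_spacePoint_sub_le h.abs_σ).trans ?_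
  calc _ ≤ h.δ + R * h.δ + h.δ * (G + 1) + h.δ := by gcongr; exact b1
    _ = (3 + R + G) * h.δ := by ring

lemma dist_final_succ_col (hδ : h.δ ≤ 1)
    (hG : ∀ u ∈ Set.Icc h.s.a h.s.b, ‖h.s.g u‖ ≤ G) {i j : ℕ} (hj : j ≤ h.m) :
   
    dist (h.final (i, j)) (h.final (i, j + 1)) ≤ (2 + G) * h.δ := by
  have hG0 : 0 ≤ G := (norm_nonneg _).trans (hG h.s.a ⟨le_rfl, h.s.lt.le⟩)
  have hδ0 := h.δ_pos.le
  have b4 := h.norm_shift_le hδ hG i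
  have hw := h.width_le hj
  have hw0 := (h.width_pos j).le
  have hd : |h.ratioSeq j| ≤ 1 := by
    rcases Nat.eq_zero_or_pos j with rfl | h0
    · rw [ratioSeq_zero, abs_one]
    · have := h.ratioSeq_mem j h0
      rw [abs_of_pos this.1]; exact this.2.le
  have hs : |colSign j| = 1 := by
    rw [← pow_left_inj₀ (abs_nonneg _) zero_le_one two_ne_zero, sq_abs, colSign_sq, one_pow]
  have hq : √(1 - h.ratioSeq j ^ 2 * 1 ^ 2) ≤ 1 :=
    Real.sqrt_le_one.2 (by nlinarith [sq_nonneg (h.ratioSeq j)])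
  rw [final_eq, final_eq]
  refine (norm_spacePoint_sub_le h.abs_σ).trans ?_
  rw [shiftSeq_succ, heightSeq_succ, sub_self, sub_self, norm_zero, mul_zero, zero_add, zero_add,
    sub_add_cancel_left, sub_add_cancel_left, abs_neg, abs_neg, abs_mul, abs_mul, abs_mul,
    hs, one_mul, abs_of_nonneg hw0, abs_of_nonneg (Real.sqrt_nonneg _)]
  calc _ ≤ h.δ * 1 * (G + 1) + h.δ * 1 := by gcongr
    _ = (2 + G) * h.δ := by ring

lemma dist_final_succ_row (hδ : h.δ ≤ 1)
    (hG : ∀ u ∈ Set.Icc h.s.a h.s.b, ‖h.s.g u‖ ≤ G)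
    (hR : ∀ k < h.c.num, ∀ t ∈ Set.Icc (h.c.lo k) (h.c.hi k), |h.c.x k t| ≤ R)
    {i j : ℕ} (hi : i ≤ 2 * h.M + 1) (hj : j ≤ h.m + 1) :
    dist (h.final (i, j)) (h.final (i + 1, j)) ≤ (6 + 3 * R) * h.δ := by
  obtain ⟨hG0, hR0⟩ := h.bound_nonneg hG hR
  have hδ0 := h.δ_pos.le
  have b1 := h.vertex_near i (by omega)
  have b1' := h.vertex_near (i + 1) (by omega)
  have b3 := h.shift_near i
  have b3' := h.shift_near (i + 1)
  have b5 := h.abs_shiftSeq_le hδ hR hj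
  have step : ‖h.s.γ (h.param (i + 1)) - h.s.γ (h.param i)‖ ≤ h.δ ∧
      ‖h.s.g (h.param (i + 1)) - h.s.g (h.param i)‖ ≤ h.δ := by
    rw [param, param]
    rcases (show (i + 1 - 1) / 2 = (i - 1) / 2 ∨ (i + 1 - 1) / 2 = (i - 1) / 2 + 1 by omega)
      with e | e
    · rw [e, sub_self, sub_self, norm_zero]; exact ⟨h.δ_pos.le, h.δ_pos.le⟩
    · rw [e]; exact h.step_near _
  have tri : ∀ {A B A' B' : ℂ}, ‖A - A'‖ ≤ h.δ → ‖B - B'‖ ≤ h.δ → ‖B' - A'‖ ≤ h.δ →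
      ‖A - B‖ ≤ 3 * h.δ := by
    intro A B A' B' h1 h2 h3
    have e : A - B = (A - A') - (B - B') - (B' - A') := by ring
    rw [e]
    have := norm_sub_le ((A - A') - (B - B')) (B' - A')
    have := norm_sub_le (A - A') (B - B')
    linarith
  rw [final_eq, final_eq]
  refine (norm_spacePoint_sub_le h.abs_σ).trans ?_
  rw [sub_self, sub_self, abs_zero, zero_mul, add_zero, add_zero]
  calc _ ≤ 3 * h.δ + (R + 1) * (3 * h.δ) := by
        refine add_le_add (tri b1 b1' step.1) (mul_le_mul b5 (tri b3 b3' step.2) (norm_nonneg _) ?_)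
        linarith
    _ = (6 + 3 * R) * h.δ := by ring

end Mesh

/-! ### Angles of the final state -/

lemma abs_arctan_sub_le (x y : ℝ) : |Real.arctan x - Real.arctan y| ≤ |x - y| := by
  have h := Convex.norm_image_sub_le_of_norm_deriv_le (f := Real.arctan) (C := 1) (s := Set.univ)
    (x := y) (y := x) (fun z _ => Real.differentiableAt_arctan z) (fun z _ => ?_) convex_univ
    (Set.mem_univ _) (Set.mem_univ _)
  · rwa [one_mul, Real.norm_eq_abs, Real.norm_eq_abs] at h
  · rw [Real.deriv_arctan, Real.norm_eq_abs, abs_of_pos (by positivity),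
      div_le_one (by positivity)]
    nlinarith [sq_nonneg z]

lemma hausdorffEDist_le_ofReal {E : Type*} [PseudoMetricSpace E] {s t : Set E} {r : ℝ}
    (h1 : ∀ x ∈ s, ∃ y ∈ t, dist x y ≤ r) (h2 : ∀ y ∈ t, ∃ x ∈ s, dist x y ≤ r) :
    Metric.hausdorffEDist s t ≤ ENNReal.ofReal r := by
  refine Metric.hausdorffEDist_le_of_mem_edist (fun x hx => ?_) fun y hy => ?_
  · obtain ⟨y, hy, h⟩ := h1 x hx
    exact ⟨y, hy, by rw [edist_dist]; exact ENNReal.ofReal_le_ofReal h⟩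
  · obtain ⟨x, hx, h⟩ := h2 y hy
    exact ⟨x, hx, by rw [edist_comm, edist_dist]; exact ENNReal.ofReal_le_ofReal h⟩

namespace Mesh

variable (h : Mesh)

lemma columnAngle_final {i : ℕ} (hi : i ∈ Set.Icc 1 (2 * h.M + 1)) :
    columnAngle h.final i = 2 * Real.arctan (h.s.cotSeq h.M i) := by
  have hz := SpineData.cotSeq_pos h.M_pos h.areaPos i
  obtain ⟨k, rfl⟩ := Nat.exists_eq_add_of_le' hi.1
  have hd := h.paperData.isDirection_motion h.startVertex h.norm_startDir 1
  have hin : inner ℝ (spacePoint (h.paperData.dir h.startDir 1 k) 0)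
      (spacePoint (h.paperData.dir h.startDir 1 (k + 1)) 0) =
      -Real.cos (2 * Real.arctan (h.s.cotSeq h.M (k + 1))) := by
    have hn := re_sq_add_im_sq (h.paperData.norm_dir h.norm_startDir 1 k)
    have ht : h.paperData.turn 1 (k + 1) ^ 2 = 1 / h.s.cotSeq h.M (k + 1) ^ 2 := by
      rw [PaperData.turn, div_pow, mul_pow, ← pow_mul, mul_comm, one_pow, mul_comm (k + 1), pow_mul]
      norm_num
      rfl
    rw [inner_spacePoint, PaperData.dir_succ, Complex.mul_re, Complex.mul_im, tanRot_re, ht,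
      Real.cos_two_mul, Real.cos_sq_arctan]
    have e : (1 - 1 / h.s.cotSeq h.M (k + 1) ^ 2) / (1 + 1 / h.s.cotSeq h.M (k + 1) ^ 2) =
        -(2 * (1 / (1 + h.s.cotSeq h.M (k + 1) ^ 2)) - 1) := by
      field_simp
      ring
    rw [e]
    linear_combination (-(2 * (1 / (1 + h.s.cotSeq h.M (k + 1) ^ 2)) - 1)) * hn
  have hca := hd.columnAngle_eq hi
  have h1 := Real.arctan_pos.2 hz
  have h2 := Real.arctan_lt_pi_div_two (h.s.cotSeq h.M (k + 1))
  rw [final, hca, Nat.add_sub_cancel, hin, neg_neg, Real.arccos_cos (by linarith) (by linarith)]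

variable {h} {β : ℝ → ℝ}

/-- The angles of the final state and the sector angles are close to those along the datum curve. -/
lemma angles_near {i : ℕ} (hi : i ∈ Set.Icc 1 (2 * h.M + 1))
    (hβ : ∀ u ∈ Set.Icc h.s.a h.s.b, β u ∈ Set.Ioo 0 Real.pi)
    (hcot : ∀ u ∈ Set.Icc h.s.a h.s.b, halfCot (h.s.Dm u) (h.s.Dp u) = Real.tan (β u / 2)) :
    |columnAngle h.final i - β (h.param i)| ≤ 2 * h.δ ∧
    ∀ r : ℝ, |r| ≤ 1 → |Real.arctan (h.σ * h.s.cotSeq h.M i * r)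
      - Real.arctan (h.σ * Real.tan (β (h.param i) / 2) * r)| ≤ h.δ := by
  have hc := h.cot_near i
  have hu := h.param_mem i
  rw [← param, hcot _ hu] at hc
  have hb := hβ _ hu
  constructor
  · have e : β (h.param i) = 2 * Real.arctan (Real.tan (β (h.param i) / 2)) := by
      rw [Real.arctan_tan (by linarith [hb.1, Real.pi_pos]) (by linarith [hb.2])]; ring
    rw [h.columnAngle_final hi]
    nth_rewrite 1 [e]
    rw [← mul_sub, abs_mul, abs_two]
    linarith [abs_arctan_sub_le (h.s.cotSeq h.M i) (Real.tan (β (h.param i) / 2))]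
  · intro r hr
    refine (abs_arctan_sub_le _ _).trans ?_
    rw [← sub_mul, ← mul_sub, abs_mul, abs_mul, h.abs_σ, one_mul]
    exact (mul_le_of_le_one_right (abs_nonneg _) hr).trans hc

variable {G R : ℝ}

lemma final_mem_foldedSet {i j : ℕ} (hi : i ≤ 2 * h.M + 1) (hj : j ∈ Set.Icc 1 (h.m + 1)) :
    h.final (i, j) ∈ h.paperData.paper.foldedSet h.final := by
  obtain ⟨k, rfl⟩ := Nat.exists_eq_add_of_le' hj.1
  refine Set.mem_iUnion₂.2 ⟨i, hi, Set.mem_iUnion₂.2 ⟨k, ?_, ?_⟩⟩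
  · exact Nat.le_of_succ_le_succ hj.2
  · exact subset_convexHull ℝ _ ⟨(i, k + 1), by simp [OrthodiagonalPaper.corners], rfl⟩

/-- The panels are small, so that each point of the folded paper is close to a vertex. -/
lemma exists_vertex_near (hδ : h.δ ≤ 1) (hG : ∀ u ∈ Set.Icc h.s.a h.s.b, ‖h.s.g u‖ ≤ G)
    (hR : ∀ k < h.c.num, ∀ t ∈ Set.Icc (h.c.lo k) (h.c.hi k), |h.c.x k t| ≤ R) {x : E3}
    (hx : x ∈ h.paperData.paper.foldedSet h.final) :
    ∃ i ≤ 2 * h.M + 1, ∃ j ∈ Set.Icc 1 (h.m + 1), dist x (h.final (i, j)) ≤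
      (8 + G + 3 * R) * h.δ := by
  obtain ⟨hG0, hR0⟩ := h.bound_nonneg hG hR
  have hδ0 := h.δ_pos.le
  obtain ⟨i, hi, hx⟩ := Set.mem_iUnion₂.1 hx
  obtain ⟨j, hj, hx⟩ := Set.mem_iUnion₂.1 hx
  change i ≤ 2 * h.M + 1 at hi
  change j ≤ h.m at hj
  refine ⟨i, hi, j + 1, ⟨by omega, by omega⟩, ?_⟩
  rw [← Metric.mem_closedBall]
  refine convexHull_min ?_ (convex_closedBall _ _) hx
  have c1 := h.dist_final_succ_col hδ hG (i := i) hj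
  have r1 := h.dist_final_succ_row hδ hG hR hi (j := j) (by omega)
  have r2 := h.dist_final_succ_row hδ hG hR hi (j := j + 1) (by omega)
  have tri := dist_triangle (h.final (i + 1, j)) (h.final (i, j)) (h.final (i, j + 1))
  rw [dist_comm (h.final (i + 1, j)) (h.final (i, j))] at tri
  have q1 : 0 ≤ G * h.δ := mul_nonneg hG0 hδ0
  have q2 : 0 ≤ R * h.δ := mul_nonneg hR0 hδ0
  rintro _ ⟨v, hv, rfl⟩
  rw [Metric.mem_closedBall]
  simp only [OrthodiagonalPaper.corners, Set.mem_insert_iff, Set.mem_singleton_iff] at hv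
  rcases hv with rfl | rfl | rfl | rfl
  · linarith
  · linarith
  · rw [dist_self]; nlinarith
  · rw [dist_comm]; linarith

end Mesh

/-! ### Approximation of the stitched surface -/

section approximation

variable {Γ : ℝ → EuclideanSpace ℝ (Fin 2)} {a b σ : ℝ} {α₀ β : ℝ → ℝ} {K : ℕ∞}
  {p : ℕ → SurfacePiece}

/-- A mesh for the stitched surface which is as fine as desired, compared to bounds `G` and `R` of
the shift field and of the profile. -/
lemma exists_mesh (hab : a < b) (hσ : σ = 1 ∨ σ = -1) (hΓ : ContDiffOn ℝ 2 Γ (Set.Icc a b))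
    (hΓ' : ∀ u ∈ Set.Icc a b, derivWithin Γ (Set.Icc a b) u ≠ 0)
    (hβ : ContDiffOn ℝ 1 β (Set.Icc a b)) (hβ' : ∀ u ∈ Set.Icc a b, β u ∈ Set.Ioo 0 Real.pi)
    (hα : ∀ u ∈ Set.Icc a b, α₀ u = Real.pi / 2 - σ * (β u / 2)) {N : ℕ}
    (hNK : ∀ k < N, (k : ℕ∞) < K)
    (hp : ∀ k : ℕ, (k : ℕ∞) < K → (p k).Admissible Γ a b α₀ β) {c : ProfileData}
    (hcN : c.num = N) (hcI : ∀ k, c.lo k = (p k).lo ∧ c.hi k = (p k).hi)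
    (hcd : ∀ k, c.d k = (p k).ratio a α₀ ∧ c.e k = √(1 - (p k).ratio a α₀ ^ 2))
    (hcx : ∀ k t, c.x k t = -σ * (p k).profileX a α₀ β t ∧ c.y k t = (p k).profileZ a α₀ β t)
    {ε : ℝ} (hε : 0 < ε) :
    ∃ h : Mesh, h.c = c ∧ h.σ = σ ∧ h.δ ≤ ε ∧ h.s.a = a ∧ h.s.b = b ∧
      (h.s.γ = fun u => planeC (Γ u)) ∧ h.s.g = shiftC Γ a b β ∧ h.s.Dm = creaseM Γ a b β ∧
      h.s.Dp = creaseP Γ a b β ∧ Monotone h.piece := by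
  have hσ2 : σ * σ = 1 := by rcases hσ with rfl | rfl <;> norm_num
  have hcone : ∀ k < c.num, ∀ t ∈ Set.Icc (c.lo k) (c.hi k), InCone Γ a b β (-σ * c.x k t) := by
    intro k hk t ht
    rw [(hcI k).1, (hcI k).2] at ht
    rw [(hcx k t).1, ← mul_assoc, neg_mul_neg, hσ2, one_mul]
    exact (hp k (hNK k (hcN ▸ hk))).inCone hab hΓ hΓ' hβ hβ' hσ hα ht
  obtain ⟨k₁, hk₁, t₁, ht₁, hmin⟩ := c.exists_min_x
  obtain ⟨k₂, hk₂, t₂, ht₂, hmax⟩ := c.exists_max_x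
  obtain ⟨μ₁, hμ₁, H₁⟩ := (hcone k₁ hk₁ t₁ ht₁).exists_margin hab hΓ hΓ' hβ hβ'
  obtain ⟨μ₂, hμ₂, H₂⟩ := (hcone k₂ hk₂ t₂ ht₂).exists_margin hab hΓ hΓ' hβ hβ'
  set δ := min ε (min μ₁ μ₂) with hδ
  have hδ0 : 0 < δ := lt_min hε (lt_min hμ₁ hμ₂)
  have hδ1 : δ ≤ μ₁ := (min_le_right _ _).trans (min_le_left _ _)
  have hδ2 : δ ≤ μ₂ := (min_le_right _ _).trans (min_le_right _ _)
  have hσa : |σ| = 1 := by rcases hσ with rfl | rfl <;> simp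
  have i1 : InCone Γ a b β (-σ * (c.x k₁ t₁ - δ)) := H₁ _ (by
    rw [← mul_sub, sub_sub_cancel_left, neg_mul_neg, abs_mul, hσa, one_mul, abs_of_pos hδ0]
    exact hδ1)
  have i2 : InCone Γ a b β (-σ * (c.x k₂ t₂ + δ)) := H₂ _ (by
    rw [← mul_sub, add_sub_cancel_left, neg_mul, abs_neg, abs_mul, hσa, one_mul, abs_of_pos hδ0]
    exact hδ2)
  -- the extreme shifts, in the order that depends on the sign
  obtain ⟨Xlo, Xhi, j1, j2, hX⟩ : ∃ Xlo Xhi, InCone Γ a b β Xlo ∧ InCone Γ a b β Xhi ∧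
      ∀ x, c.x k₁ t₁ - δ ≤ x → x ≤ c.x k₂ t₂ + δ → -σ * x ∈ Set.Icc Xlo Xhi := by
    rcases hσ with rfl | rfl
    · exact ⟨_, _, i2, i1, fun x h1 h2 => ⟨by linarith, by linarith⟩⟩
    · exact ⟨_, _, i1, i2, fun x h1 h2 => ⟨by linarith, by linarith⟩⟩
  set s := SpineData.ofDatum hab hΓ hΓ' hβ hβ' Xlo Xhi j1 j2 with hs
  obtain ⟨m, w, piece, z1, z2, z3, z4, z5⟩ := c.exists_zigzag hδ0
  obtain ⟨M, r1, r2, r3, r4, r5, r6, r7⟩ := s.exists_rows hδ0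
  refine ⟨{ s := s
            c := c
            σ := σ
            δ := δ
            M := M
            m := m
            w := w
            piece := piece
            σ_sq := by rw [sq, hσ2]
            δ_pos := hδ0
            M_pos := r1
            areaPos := r2
            length_pos := r3
            vertex_near := r4
            cot_near := r5
            step_near := r6
            dense := r7
            one_le := z1
            w_pos := z2
            piece_lt := z4
            zigzag := z5
            d_mem := fun k hk => by
              rw [(hcd k).1]
              exact (hp k (hNK k (hcN ▸ hk))).ratio_mem hab.le hσ hα hβ'
            e_eq := fun k => by rw [(hcd k).1, (hcd k).2]
            range := fun k hk t ht x hx => by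
              have := abs_le.1 hx
              exact hX x (by linarith [hmin k hk t ht]) (by linarith [hmax k hk t ht]) },
    rfl, rfl, min_le_left _ _, rfl, rfl, rfl, rfl, rfl, rfl, z3⟩

/-- The stitched surface is approximated by folded papers. The sign `σ` is `1` if the sector
angles `α₀` to the left of the first column are acute, and `-1` if they are obtuse. -/
theorem exists_paper_of_stitchedSurface (hab : a < b) (hσ : σ = 1 ∨ σ = -1)
    (hΓ : ContDiffOn ℝ 2 Γ (Set.Icc a b))
    (hΓ' : ∀ u ∈ Set.Icc a b, derivWithin Γ (Set.Icc a b) u ≠ 0)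
    (hβ : ContDiffOn ℝ 1 β (Set.Icc a b)) (hβ' : ∀ u ∈ Set.Icc a b, β u ∈ Set.Ioo 0 Real.pi)
    (hα : ∀ u ∈ Set.Icc a b, α₀ u = Real.pi / 2 - σ * (β u / 2)) (hK : 0 < K)
    (hp : ∀ k : ℕ, (k : ℕ∞) < K → (p k).Admissible Γ a b α₀ β)
    (h0 : (p 0).f (p 0).lo = 0)
    (hst : ∀ k : ℕ, ((k + 1 : ℕ) : ℕ∞) < K → ∀ u ∈ Set.Icc a b,
      (p (k + 1)).param Γ a b β u (p (k + 1)).lo = (p k).param Γ a b β u (p k).hi)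
    (hS : Bornology.IsBounded (stitchedSurface K p Γ a b β)) {ε : ℝ} (hε : 0 < ε) :
    ∃ (P : OrthodiagonalPaper) (φ : ℝ → ℕ × ℕ → E3) (piece : ℕ → ℕ) (u : ℕ → ℝ),
      P.HaltingAngles ∧ P.IsHaltingMotion φ ∧
      (∀ j ∈ Set.Icc 1 P.cols, (piece j : ℕ∞) < K) ∧
      MonotoneOn piece (Set.Icc 1 P.cols) ∧
      (∀ j, 1 ≤ j → j + 1 ≤ P.cols → piece (j + 1) = piece j → P.α 1 (j + 1) = P.α 1 j) ∧
      MonotoneOn u (Set.Icc 1 P.rows) ∧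
      (∀ i ∈ Set.Icc 1 P.rows, u i ∈ Set.Icc a b) ∧
      (∀ i ∈ Set.Icc 1 P.rows, |columnAngle (φ 1) i - β (u i)| ≤ ε ∧
        |P.α i 0 - α₀ (u i)| ≤ ε ∧
        ∀ j ∈ Set.Icc 1 P.cols, |P.α i j - (p (piece j)).α (u i)| ≤ ε) ∧
      Metric.hausdorffEDist ((fun i => φ 1 (i, 1)) '' Set.Icc 1 P.rows)
        ((fun v => liftPlane (Γ v)) '' Set.Icc a b) ≤ ENNReal.ofReal ε ∧
      (∀ i ∈ Set.Icc 1 P.rows,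
        Metric.hausdorffEDist ((fun j => φ 1 (i, j)) '' Set.Icc 1 (P.cols + 1))
          (stitchedCurve K p Γ a b β (u i)) ≤ ENNReal.ofReal ε) ∧
      Metric.hausdorffEDist (P.foldedSet (φ 1)) (stitchedSurface K p Γ a b β)
        ≤ ENNReal.ofReal ε := by
  have ha : a ∈ Set.Icc a b := ⟨le_rfl, hab.le⟩
  have hσ2 : σ * σ = 1 := by rcases hσ with rfl | rfl <;> norm_num
  obtain ⟨R, hR⟩ := exists_profile_bound hab hσ hα hΓ' hβ' hp hS
  obtain ⟨G, hG⟩ : ∃ G, ∀ u ∈ Set.Icc a b, ‖shiftC Γ a b β u‖ ≤ G :=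
    isCompact_Icc.exists_bound_of_continuousOn (contDiffOn_shiftC hab hΓ hΓ' hβ hβ').continuousOn
  have hG0 : 0 ≤ G := (norm_nonneg _).trans (hG a ha)
  have hR0 : 0 ≤ R := (abs_nonneg _).trans (hR 0 hK _ ⟨le_rfl, (hp 0 hK).le⟩).1
  -- `C δ` bounds all the errors that occur at the scale `δ`
  set C := 11 + 4 * R + 2 * G with hC
  have hC0 : 0 < C := by positivity
  set ε' := min 1 (ε / C) with hε'
  have hε'0 : 0 < ε' := lt_min one_pos (div_pos hε hC0)
  obtain ⟨N, hN, hNK, hNear⟩ := exists_finite_pieces (K := K)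
    (x := fun k => (p k).profileX a α₀ β) (y := fun k => (p k).profileZ a α₀ β)
    (I := fun k => Set.Icc (p k).lo (p k).hi) hK hR hε'0
  obtain ⟨c, hcN, hcI, hcd, hcx⟩ := exists_profile hab hσ hα hΓ' hβ' hp hN hNK h0 hst
  obtain ⟨h, rfl, rfl, hδ, rfl, rfl, hγ, hg, hm, hpp, hmono⟩ := exists_mesh hab hσ hΓ hΓ' hβ hβ' hα
    hNK hp hcN hcI hcd hcx hε'0
  have hδ1 : h.δ ≤ 1 := hδ.trans (min_le_left _ _)
  have hCε : C * ε' ≤ ε := by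
    calc C * ε' ≤ C * (ε / C) := mul_le_mul_of_nonneg_left (min_le_right _ _) hC0.le
      _ = ε := mul_div_cancel₀ _ hC0.ne'
  have hδ0 := h.δ_pos.le
  have hG' : ∀ u ∈ Set.Icc h.s.a h.s.b, ‖h.s.g u‖ ≤ G := by rw [hg]; exact hG
  have hR' : ∀ k < h.c.num, ∀ t ∈ Set.Icc (h.c.lo k) (h.c.hi k), |h.c.x k t| ≤ R := by
    intro k hk t ht
    rw [(hcI k).1, (hcI k).2] at ht
    rw [(hcx k t).1, abs_mul, abs_neg, h.abs_σ, one_mul]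
    exact (hR k (hNK k (hcN ▸ hk)) t ht).1
  have hcot : ∀ u ∈ Set.Icc h.s.a h.s.b, halfCot (h.s.Dm u) (h.s.Dp u) = Real.tan (β u / 2) := by
    rw [hm, hpp]
    exact fun u hu => halfCot_crease (hΓ' u hu) (hβ' u hu)
  have htarget : ∀ k < h.c.num, ∀ u ∈ Set.Icc h.s.a h.s.b, ∀ t,
      h.target u k t = (p k).param Γ h.s.a h.s.b β u t := by
    intro k hk u hu t
    rw [param_eq_spacePoint hab hσ hα hβ' (hp k (hNK k (hcN ▸ hk))) hu, Mesh.target, (hcx k t).1,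
      (hcx k t).2, hγ, hg, neg_mul, mul_neg, ← mul_assoc, hσ2, one_mul]
    congr 1
    push_cast
    ring
  -- every point of the surface is close to a point of the finitely many pieces, over the same `u`
  have hfin : ∀ k : ℕ, (k : ℕ∞) < K → ∀ t ∈ Set.Icc (p k).lo (p k).hi, ∃ k' < h.c.num,
      ∃ t' ∈ Set.Icc (h.c.lo k') (h.c.hi k'), ∀ u ∈ Set.Icc h.s.a h.s.b,
        dist (h.target u k' t') ((p k).param Γ h.s.a h.s.b β u t) ≤ (1 + G) * ε' := by
    intro k hk t ht
    obtain ⟨k', hk', t', ht', e1, e2⟩ := hNear k hk t ht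
    refine ⟨k', hcN ▸ hk', t', by rw [(hcI k').1, (hcI k').2]; exact ht', fun u hu => ?_⟩
    rw [htarget k' (hcN ▸ hk') u hu, param_eq_spacePoint hab hσ hα hβ' (hp k hk) hu,
      param_eq_spacePoint hab hσ hα hβ' (hp k' (hNK k' hk')) hu, dist_eq_norm, spacePoint_sub,
      add_sub_add_left_eq_sub, ← sub_mul, ← Complex.ofReal_sub]
    refine (norm_spacePoint_le _ _).trans ?_
    rw [norm_mul, Complex.norm_real, Real.norm_eq_abs]
    have := mul_le_mul e1 (hG u hu) (norm_nonneg _) hε'0.le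
    linarith
  have hrow : ∀ i ≤ 2 * h.M + 2, ∀ j ∈ Set.Icc 1 (h.m + 1), ∃ k < h.c.num,
      ∃ t ∈ Set.Icc (h.c.lo k) (h.c.hi k),
        dist (h.final (i, j)) (h.target (h.param i) k t) ≤ (3 + R + G) * h.δ := by
    intro i hi j hj
    obtain ⟨k, hk, t, ht, e1, e2⟩ := h.zigzag_near.1 j hj
    exact ⟨k, hk, t, ht, h.dist_final_target hδ1 hG' hR' hi hk ht e1 e2⟩
  have hrow' : ∀ i ≤ 2 * h.M + 2, ∀ k < h.c.num, ∀ t ∈ Set.Icc (h.c.lo k) (h.c.hi k),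
      ∃ j ∈ Set.Icc 1 (h.m + 1),
        dist (h.final (i, j)) (h.target (h.param i) k t) ≤ (3 + R + G) * h.δ := by
    intro i hi k hk t ht
    obtain ⟨j, hj, e1, e2⟩ := h.zigzag_near.2 k hk t ht
    exact ⟨j, hj, h.dist_final_target hδ1 hG' hR' hi hk ht e1 e2⟩
  have hmem : ∀ k < h.c.num, ∀ t ∈ Set.Icc (h.c.lo k) (h.c.hi k), ∀ u ∈ Set.Icc h.s.a h.s.b,
      h.target u k t ∈ stitchedCurve K p Γ h.s.a h.s.b β u := by
    intro k hk t ht u hu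
    rw [(hcI k).1, (hcI k).2] at ht
    exact ⟨k, hNK k (hcN ▸ hk), t, ht, htarget k hk u hu t⟩
  have hodd : ∀ q, h.param (2 * q + 1) = h.s.node h.M q := by
    intro q
    rw [Mesh.param, show (2 * q + 1 - 1) / 2 = q by omega]
  have e3 : (3 + R + G) * h.δ ≤ (3 + R + G) * ε' := mul_le_mul_of_nonneg_left hδ (by positivity)
  have e8 : (8 + G + 3 * R) * h.δ ≤ (8 + G + 3 * R) * ε' :=
    mul_le_mul_of_nonneg_left hδ (by positivity)
  have eR : R * h.δ ≤ R * ε' := mul_le_mul_of_nonneg_left hδ hR0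
  have pR : 0 ≤ R * ε' := by positivity
  have pG : 0 ≤ G * ε' := by positivity
  have hCe : C * ε' = 11 * ε' + 4 * (R * ε') + 2 * (G * ε') := by rw [hC]; ring
  refine ⟨h.paperData.paper, h.paperData.motion h.startDir h.startVertex, h.piece, h.param,
    h.paperData.haltingAngles, h.paperData.isHaltingMotion h.startVertex h.norm_startDir,
    ?_, ?_, ?_, ?_, ?_, ?_, ?_, ?_, ?_⟩
  · exact fun j hj => hNK _ (hcN ▸ (h.piece_lt j hj).1)
  · exact hmono.monotoneOn _
  · intro j hj1 hj2 hj
    change h.paperData.angle 1 (j + 1) = h.paperData.angle 1 j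
    have hj2' : j + 1 ≤ h.m := hj2
    have e : h.ratioSeq (j + 1) = h.ratioSeq j := by
      rw [h.ratioSeq_eq ⟨by omega, hj2'⟩, h.ratioSeq_eq ⟨hj1, by omega⟩, hj]
    rw [PaperData.angle, PaperData.angle]
    change _ - Real.arctan (_ * h.ratioSeq (j + 1)) = _ - Real.arctan (_ * h.ratioSeq j)
    rw [e]
  · exact h.param_mono.monotoneOn _
  · exact fun i _ => h.param_mem i
  · intro i hi
    have hu := h.param_mem i
    obtain ⟨n1, n2⟩ := Mesh.angles_near hi hβ' hcot
    have hb := hβ' _ hu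
    have e1 : ∀ j, h.paperData.paper.α i j =
        Real.pi / 2 - Real.arctan (h.σ * h.s.cotSeq h.M i * h.ratioSeq j) := fun _ => rfl
    refine ⟨?_, ?_, fun j hj => ?_⟩
    · refine n1.trans ?_
      linarith
    · have e2 : α₀ (h.param i) =
          Real.pi / 2 - Real.arctan (h.σ * Real.tan (β (h.param i) / 2) * 1) := by
        rw [hα _ hu, mul_one]
        congr 1
        have ht := Real.arctan_tan (x := β (h.param i) / 2) (by linarith [hb.1, Real.pi_pos])
          (by linarith [hb.2])
        rcases hσ with e | e
        · rw [e, one_mul, one_mul, ht]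
        · rw [e, neg_one_mul, neg_one_mul, Real.arctan_neg, ht]
      rw [e1, e2, h.ratioSeq_zero, sub_sub_sub_cancel_left, abs_sub_comm]
      refine (n2 1 (by simp)).trans ?_
      linarith
    · obtain ⟨hk, -⟩ := h.piece_lt j hj
      have hr := h.d_mem _ hk
      rw [e1, (hp _ (hNK _ (hcN ▸ hk))).α_eq hab.le hσ hα hβ' hu, ← (hcd _).1, h.ratioSeq_eq hj,
        sub_sub_sub_cancel_left, abs_sub_comm]
      refine (n2 _ (by rw [abs_of_pos hr.1]; exact hr.2.le)).trans ?_
      linarith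
  · have hcol : ∀ i ∈ Set.Icc 1 (2 * h.M + 1), ∀ v ∈ Set.Icc h.s.a h.s.b,
        ‖h.s.γ v - h.s.γ (h.param i)‖ ≤ h.δ → dist (h.final (i, 1)) (liftPlane (Γ v)) ≤ ε := by
      intro i hi v hv hle
      have b := h.vertex_near i (by have := hi.2; omega)
      have e : h.final (i, 1) = spacePoint (h.s.vertexSeq h.M h.δ i) 0 := by
        rw [Mesh.final_eq, h.shiftSeq_one, h.heightSeq_one]
        simp
      have e' : liftPlane (Γ v) = spacePoint (h.s.γ v) 0 := by rw [liftPlane_eq, hγ]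
      rw [e, e', dist_eq_norm, spacePoint_sub, sub_self, norm_spacePoint_zero]
      have tri := norm_sub_le_norm_sub_add_norm_sub (h.s.vertexSeq h.M h.δ i)
        (h.s.γ (h.param i)) (h.s.γ v)
      rw [norm_sub_rev (h.s.γ (h.param i))] at tri
      change ‖h.s.vertexSeq h.M h.δ i - h.s.γ (h.param i)‖ ≤ h.δ at b
      linarith
    refine hausdorffEDist_le_ofReal ?_ ?_
    · rintro _ ⟨i, hi, rfl⟩
      exact ⟨_, ⟨h.param i, h.param_mem i, rfl⟩, hcol i hi _ (h.param_mem i) (by simpa using hδ0)⟩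
    · rintro _ ⟨v, hv, rfl⟩
      obtain ⟨q, hq, d1, -⟩ := h.dense v hv
      refine ⟨_, ⟨2 * q + 1, ⟨by omega, ?_⟩, rfl⟩, ?_⟩
      · change 2 * q + 1 ≤ 2 * h.M + 1; omega
      · exact hcol _ ⟨by omega, by omega⟩ v hv (by rw [hodd]; exact d1)
  · intro i hi
    have hi2 : i ≤ 2 * h.M + 1 := hi.2
    have hu := h.param_mem i
    refine hausdorffEDist_le_ofReal ?_ ?_
    · rintro _ ⟨j, hj, rfl⟩
      obtain ⟨k, hk, t, ht, d⟩ := hrow i (by omega) j hj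
      refine ⟨_, hmem k hk t ht _ hu, d.trans ?_⟩
      linarith
    · rintro _ ⟨k, hk, t, ht, rfl⟩
      obtain ⟨k', hk', t', ht', d'⟩ := hfin k hk t ht
      obtain ⟨j, hj, d⟩ := hrow' i (by omega) k' hk' t' ht'
      refine ⟨_, ⟨j, hj, rfl⟩, (dist_triangle _ _ _).trans ((add_le_add d (d' _ hu)).trans ?_)⟩
      linarith
  · refine hausdorffEDist_le_ofReal ?_ ?_
    · intro x hx
      obtain ⟨i, hi, j, hj, d⟩ := Mesh.exists_vertex_near hδ1 hG' hR' hx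
      obtain ⟨k, hk, t, ht, d'⟩ := hrow i (by omega) j hj
      refine ⟨_, Set.mem_iUnion₂.2 ⟨_, h.param_mem i, hmem k hk t ht _ (h.param_mem i)⟩,
        (dist_triangle _ _ _).trans ((add_le_add d d').trans ?_)⟩
      linarith
    · intro y hy
      obtain ⟨u, hu, k, hk, t, ht, rfl⟩ := Set.mem_iUnion₂.1 hy
      obtain ⟨k', hk', t', ht', d'⟩ := hfin k hk t ht
      obtain ⟨q, hq, g1, g2⟩ := h.dense u hu
      obtain ⟨j, hj, d⟩ := hrow' (2 * q + 1) (by omega) k' hk' t' ht'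
      rw [hodd] at d
      have d2 : dist (h.target (h.s.node h.M q) k' t') (h.target u k' t') ≤ h.δ + R * h.δ := by
        rw [dist_comm]
        refine (Mesh.norm_spacePoint_sub_le h.abs_σ).trans ?_
        rw [sub_self, sub_self, abs_zero, zero_mul, add_zero, add_zero]
        exact add_le_add g1 (mul_le_mul (hR' k' hk' t' ht') g2 (norm_nonneg _) hR0)
      refine ⟨_, Mesh.final_mem_foldedSet (show 2 * q + 1 ≤ 2 * h.M + 1 by omega) hj,
        (dist_triangle4 _ _ _ _).trans ((add_le_add (add_le_add d d2) (d' u hu)).trans ?_)⟩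
      linarith

end approximation

end

theorem mainTheorem3 :
    -- the rows of a folded paper
    (∀ (P : OrthodiagonalPaper) (F : ℕ × ℕ → EuclideanSpace ℝ (Fin 3)) (l r : ℕ) (θ : ℝ),
      P.HaltingAngles → P.IsFinal F → 1 ≤ l → l < r → r ≤ P.cols + 1 →
      (∀ j, l ≤ j → j + 1 < r → P.α 1 (j + 1) = P.α 1 j) →
      (∀ i ∈ Set.Icc 1 P.rows, ∀ j, l ≤ j → j < r → P.α i j = P.α i l) ∧
      (∀ i ∈ Set.Icc 1 P.rows, ∀ j, l < j → j < r →
        ∠ (F (i, j - 1)) (F (i, j)) (F (i, j + 1)) = creaseAngle (P.α i l) (columnAngle F i) ∧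
        Real.cos (∠ (F (i, j - 1)) (F (i, j)) (F (i, j + 1)))
          = 4 * Real.cos (P.α i l) ^ 2 / (1 - Real.cos (columnAngle F i)) - 1) ∧
      ∃ (ν : EuclideanSpace ℝ (Fin 3)) (x y : ℕ → EuclideanSpace ℝ (Fin 3))
        (g : ℕ → ℕ → Fin 2 → ℝ),
        ‖ν‖ = 1 ∧
        (∀ i ≤ P.rows + 1, inner ℝ ν (F (i, 1) - F (0, 1)) = 0) ∧
        ∀ i ∈ Set.Icc 1 P.rows,
          ‖x i‖ = 1 ∧ ‖y i‖ = 1 ∧ inner ℝ (x i) (y i) = 0 ∧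
          ν ∈ Submodule.span ℝ {x i, y i} ∧
          (∀ j ∈ Set.Icc l r, F (i, j) = F (i, l) + (g i j 0 • x i + g i j 1 • y i)) ∧
          MonotoneOn (fun j => (shearRotation (creaseAngle (P.α i l) (columnAngle F i)) θ
            *ᵥ g i j) 0) (Set.Icc l r) ∧
          AntitoneOn (fun j => (shearRotation (creaseAngle (P.α i l) (columnAngle F i)) θ
            *ᵥ g i j) 1) (Set.Icc l r) ∧
          ∀ j ∈ Set.Icc l r, g i j =
            rowMatrix (P.α 1 l) (columnAngle F 1) (P.α i l) (columnAngle F i) θ *ᵥ g 1 j) ∧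
    -- the approximation of the stitched surface
    (∀ (a b : ℝ) (Γ : ℝ → EuclideanSpace ℝ (Fin 2)) (α₀ β : ℝ → ℝ) (K : ℕ∞)
      (p : ℕ → SurfacePiece),
      a < b → ContDiffOn ℝ 2 Γ (Set.Icc a b) →
      (∀ u ∈ Set.Icc a b, derivWithin Γ (Set.Icc a b) u ≠ 0) →
      ContDiffOn ℝ 1 β (Set.Icc a b) → (∀ u ∈ Set.Icc a b, β u ∈ Set.Ioo 0 Real.pi) →
      ((∀ u ∈ Set.Icc a b, α₀ u = (Real.pi + β u) / 2) ∨
        (∀ u ∈ Set.Icc a b, α₀ u = (Real.pi - β u) / 2)) →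
      0 < K → (∀ k : ℕ, (k : ℕ∞) < K → (p k).Admissible Γ a b α₀ β) →
      (p 0).f (p 0).lo = 0 →
      (∀ k : ℕ, ((k + 1 : ℕ) : ℕ∞) < K → ∀ u ∈ Set.Icc a b,
        (p (k + 1)).param Γ a b β u (p (k + 1)).lo = (p k).param Γ a b β u (p k).hi) →
      Bornology.IsBounded (stitchedSurface K p Γ a b β) →
      ∀ ε : ℝ, 0 < ε →
        ∃ (P : OrthodiagonalPaper) (φ : ℝ → ℕ × ℕ → EuclideanSpace ℝ (Fin 3))
          (piece : ℕ → ℕ) (u : ℕ → ℝ),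
          P.HaltingAngles ∧ P.IsHaltingMotion φ ∧
          -- the panels to the right of the first column are distributed over pieces
          (∀ j ∈ Set.Icc 1 P.cols, (piece j : ℕ∞) < K) ∧
          MonotoneOn piece (Set.Icc 1 P.cols) ∧
          (∀ j, 1 ≤ j → j + 1 ≤ P.cols → piece (j + 1) = piece j →
            P.α 1 (j + 1) = P.α 1 j) ∧
          -- the rows belong to parameters of the datum curve
          MonotoneOn u (Set.Icc 1 P.rows) ∧
          (∀ i ∈ Set.Icc 1 P.rows, u i ∈ Set.Icc a b) ∧
          (∀ i ∈ Set.Icc 1 P.rows, |columnAngle (φ 1) i - β (u i)| ≤ ε ∧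
            |P.α i 0 - α₀ (u i)| ≤ ε ∧
            ∀ j ∈ Set.Icc 1 P.cols, |P.α i j - (p (piece j)).α (u i)| ≤ ε) ∧
          -- the first column approximates the datum curve, the rows approximate the target curves
          Metric.hausdorffEDist ((fun i => φ 1 (i, 1)) '' Set.Icc 1 P.rows)
            ((fun v => liftPlane (Γ v)) '' Set.Icc a b) ≤ ENNReal.ofReal ε ∧
          (∀ i ∈ Set.Icc 1 P.rows,
            Metric.hausdorffEDist ((fun j => φ 1 (i, j)) '' Set.Icc 1 (P.cols + 1))
              (stitchedCurve K p Γ a b β (u i)) ≤ ENNReal.ofReal ε) ∧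
          -- the folded paper approximates the surface
          Metric.hausdorffEDist (P.foldedSet (φ 1)) (stitchedSurface K p Γ a b β)
            ≤ ENNReal.ofReal ε) := by
  constructor
  · intro P F l r θ hP hF hl hlr hr hrun
    exact OrthodiagonalPaper.rows_of_final_state P F l r θ hP hF hl hlr hr hrun
  · intro a b Γ α₀ β K p hab hΓ hΓ' hβ hβ' hα₀ hK hp h0 hst hS ε hε
    rcases hα₀ with hα₀ | hα₀
    · exact exists_paper_of_stitchedSurface (σ := -1) hab (Or.inr rfl) hΓ hΓ' hβ hβ'
        (fun u hu => by rw [hα₀ u hu]; ring) hK hp h0 hst hS hε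
    · exact exists_paper_of_stitchedSurface (σ := 1) hab (Or.inl rfl) hΓ hΓ' hβ hβ'
        (fun u hu => by rw [hα₀ u hu]; ring) hK hp h0 hst hS hε
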